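/- **Setting.** For even $N\ge 2$ let $\mathbb T=\mathbb Z/N\mathbb Z\simeq\{0,\dots,N-1\}$; $(x,x']\subset\mathbb T$ denotes the half-open interval from $x$ to $x'$ in the direction $x\mapsto x+1$ (empty if $x=x'$), $|(x,x']|$ its cardinality, and $\mathrm{dist}(x,x')=|(x,x']|\wedge|(x',x]|$. Put $\ell=\frac12(1+N^{-1/2})$, $r=\frac12(1-N^{-1/2})$, $\tau=r/\ell$, $\nu=1-2\sqrt{r\ell}$. Let $(a(x))_{x\in\mathbb T}$ be a random environment with $1/A\le a(x)\le A$. Given $a$, consider the exclusion process $\eta(t,x)\in\{0,1\}$ on $\mathbb T$ with $N/2$ particles, in which a particle jumps from $x$ to $x+1$ at rate $r\,a(x)$ and from $x+1$ to $x$ at rate $\ell\,a(x)$, jumps to occupied sites being forbidden, started from a deterministic configuration. Its height function is $h(0,x)=\sum_{0<y\le x}(2\eta(0,y)-1)$ for $x=0,\dots,N-1$; each jump from $x$ to $x+1$ decreases $h(t,x)$ by $2$ and each jump from $x+1$ to $x$ increases $h(t,x)$ by $2$. Let $$Z(t,x)=\tau^{\frac12h(t,x)}e^{\nu t}.$$ The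 initial condition is near stationary with exponent $\beta>0$ and constant $K$: for all $x,x'\in\mathbb T$, $$Z(0,x)\le K,\qquad |Z(0,x)-Z(0,x')|\le K\,(\mathrm{dist}(x,x')/N)^{\beta}.$$ **Good event.** Let $\Delta f(x)=f(x+1)+f(x-1)-2f(x)$. Let $Q(t;x,y)$ be the kernel of $e^{tH}$, $H=\sqrt{r\ell}\,a(x)\Delta-\nu(a(x)-1)$, let $p(t;x,y)$ be the kernel of $e^{\frac t2\Delta}$, and let $D=Q-p$. Put $R(x,x')=-\frac12\sum_{y\in(x,x']}(a(y)-1)$. Given $\alpha>0$, $w\in(0,1]$, $v\in(0,\alpha)$ and $\Lambda,T<\infty$, let $\Omega(w,v,\Lambda,T,N)$ be the event that $$\sup_{x\ne x'}\ |R(x,x')|\,\big(|(x,x']|/N\big)^{-\alpha}\le\Lambda$$ and that, for all $t\in[0,N^2T]$ and $x,x',y\in\mathbb T$, * $\sum_yQ(t;x,y)\le\Lambda$ and $Q(t;x,y)\le\Lambda(t+1)^{-1/2}$; * $|Q(t;x,y)-Q(t;x',y)|\le\Lambda\,\mathrm{dist}(x,x')^w(t+1)^{-(w+1)/2}$; *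 $\sum_y|Q(t;x,y)-Q(t;x',y)|\le\Lambda\,\mathrm{dist}(x,x')^w(t+1)^{-w/2}$; * $\sum_y|D(t;x,y)|\le\Lambda\,(tN^{-2})^{v/2}$; * $\sum_y|D(t;x,y)-D(t;x',y)|\le\Lambda\big(\mathrm{dist}(x,x')^w(1+t)^{-w/2}N^{-v}+(\mathrm{dist}(x,x')/N)^w\big)$; * $|D(t;x,y)-D(t;x',y)|\le\Lambda\big(\mathrm{dist}(x,x')^w(1+t)^{-(w+1)/2}N^{-v}+(\mathrm{dist}(x,x')/N)^w(1+t)^{-1/2}\big)$; * $\sup_{t'\in[t,t+1]}Q(t';x,y)\le\Lambda\,Q(t+1;x,y)$. **Proposition.** Fix $A>0$, $\alpha,\beta>0$, $K$, and $u\in(0,1)$, $v\in(0,\alpha)$, $k>1$, $\Lambda,T<\infty$. There is a finite constant $c$, depending only on these parameters, such that the following holds for every even $N$, every environment and every initial condition as above. Let $\Omega$ be the event $\Omega(w,v,\Lambda,T,N)$ with $w=u$ or with $w=1$, and write $\|Y\|_{\Omega,k}=\mathbb E\big[\,|Y|^k\mathbf 1_{\Omega}\,\big|\,a\,\big]^{1/k}$.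 Then, for all $x,x'\in\mathbb T$ and $t,t'\in[0,N^2T]$, almost surely, $$\|Z(t,x)\|_{\Omega,k}\le c,$$ $$\|Z(t,x)-Z(t,x')\|_{\Omega,k}\le c\,\Big(\frac{\mathrm{dist}(x,x')}{N}\Big)^{\frac u2\wedge\beta\wedge v},$$ $$\|Z(t',x)-Z(t,x)\|_{\Omega,k}\le c\,\Big(\frac{|t'-t|\vee1}{N^2}\Big)^{\frac u4\wedge\frac\beta2\wedge\frac v2}.$$ -/

import Mathlib

open MeasureTheory ProbabilityTheory Filter Topology
open scoped NNReal ENNReal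

namespace InhomASEP

noncomputable section

/-! ### Weakly asymmetric rates -/

/-- The homogeneous rate of jumps to the left, `ℓ = (1 + N^{-1/2}) / 2`. -/
def rateL (N : ℕ) : ℝ := (1 + (N : ℝ) ^ (-(1 / 2) : ℝ)) / 2

/-- The homogeneous rate of jumps to the right, `r = (1 - N^{-1/2}) / 2`. -/
def rateR (N : ℕ) : ℝ := (1 - (N : ℝ) ^ (-(1 / 2) : ℝ)) / 2

/-- `τ = r / ℓ`. -/
def tau (N : ℕ) : ℝ := rateR N / rateL N

/-- `ν = 1 - 2 √(r ℓ)`. -/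
def nu (N : ℕ) : ℝ := 1 - 2 * √(rateR N * rateL N)

/-! ### Geometry of the discrete torus `ZMod N` -/

/-- The half-open interval `(x, x']` of the discrete torus, run through in the direction
`x, x + 1, x + 2, …`; it is empty when `x' = x`. -/
def arc {N : ℕ} [NeZero N] (x x' : ZMod N) : Finset (ZMod N) :=
  Finset.univ.filter fun y => 0 < (y - x).val ∧ (y - x).val ≤ (x' - x).val

/-- Geodesic distance on the discrete torus, `|(x, x']| ∧ |(x', x]|`. -/
def torusDist {N : ℕ} [NeZero N] (x x' : ZMod N) : ℕ :=
  min (arc x x').card (arc x' x).card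

/-! ### The inhomogeneity and the discrete Hill-type operator

An environment is a function `a : ZMod N → ℝ`, the rate multiplier `a x` sitting on the
bond `(x, x + 1)`. -/

/-- The partial sums `R(x, x') = - (1/2) ∑_{y ∈ (x, x']} (a y - 1)`. -/
def partialSum {N : ℕ} [NeZero N] (a : ZMod N → ℝ) (x x' : ZMod N) : ℝ :=
  -(1 / 2) * ∑ y ∈ arc x x', (a y - 1)

/-- The discrete Hölder seminorm
`sup_{x, x'} |f (x, x')| / (|(x, x']| / N)^w`
(a supremum over a finite set; the terms with `x = x'` are `0`). -/
def holderSeminorm {N : ℕ} [NeZero N] (w : ℝ) (f : ZMod N → ZMod N → ℝ) : ℝ :=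
  ⨆ p : ZMod N × ZMod N, |f p.1 p.2| / (((arc p.1 p.2).card : ℝ) / N) ^ w

/-- The matrix of the discrete Laplacian `Δ f x = f (x + 1) + f (x - 1) - 2 f x`. -/
def laplacian (N : ℕ) : Matrix (ZMod N) (ZMod N) ℝ := fun x y =>
  (if y = x + 1 then 1 else 0) + (if y = x - 1 then 1 else 0) - 2 * (if y = x then 1 else 0)

/-- The matrix of the operator `√(r ℓ) a(x) Δ - ν (a(x) - 1)`. -/
def hill {N : ℕ} (a : ZMod N → ℝ) : Matrix (ZMod N) (ZMod N) ℝ := fun x y =>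
  √(rateR N * rateL N) * a x * laplacian N x y - nu N * (a x - 1) * (if y = x then 1 else 0)

/-- The kernel `Q(t; x, y)` of the semigroup generated by `hill a`. -/
def kernelQ {N : ℕ} [NeZero N] (a : ZMod N → ℝ) (t : ℝ) (x y : ZMod N) : ℝ :=
  NormedSpace.exp (t • hill a) x y

/-- The transition kernel of the simple random walk in continuous time, generated by `Δ / 2`. -/
def heatKernel (N : ℕ) [NeZero N] (t : ℝ) (x y : ZMod N) : ℝ :=
  NormedSpace.exp ((t / 2) • laplacian N) x y

/-- The difference of `kernelQ` and the heat kernel. -/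
def kernelDiff {N : ℕ} [NeZero N] (a : ZMod N → ℝ) (t : ℝ) (x y : ZMod N) : ℝ :=
  kernelQ a t x y - heatKernel N t x y

/-- The environments that make up the good event with parameters `w, v, Λ, T, N`; here `α` is
the Hölder exponent of the partial sums of the environment. -/
structure GoodEnv {N : ℕ} [NeZero N] (α w v Λ T : ℝ) (a : ZMod N → ℝ) : Prop where
  holder : holderSeminorm α (partialSum a) ≤ Λ
  sum_le : ∀ t, 0 ≤ t → t ≤ (N : ℝ) ^ 2 * T → ∀ x, ∑ y, kernelQ a t x y ≤ Λ
  sup_le : ∀ t, 0 ≤ t → t ≤ (N : ℝ) ^ 2 * T → ∀ x y, kernelQ a t x y ≤ Λ / √(t + 1)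
  grad_sup_le : ∀ t, 0 ≤ t → t ≤ (N : ℝ) ^ 2 * T → ∀ x x' y,
    |kernelQ a t x y - kernelQ a t x' y|
      ≤ (torusDist x x' : ℝ) ^ w / (t + 1) ^ ((w + 1) / 2) * Λ
  grad_sum_le : ∀ t, 0 ≤ t → t ≤ (N : ℝ) ^ 2 * T → ∀ x x',
    ∑ y, |kernelQ a t x y - kernelQ a t x' y|
      ≤ (torusDist x x' : ℝ) ^ w / (t + 1) ^ (w / 2) * Λ
  diff_sum_le : ∀ t, 0 ≤ t → t ≤ (N : ℝ) ^ 2 * T → ∀ x,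
    ∑ y, |kernelDiff a t x y| ≤ (t / (N : ℝ) ^ 2) ^ (v / 2) * Λ
  diff_grad_sum_le : ∀ t, 0 ≤ t → t ≤ (N : ℝ) ^ 2 * T → ∀ x x',
    ∑ y, |kernelDiff a t x y - kernelDiff a t x' y|
      ≤ ((torusDist x x' : ℝ) ^ w / (1 + t) ^ (w / 2) * (N : ℝ) ^ (-v)
          + ((torusDist x x' : ℝ) / N) ^ w) * Λ
  diff_grad_sup_le : ∀ t, 0 ≤ t → t ≤ (N : ℝ) ^ 2 * T → ∀ x x' y,
    |kernelDiff a t x y - kernelDiff a t x' y|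
      ≤ ((torusDist x x' : ℝ) ^ w / (1 + t) ^ ((w + 1) / 2) * (N : ℝ) ^ (-v)
          + ((torusDist x x' : ℝ) / N) ^ w / (1 + t) ^ (1 / 2 : ℝ)) * Λ
  local_le : ∀ t, 0 ≤ t → t ≤ (N : ℝ) ^ 2 * T → ∀ x y, ∀ t' ∈ Set.Icc t (t + 1),
    kernelQ a t' x y ≤ Λ * kernelQ a (t + 1) x y

/-- The good event: the random environment is a good one. -/
def goodEvent {N : ℕ} [NeZero N] {Ω : Type*} (α w v Λ T : ℝ) (a : Ω → ZMod N → ℝ) : Set Ω :=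
  {ω | GoodEnv α w v Λ T (a ω)}

/-! ### The exclusion process with its height function -/

/-- A particle configuration together with a height function. -/
abbrev State (N : ℕ) : Type := (ZMod N → Bool) × (ZMod N → ℤ)

/-- A particle jumps from `x` to `x + 1`: the height at `x` decreases by `2`. -/
def jumpRight {N : ℕ} (x : ZMod N) (s : State N) : State N :=
  (Function.update (Function.update s.1 x false) (x + 1) true,
    Function.update s.2 x (s.2 x - 2))

/-- A particle jumps from `x + 1` to `x`: the height at `x` increases by `2`. -/
def jumpLeft {N : ℕ} (x : ZMod N) (s : State N) : State N :=
  (Function.update (Function.update s.1 (x + 1) false) x true,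
    Function.update s.2 x (s.2 x + 2))

/-- The generator of the exclusion process in the environment `a`: a particle jumps from `x` to
`x + 1` at rate `r a(x)` and from `x + 1` to `x` at rate `ℓ a(x)`, if the target is empty. -/
def generator {N : ℕ} [NeZero N] (a : ZMod N → ℝ) (f : State N → ℝ) (s : State N) : ℝ :=
  ∑ x, a x *
    (rateR N * (if s.1 x = true ∧ s.1 (x + 1) = false then f (jumpRight x s) - f s else 0)
      + rateL N * (if s.1 (x + 1) = true ∧ s.1 x = false then f (jumpLeft x s) - f s else 0))

/-- The height function of a configuration at time zero, `h(x) = ∑_{0 < y ≤ x} (2 η(y) - 1)` for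
`x = 0, …, N - 1`. -/
def initialHeight {N : ℕ} (η : ZMod N → Bool) (x : ZMod N) : ℤ :=
  ∑ y ∈ Finset.Ioc 0 x.val, (2 * (if η (y : ZMod N) = true then 1 else 0) - 1)

/-- The filtration generated by the (random) environment and by the process up to time `t`. -/
def envFiltration {N : ℕ} {Ω : Type*} [mΩ : MeasurableSpace Ω] (a : Ω → ZMod N → ℝ)
    (X : ℝ≥0 → Ω → State N) (ha : Measurable a) (hX : ∀ t, Measurable (X t)) :
    Filtration ℝ≥0 mΩ where
  seq t := MeasurableSpace.comap a inferInstance ⊔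
    ⨆ s : ℝ≥0, ⨆ _ : s ≤ t, MeasurableSpace.comap (X s) inferInstance
  mono' _ _ hst := sup_le_sup le_rfl
    (iSup_mono fun _ => iSup_le fun hr => le_iSup_of_le (hr.trans hst) le_rfl)
  le' _ := sup_le ha.comap_le (iSup_le fun s => iSup_le fun _ => (hX s).comap_le)

/-- `X` is the inhomogeneous exclusion process, together with its height function, in the random
environment `a`, started from the deterministic configuration `η₀`: it has right-continuous paths
with left limits and, given the environment, it is the Markov process whose generator is
`generator a`, in the sense of the martingale problem. -/
structure IsASEP {N : ℕ} [NeZero N] {Ω : Type*} [MeasurableSpace Ω] (P : Measure Ω)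
    (a : Ω → ZMod N → ℝ) (η₀ : ZMod N → Bool) (X : ℝ≥0 → Ω → State N) : Prop where
  measurable_env : Measurable a
  measurable_process : ∀ t, Measurable (X t)
  initial : ∀ᵐ ω ∂P, X 0 ω = (η₀, initialHeight η₀)
  right_cont : ∀ ω t, ContinuousWithinAt (fun s => X s ω) (Set.Ici t) t
  left_lim : ∀ ω t, 0 < t → ∃ s₀, Tendsto (fun s => X s ω) (𝓝[<] t) (𝓝 s₀)
  martingale : ∀ f : State N → ℝ, (∃ C, ∀ s, |f s| ≤ C) →
    Martingale
      (fun (t : ℝ≥0) ω => f (X t ω) - ∫ s in (0 : ℝ)..t, generator (a ω) f (X s.toNNReal ω))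
      (envFiltration a X measurable_env measurable_process) P

/-! ### The Gärtner transform and conditional norms -/

/-- `τ^{h/2} e^{ν t}`. -/
def gaertner (N : ℕ) (t : ℝ) (h : ℤ) : ℝ := tau N ^ ((h : ℝ) / 2) * Real.exp (nu N * t)

/-- The Gärtner (microscopic Hopf-Cole) transform `Z(t, x)` of the process `X`. -/
def Z {N : ℕ} {Ω : Type*} (X : ℝ≥0 → Ω → State N) (t : ℝ≥0) (x : ZMod N) (ω : Ω) : ℝ :=
  gaertner N t ((X t ω).2 x)

/-- The initial condition `η₀` is near stationary, with exponent `β` and constant `K`. -/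
def NearStationary {N : ℕ} [NeZero N] (β K : ℝ) (η₀ : ZMod N → Bool) : Prop :=
  (∀ x, gaertner N 0 (initialHeight η₀ x) ≤ K) ∧
  ∀ x x', |gaertner N 0 (initialHeight η₀ x) - gaertner N 0 (initialHeight η₀ x')|
    ≤ K * ((torusDist x x' : ℝ) / N) ^ β

/-- The conditional norm `E[ |Y|^k 1_G | a ]^{1/k}`, where `a` is the random environment; it takes
values in `[0, ∞]`. -/
def condNorm {N : ℕ} {Ω : Type*} [MeasurableSpace Ω] (P : Measure Ω) (a : Ω → ZMod N → ℝ)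
    (G : Set Ω) (k : ℝ) (Y : Ω → ℝ) (ω : Ω) : ℝ≥0∞ :=
  (condLExp (MeasurableSpace.comap a inferInstance) P
    (G.indicator fun ω' => ‖Y ω'‖ₑ ^ k) ω) ^ (1 / k)

end

end InhomASEP

/-! The Gärtner transform linearises the process: on configurations compatible with their heights,
the generator sends `Z(y)` to the Hill operator applied to `Z` (`jumpGen_expHeight`). Hence, for `s`
in `[0, t]`, the sum over `y` of `Q(t - s; x, y) Z(t₀ + s, y)` is a martingale, and `Z(t₀ + t, x)`
is the kernel `Q(t)` applied to `Z(t₀)` plus a stochastic convolution. A jump over `(x, x + 1)`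
changes `Z` at `x` only, by a relative amount of order `N^{-1/2}`, so the bracket of the convolution
has density at most a constant times `N⁻¹ ∑ Q² Z²`; no cancellation inside the bracket is needed
(`convolution_moment_le`). Even moments of martingales are bounded by Itô's formula and a maximum
argument that stands in for Burkholder's inequality (`martingale_moment_le`).

Uniform moments: the moments of `Z`, damped exponentially in time, are maximised over space and
time. Strong damping makes the noise contribute at most half of the maximum, so the initial data
bound it. Space increments: the noise sees `∑ (Q - Q')²`, which is at most of order `dist^u
r^{-(1+u)/2}`; as `u < 1` this is integrable and gives the exponent `u/2`. In the part without noise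
`Q = p + D`: the heat kernel commutes with translations, so it preserves the modulus of the initial
profile (exponent `β`), and the bounds on `D` give `v`. Time increments: the process is restarted at
the earlier time. The noise gives the power `1/4` of the rescaled time step, the heat kernel
averages spatial increments over distances of order the square root of the step, and `D` again gives
`v`.

All this is done in a fixed environment, without probability: expectations are positive linear
functionals on functions dominated by a weight, evolved by the exponential series of the generator.
Increments in time are handled on pairs of states whose first coordinate is frozen. The link with
the process is that the martingale problem determines the one- and two-time laws given the
environment (`integral_mul_process_eq`, `integral_pair_eq`). Countability of the state space extends
this to unbounded functions (`lintegral_pair_le`), and testing on events of the environment yields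
the conditional norms (`condLExp_rpow_le`). -/

namespace InhomASEP

/-! ### Jump generators and their semigroups -/

section JumpGenerator

variable {S J : Type*} [Fintype J]

/-- The generator of a Markov jump process with finitely many possible jumps. -/
def jumpGen (c : J → S → ℝ) (τ : J → S → S) : (S → ℝ) →ₗ[ℝ] (S → ℝ) where
  toFun f s := ∑ j, c j s * (f (τ j s) - f s)
  map_add' f g := by
    funext s
    simp only [Pi.add_apply, ← Finset.sum_add_distrib]
    exact Finset.sum_congr rfl fun j _ => by ring
  map_smul' r f := by
    funext s
    simp only [Pi.smul_apply, smul_eq_mul, RingHom.id_apply, Finset.mul_sum]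
    exact Finset.sum_congr rfl fun j _ => by ring

theorem jumpGen_apply (c : J → S → ℝ) (τ : J → S → S) (f : S → ℝ) (s : S) :
    jumpGen c τ f s = ∑ j, c j s * (f (τ j s) - f s) := rfl

/-- Functions dominated by a multiple of the weight `W`. -/
def Dom (W : S → ℝ) (g : S → ℝ) : Prop := ∃ C, ∀ s, |g s| ≤ C * W s

/-- A jump process with bounded rates that preserves the set `V` and increases the weight `W` at
most by a bounded factor. -/
structure JumpBounds (c : J → S → ℝ) (τ : J → S → S) (V : Set S) (W : S → ℝ) (κ R : ℝ) :
    Prop where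
  rate_nonneg : ∀ j s, 0 ≤ c j s
  rate_le : ∀ j s, c j s ≤ κ
  weight_nonneg : ∀ s, 0 ≤ W s
  weight_le : ∀ j s, W (τ j s) ≤ R * W s
  inv : ∀ j s, s ∈ V → c j s ≠ 0 → τ j s ∈ V
  kappa_nonneg : 0 ≤ κ
  ratio_nonneg : 0 ≤ R

/-- Positive linear functionals on the functions dominated by `W`. -/
structure PosFun (V : Set S) (W : S → ℝ) (Φ : (S → ℝ) → ℝ) : Prop where
  add : ∀ f g, Dom W f → Dom W g → Φ (f + g) = Φ f + Φ g
  smul : ∀ (r : ℝ) f, Dom W f → Φ (r • f) = r * Φ f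
  nonneg : ∀ f, Dom W f → (∀ s ∈ V, 0 ≤ f s) → 0 ≤ Φ f

/-- The functional `Φ` evolved by the semigroup generated by a linear map. -/
noncomputable def evol (L : (S → ℝ) →ₗ[ℝ] (S → ℝ)) (Φ : (S → ℝ) → ℝ) (t : ℝ) (g : S → ℝ) : ℝ :=
  ∑' n : ℕ, t ^ n / n.factorial * Φ ((L ^ n) g)

theorem Dom.add {W f g : S → ℝ} (hf : Dom W f) (hg : Dom W g) : Dom W (f + g) := by
  obtain ⟨C, hC⟩ := hf
  obtain ⟨D, hD⟩ := hg
  exact ⟨C + D, fun s => (abs_add_le _ _).trans (by rw [add_mul]; exact add_le_add (hC s) (hD s))⟩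

theorem Dom.smul {W f : S → ℝ} (r : ℝ) (hf : Dom W f) : Dom W (r • f) := by
  obtain ⟨C, hC⟩ := hf
  refine ⟨|r| * C, fun s => ?_⟩
  rw [Pi.smul_apply, smul_eq_mul, abs_mul, mul_assoc]
  exact mul_le_mul_of_nonneg_left (hC s) (abs_nonneg r)

theorem Dom.zero {W : S → ℝ} : Dom W 0 := ⟨0, fun s => by simp⟩

theorem Dom.neg {W f : S → ℝ} (hf : Dom W f) : Dom W (-f) := by
  simpa using hf.smul (-1)

theorem Dom.sub {W f g : S → ℝ} (hf : Dom W f) (hg : Dom W g) : Dom W (f - g) := by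
  rw [sub_eq_add_neg]; exact hf.add hg.neg

theorem Dom.sum {ι : Type*} {W : S → ℝ} (s : Finset ι) {f : ι → S → ℝ}
    (hf : ∀ i ∈ s, Dom W (f i)) : Dom W (∑ i ∈ s, f i) := by
  classical
  induction s using Finset.induction_on with
  | empty => simpa using Dom.zero
  | insert a s ha ih =>
    rw [Finset.sum_insert ha]
    exact (hf a (by simp)).add (ih fun i hi => hf i (by simp [hi]))

theorem Dom.weight {W : S → ℝ} (hW : ∀ s, 0 ≤ W s) : Dom W W :=
  ⟨1, fun s => by rw [abs_of_nonneg (hW s), one_mul]⟩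

namespace PosFun

variable {V : Set S} {W : S → ℝ} {Φ : (S → ℝ) → ℝ}

theorem sub (h : PosFun V W Φ) {f g : S → ℝ} (hf : Dom W f) (hg : Dom W g) :
    Φ (f - g) = Φ f - Φ g := by
  have : f - g = f + (-1 : ℝ) • g := by rw [neg_one_smul, sub_eq_add_neg]
  rw [this, h.add f _ hf (hg.smul _), h.smul _ _ hg]; ring

theorem mono (h : PosFun V W Φ) {f g : S → ℝ} (hf : Dom W f) (hg : Dom W g)
    (hfg : ∀ s ∈ V, f s ≤ g s) : Φ f ≤ Φ g := by
  have := h.nonneg (g - f) (hg.sub hf) fun s hs => sub_nonneg.2 (hfg s hs)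
  rw [h.sub hg hf] at this
  linarith

theorem congr (h : PosFun V W Φ) {f g : S → ℝ} (hf : Dom W f) (hg : Dom W g)
    (hfg : ∀ s ∈ V, f s = g s) : Φ f = Φ g :=
  le_antisymm (h.mono hf hg fun s hs => (hfg s hs).le) (h.mono hg hf fun s hs => (hfg s hs).ge)

theorem zero (h : PosFun V W Φ) : Φ 0 = 0 := by
  have := h.smul 0 0 Dom.zero
  simpa using this

theorem sum (h : PosFun V W Φ) {ι : Type*} (s : Finset ι) {f : ι → S → ℝ}
    (hf : ∀ i ∈ s, Dom W (f i)) : Φ (∑ i ∈ s, f i) = ∑ i ∈ s, Φ (f i) := by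
  classical
  induction s using Finset.induction_on with
  | empty => simpa using h.zero
  | insert a s ha ih =>
    rw [Finset.sum_insert ha, Finset.sum_insert ha,
      h.add _ _ (hf a (by simp)) (Dom.sum s fun i hi => hf i (by simp [hi])),
      ih fun i hi => hf i (by simp [hi])]

theorem abs_le (h : PosFun V W Φ) (hW : ∀ s, 0 ≤ W s) {f : S → ℝ} {C : ℝ}
    (hf : ∀ s, |f s| ≤ C * W s) : |Φ f| ≤ C * Φ W := by
  have hd : Dom W f := ⟨C, hf⟩
  have hw : Dom W W := Dom.weight hW
  rw [← h.smul C W hw, _root_.abs_le]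
  constructor
  · have := h.mono (hw.smul (-C)) hd fun s _ => by
      simpa using (_root_.abs_le.1 (hf s)).1
    rwa [h.smul _ _ hw, neg_mul, ← h.smul _ _ hw] at this
  · exact h.mono hd (hw.smul C) fun s _ => (_root_.abs_le.1 (hf s)).2

end PosFun

theorem posFun_eval {V : Set S} {W : S → ℝ} {s : S} (hs : s ∈ V) :
    PosFun V W fun f => f s where
  add _ _ _ _ := rfl
  smul _ _ _ := rfl
  nonneg _ _ h := h s hs

/-! #### Exponential series -/

theorem summable_exp_series {a : ℕ → ℝ} {C ρ : ℝ} (ha : ∀ n, |a n| ≤ C * ρ ^ n) (t : ℝ) :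
    Summable fun n : ℕ => t ^ n / n.factorial * a n := by
  refine Summable.of_norm_bounded (g := fun n : ℕ => C * ((|t| * ρ) ^ n / n.factorial))
    ((Real.summable_pow_div_factorial _).mul_left C) fun n => ?_
  rw [Real.norm_eq_abs, abs_mul, abs_div, abs_pow, Nat.abs_cast, mul_pow]
  calc |t| ^ n / n.factorial * |a n| ≤ |t| ^ n / n.factorial * (C * ρ ^ n) :=
        mul_le_mul_of_nonneg_left (ha n) (by positivity)
    _ = _ := by ring

theorem hasDerivAt_exp_series {a : ℕ → ℝ} {C ρ : ℝ} (ha : ∀ n, |a n| ≤ C * ρ ^ n) (t : ℝ) :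
    HasDerivAt (fun t : ℝ => ∑' n : ℕ, t ^ n / n.factorial * a n)
      (∑' n : ℕ, t ^ n / n.factorial * a (n + 1)) t := by
  have ha' : ∀ n, |a (n + 1)| ≤ (C * ρ) * ρ ^ n := fun n => (ha (n + 1)).trans_eq (by ring)
  set r : ℝ := |t| + 1
  have hr : 0 ≤ r := by positivity
  set d : ℕ → ℝ → ℝ := fun n t => (n * t ^ (n - 1)) / n.factorial * a n
  have hd0 : ∀ y, d 0 y = 0 := fun y => by simp [d]
  have hds : ∀ n y, d (n + 1) y = y ^ n / n.factorial * a (n + 1) := by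
    intro n y
    simp only [d, Nat.add_sub_cancel, Nat.factorial_succ]
    push_cast
    field_simp
  have key := hasDerivAt_tsum_of_isPreconnected
    (g := fun (n : ℕ) (t : ℝ) => t ^ n / n.factorial * a n) (g' := d)
    (u := fun n => |d n r|) (t := Metric.ball (0 : ℝ) r) (y₀ := 0) (y := t) ?_
    Metric.isOpen_ball (convex_ball _ _).isPreconnected ?_ ?_ ?_ ?_ ?_
  · have e : ∑' n, d n t = ∑' n : ℕ, t ^ n / n.factorial * a (n + 1) := by
      rw [Summable.tsum_eq_zero_add]
      · simp [hd0, hds]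
      · rw [← summable_nat_add_iff 1]
        simpa [hds] using summable_exp_series ha' t
    rwa [e] at key
  · rw [← summable_nat_add_iff 1]
    simpa only [hds] using (summable_exp_series ha' r).abs
  · intro n y _
    exact ((hasDerivAt_pow n y).div_const _).mul_const _
  · intro n y hy
    rcases n with _ | n
    · simp [hd0]
    · rw [hds, hds, Real.norm_eq_abs, abs_mul, abs_mul, abs_div, abs_div, abs_pow, abs_pow]
      have : |y| ≤ |r| := by
        rw [abs_of_nonneg hr]
        simpa using (mem_ball_zero_iff.1 hy).le
      gcongr
  · simpa using lt_of_le_of_lt (abs_nonneg t) (lt_add_one _)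
  · exact summable_exp_series ha 0
  · rw [mem_ball_zero_iff, Real.norm_eq_abs]
    exact lt_add_one _

theorem abs_exp_series_le {a : ℕ → ℝ} {C ρ : ℝ} (ha : ∀ n, |a n| ≤ C * ρ ^ n) {t : ℝ}
    (ht : 0 ≤ t) : |∑' n : ℕ, t ^ n / n.factorial * a n| ≤ C * Real.exp (ρ * t) := by
  have h1 : HasSum (fun n : ℕ => C * ((ρ * t) ^ n / n.factorial)) (C * Real.exp (ρ * t)) := by
    rw [Real.exp_eq_exp_ℝ]
    exact (NormedSpace.expSeries_div_hasSum_exp (𝔸 := ℝ) (ρ * t)).mul_left C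
  rw [← Real.norm_eq_abs]
  refine tsum_of_norm_bounded h1 fun n => ?_
  rw [Real.norm_eq_abs, abs_mul, abs_of_nonneg (by positivity : 0 ≤ t ^ n / n.factorial)]
  calc t ^ n / n.factorial * |a n| ≤ t ^ n / n.factorial * (C * ρ ^ n) :=
        mul_le_mul_of_nonneg_left (ha n) (by positivity)
    _ = _ := by rw [mul_pow]; ring

/-- The exponential series of a binomial transform. -/
theorem exp_series_binomial {a b : ℕ → ℝ} {C ρ : ℝ} (ha : ∀ n, |a n| ≤ C * ρ ^ n) (l : ℝ)
    (hb : ∀ n, b n = ∑ m ∈ Finset.range (n + 1), a m * l ^ (n - m) * n.choose m) (t : ℝ) :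
    ∑' n : ℕ, t ^ n / n.factorial * b n
      = (∑' n : ℕ, t ^ n / n.factorial * a n) * Real.exp (l * t) := by
  have h2 : Summable fun n : ℕ => (l * t) ^ n / (n.factorial : ℝ) :=
    Real.summable_pow_div_factorial _
  have h3 : Real.exp (l * t) = ∑' n : ℕ, (l * t) ^ n / (n.factorial : ℝ) := by
    rw [Real.exp_eq_exp_ℝ]
    exact (NormedSpace.expSeries_div_hasSum_exp (𝔸 := ℝ) (l * t)).tsum_eq.symm
  rw [h3, tsum_mul_tsum_eq_tsum_sum_range_of_summable_norm
    (f := fun n : ℕ => t ^ n / n.factorial * a n) (summable_exp_series ha t).norm h2.norm]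
  refine tsum_congr fun n => ?_
  rw [hb, Finset.mul_sum]
  refine Finset.sum_congr rfl fun m hm => ?_
  have hm : m ≤ n := Nat.lt_succ_iff.1 (Finset.mem_range.1 hm)
  rw [Nat.cast_choose ℝ hm, mul_pow]
  have : t ^ n = t ^ m * t ^ (n - m) := by rw [← pow_add, Nat.add_sub_cancel' hm]
  rw [this]
  have := Nat.factorial_ne_zero n
  field_simp

/-! #### The evolved functional -/

section Evol

variable {c : J → S → ℝ} {τ : J → S → S} {V : Set S} {W : S → ℝ} {κ R : ℝ} {Φ : (S → ℝ) → ℝ}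

/-- There are `card J` jumps of rate at most `κ`, each raising the weight by at most the factor `R`.
So the generator is bounded for the `W`-weighted sup norm, and its exponential series converges even
on unbounded functions. -/
theorem JumpBounds.abs_gen_le (h : JumpBounds c τ V W κ R) {f : S → ℝ} {C : ℝ}
    (hf : ∀ s, |f s| ≤ C * W s) (s : S) :
    |jumpGen c τ f s| ≤ C * (Fintype.card J * κ * (R + 1)) * W s := by
  rw [jumpGen_apply]
  have hC : 0 ≤ C * W s := (abs_nonneg _).trans (hf s)
  by_cases hCn : 0 ≤ C
  · refine (Finset.abs_sum_le_sum_abs _ _).trans ?_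
    calc ∑ j, |c j s * (f (τ j s) - f s)| ≤ ∑ _j : J, κ * (C * (R + 1) * W s) := by
          refine Finset.sum_le_sum fun j _ => ?_
          rw [abs_mul, abs_of_nonneg (h.rate_nonneg j s)]
          refine mul_le_mul (h.rate_le j s) ?_ (abs_nonneg _) h.kappa_nonneg
          calc |f (τ j s) - f s| ≤ |f (τ j s)| + |f s| := abs_sub _ _
            _ ≤ C * (R * W s) + C * W s :=
              add_le_add ((hf _).trans (mul_le_mul_of_nonneg_left (h.weight_le j s) hCn)) (hf s)
            _ = _ := by ring
      _ = _ := by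
        rw [Finset.sum_const, Finset.card_univ, nsmul_eq_mul]; ring
  -- A negative `C` is allowed in the hypothesis, but then `W`, and with it `f`, vanishes
  -- identically.
  · have hz : ∀ s, W s = 0 := fun s => by
      have := (abs_nonneg _).trans (hf s)
      have := h.weight_nonneg s
      nlinarith
    have hf0 : ∀ s, f s = 0 := fun s => by
      have := hf s
      rw [hz, mul_zero] at this
      exact abs_eq_zero.1 (le_antisymm this (abs_nonneg _))
    simp [hf0, hz]

theorem JumpBounds.abs_gen_pow_le (h : JumpBounds c τ V W κ R) {f : S → ℝ} {C : ℝ}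
    (hf : ∀ s, |f s| ≤ C * W s) (n : ℕ) :
    ∀ s, |(jumpGen c τ ^ n) f s| ≤ C * (Fintype.card J * κ * (R + 1)) ^ n * W s := by
  induction n with
  | zero => simpa using hf
  | succ n ih =>
    intro s
    rw [pow_succ', Module.End.mul_apply, pow_succ, ← mul_assoc]
    exact h.abs_gen_le ih s

theorem JumpBounds.dom_gen (h : JumpBounds c τ V W κ R) {f : S → ℝ} (hf : Dom W f) :
    Dom W (jumpGen c τ f) := by
  obtain ⟨C, hC⟩ := hf
  exact ⟨_, h.abs_gen_le hC⟩

theorem JumpBounds.dom_gen_pow (h : JumpBounds c τ V W κ R) {f : S → ℝ} (hf : Dom W f) (n : ℕ) :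
    Dom W ((jumpGen c τ ^ n) f) := by
  obtain ⟨C, hC⟩ := hf
  exact ⟨_, h.abs_gen_pow_le hC n⟩

theorem JumpBounds.abs_series_le (h : JumpBounds c τ V W κ R) (hΦ : PosFun V W Φ) {f : S → ℝ}
    {C : ℝ} (hf : ∀ s, |f s| ≤ C * W s) (n : ℕ) :
    |Φ ((jumpGen c τ ^ n) f)| ≤ (C * Φ W) * (Fintype.card J * κ * (R + 1)) ^ n := by
  refine (hΦ.abs_le h.weight_nonneg (h.abs_gen_pow_le hf n)).trans_eq (by ring)

theorem JumpBounds.summable_evol (h : JumpBounds c τ V W κ R) (hΦ : PosFun V W Φ) {f : S → ℝ}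
    (hf : Dom W f) (t : ℝ) :
    Summable fun n : ℕ => t ^ n / n.factorial * Φ ((jumpGen c τ ^ n) f) := by
  obtain ⟨C, hC⟩ := hf
  exact summable_exp_series (h.abs_series_le hΦ hC) t

theorem JumpBounds.hasDerivAt_evol (h : JumpBounds c τ V W κ R) (hΦ : PosFun V W Φ) {f : S → ℝ}
    (hf : Dom W f) (t : ℝ) :
    HasDerivAt (fun t => evol (jumpGen c τ) Φ t f) (evol (jumpGen c τ) Φ t (jumpGen c τ f)) t := by
  obtain ⟨C, hC⟩ := hf
  have := hasDerivAt_exp_series (h.abs_series_le hΦ hC) t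
  simp only [pow_succ (jumpGen c τ), Module.End.mul_apply] at this
  exact this

theorem evol_zero (L : (S → ℝ) →ₗ[ℝ] (S → ℝ)) (Φ : (S → ℝ) → ℝ) (g : S → ℝ) :
    evol L Φ 0 g = Φ g := by
  rw [evol, tsum_eq_single 0 fun n hn => by simp [hn]]
  simp

/-- The evolved functional in terms of the positive operator `L + l`. -/
theorem JumpBounds.evol_eq_shift (h : JumpBounds c τ V W κ R) (hΦ : PosFun V W Φ) {f : S → ℝ}
    (hf : Dom W f) (l t : ℝ) :
    evol (jumpGen c τ) Φ t f = Real.exp (-(l * t))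
      * ∑' n : ℕ, t ^ n / n.factorial
          * Φ (((jumpGen c τ + l • (1 : Module.End ℝ (S → ℝ))) ^ n) f) := by
  obtain ⟨C, hC⟩ := hf
  have hf : Dom W f := ⟨C, hC⟩
  rw [exp_series_binomial (h.abs_series_le hΦ hC) l, mul_comm (Real.exp _), mul_assoc,
    ← Real.exp_add, add_neg_cancel, Real.exp_zero, mul_one, evol]
  intro n
  have hcomm : Commute (jumpGen c τ) (l • (1 : Module.End ℝ (S → ℝ))) :=
    (Commute.one_right _).smul_right l
  rw [hcomm.add_pow, LinearMap.sum_apply, hΦ.sum]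
  · refine Finset.sum_congr rfl fun m _ => ?_
    have : (jumpGen c τ ^ m * (l • (1 : Module.End ℝ (S → ℝ))) ^ (n - m) * (n.choose m : ℕ)) f
        = (l ^ (n - m) * n.choose m) • (jumpGen c τ ^ m) f := by
      rw [smul_pow, one_pow, mul_smul_comm, mul_one, smul_mul_assoc, ← nsmul_eq_mul']
      simp [mul_smul, Nat.cast_smul_eq_nsmul]
    rw [this, hΦ.smul _ _ (h.dom_gen_pow hf m)]
    ring
  · intro m _
    have : (jumpGen c τ ^ m * (l • (1 : Module.End ℝ (S → ℝ))) ^ (n - m) * (n.choose m : ℕ)) f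
        = (l ^ (n - m) * n.choose m) • (jumpGen c τ ^ m) f := by
      rw [smul_pow, one_pow, mul_smul_comm, mul_one, smul_mul_assoc, ← nsmul_eq_mul']
      simp [mul_smul, Nat.cast_smul_eq_nsmul]
    rw [this]
    exact (h.dom_gen_pow hf m).smul _

/-- Uniformisation: `e^{tL} = e^{-lt} e^{t(L+l)}`, and once `l` dominates the total jump rate all
coefficients of `L + l` are nonnegative, so every term of the second series is nonnegative. -/
theorem JumpBounds.posFun_evol (h : JumpBounds c τ V W κ R) (hΦ : PosFun V W Φ) {t : ℝ}
    (ht : 0 ≤ t) : PosFun V W (evol (jumpGen c τ) Φ t) where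
  add f g hf hg := by
    rw [evol, evol, evol, ← (h.summable_evol hΦ hf t).tsum_add (h.summable_evol hΦ hg t)]
    refine tsum_congr fun n => ?_
    rw [map_add, hΦ.add _ _ (h.dom_gen_pow hf n) (h.dom_gen_pow hg n), mul_add]
  smul r f hf := by
    rw [evol, evol, ← tsum_mul_left]
    refine tsum_congr fun n => ?_
    rw [map_smul, hΦ.smul _ _ (h.dom_gen_pow hf n)]
    ring
  nonneg f hf hf0 := by
    set l : ℝ := Fintype.card J * κ
    rw [h.evol_eq_shift hΦ hf l]
    refine mul_nonneg (Real.exp_nonneg _) (tsum_nonneg fun n => mul_nonneg (by positivity) ?_)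
    -- Positivity is known on `V` only; it propagates because a jump of nonzero rate does not leave
    -- `V`.
    have key : Dom W (((jumpGen c τ + l • (1 : Module.End ℝ (S → ℝ))) ^ n) f) ∧
        ∀ s ∈ V, 0 ≤ ((jumpGen c τ + l • (1 : Module.End ℝ (S → ℝ))) ^ n) f s := by
      induction n with
      | zero => simpa using ⟨hf, hf0⟩
      | succ n ih =>
        rw [pow_succ', Module.End.mul_apply]
        set g := ((jumpGen c τ + l • (1 : Module.End ℝ (S → ℝ))) ^ n) f
        rw [LinearMap.add_apply, LinearMap.smul_apply, Module.End.one_apply]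
        refine ⟨(h.dom_gen ih.1).add (ih.1.smul l), fun s hs => ?_⟩
        rw [Pi.add_apply, jumpGen_apply, Pi.smul_apply, smul_eq_mul]
        have : l * g s = ∑ _j : J, κ * g s := by
          rw [Finset.sum_const, Finset.card_univ, nsmul_eq_mul]; ring
        rw [this, ← Finset.sum_add_distrib]
        refine Finset.sum_nonneg fun j _ => ?_
        have h1 := mul_nonneg (sub_nonneg.2 (h.rate_le j s)) (ih.2 s hs)
        have h2 : 0 ≤ c j s * g (τ j s) := by
          rcases eq_or_ne (c j s) 0 with h0 | h0
          · simp [h0]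
          · exact mul_nonneg (h.rate_nonneg j s) (ih.2 _ (h.inv j s hs h0))
        linarith
    exact hΦ.nonneg _ key.1 key.2

/-- The double exponential series is dominated by a product of two scalar exponential series;
regrouping it along antidiagonals and using the binomial formula gives the semigroup property. -/
theorem JumpBounds.evol_evol (h : JumpBounds c τ V W κ R) (hΦ : PosFun V W Φ) {f : S → ℝ}
    (hf : Dom W f) (t s : ℝ) :
    evol (jumpGen c τ) (evol (jumpGen c τ) Φ t) s f = evol (jumpGen c τ) Φ (t + s) f := by
  obtain ⟨C, hC⟩ := hf
  obtain ⟨ρ, hρ, ha⟩ : ∃ ρ : ℝ, 0 ≤ ρ ∧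
      ∀ n, |Φ ((jumpGen c τ ^ n) f)| ≤ (C * Φ W) * ρ ^ n :=
    ⟨_, mul_nonneg (mul_nonneg (Nat.cast_nonneg _) h.kappa_nonneg)
        (add_nonneg h.ratio_nonneg zero_le_one), h.abs_series_le hΦ hC⟩
  set a : ℕ → ℝ := fun n => Φ ((jumpGen c τ ^ n) f)
  set F : ℕ × ℕ → ℝ := fun p => s ^ p.1 / p.1.factorial * (t ^ p.2 / p.2.factorial * a (p.1 + p.2))
  have hF : Summable F := by
    have h1 := ((Real.summable_pow_div_factorial (|s| * ρ)).norm.of_norm.mul_of_nonneg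
      (Real.summable_pow_div_factorial (|t| * ρ)) ?_ ?_)
    · refine Summable.of_norm_bounded (h1.mul_left (C * Φ W)) fun p => ?_
      simp only [F, Real.norm_eq_abs, abs_mul, abs_div, abs_pow, Nat.abs_cast]
      calc |s| ^ p.1 / p.1.factorial * (|t| ^ p.2 / p.2.factorial * |a (p.1 + p.2)|)
          ≤ |s| ^ p.1 / p.1.factorial
            * (|t| ^ p.2 / p.2.factorial * (C * Φ W * ρ ^ (p.1 + p.2))) := by
            gcongr
            exact ha _
        _ = _ := by rw [pow_add ρ, mul_pow |s| ρ, mul_pow |t| ρ]; ring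
    all_goals
      intro n
      simp only [Pi.zero_apply]
      positivity
  have e1 : evol (jumpGen c τ) (evol (jumpGen c τ) Φ t) s f = ∑' p, F p := by
    rw [hF.tsum_prod, evol]
    refine tsum_congr fun n => ?_
    simp only [F]
    rw [tsum_mul_left, evol]
    congr 1
    refine tsum_congr fun m => ?_
    simp only [a]
    rw [add_comm n m, pow_add, Module.End.mul_apply]
  rw [e1, ← Finset.HasAntidiagonal.sigmaAntidiagonalEquivProd.tsum_eq, Summable.tsum_sigma', evol]
  · refine tsum_congr fun n => ?_
    rw [tsum_fintype]
    refine (Finset.sum_coe_sort (Finset.HasAntidiagonal.antidiagonal n) F).trans ?_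
    rw [add_comm t s,
      (Commute.all s t).add_pow', Finset.sum_div, Finset.sum_mul]
    refine Finset.sum_congr rfl fun p hp => ?_
    obtain rfl := Finset.HasAntidiagonal.mem_antidiagonal.1 hp
    rw [nsmul_eq_mul, Nat.cast_add_choose]
    simp only [F, a]
    have := Nat.factorial_ne_zero (p.1 + p.2)
    have := Nat.factorial_ne_zero p.1
    have := Nat.factorial_ne_zero p.2
    field_simp
  · intro n
    exact (hasSum_fintype _).summable
  · exact (Equiv.summable_iff _).2 hF

end Evol

end JumpGenerator


/-! ### Itô's formula for powers of martingales. -/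

section Ito

variable {S J I : Type*}

theorem Dom.mul {v w f g : S → ℝ} (hf : Dom v f) (hg : Dom w g) :
    Dom (fun s => v s * w s) fun s => f s * g s := by
  obtain ⟨C, hC⟩ := hf
  obtain ⟨D, hD⟩ := hg
  refine ⟨C * D, fun s => ?_⟩
  rw [abs_mul]
  calc |f s| * |g s| ≤ (C * v s) * (D * w s) :=
        mul_le_mul (hC s) (hD s) (abs_nonneg _) ((abs_nonneg _).trans (hC s))
    _ = _ := by ring

theorem Dom.pow {v f : S → ℝ} (hf : Dom v f) (k : ℕ) :
    Dom (fun s => v s ^ k) fun s => f s ^ k := by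
  obtain ⟨C, hC⟩ := hf
  refine ⟨C ^ k, fun s => ?_⟩
  rw [abs_pow, ← mul_pow]
  exact pow_le_pow_left₀ (abs_nonneg _) (hC s) k

theorem Dom.pow_mul_pow {v f g : S → ℝ} (hf : Dom v f) (hg : Dom v g) {i j k : ℕ}
    (hk : i + j = k) : Dom (fun s => v s ^ k) fun s => f s ^ i * g s ^ j := by
  subst hk
  simpa only [pow_add] using (hf.pow i).mul (hg.pow j)

theorem Dom.finset_prod {v : S → ℝ} {z : I → S → ℝ} (hz : ∀ i, Dom v (z i)) {k : ℕ}
    (p : Fin k → I) : Dom (fun s => v s ^ k) fun s => ∏ l, z (p l) s := by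
  choose C hC using hz
  refine ⟨∏ l, C (p l), fun s => ?_⟩
  rw [Finset.abs_prod]
  calc ∏ l, |z (p l) s| ≤ ∏ l, (C (p l) * v s) :=
        Finset.prod_le_prod (fun _ _ => abs_nonneg _) fun l _ => hC _ s
    _ = _ := by rw [Finset.prod_mul_distrib]; simp

theorem Dom.comb [Fintype I] {v : S → ℝ} {z : I → S → ℝ} (hz : ∀ i, Dom v (z i)) (b : I → ℝ) :
    Dom v fun s => ∑ i, b i * z i s := by
  have := Dom.sum Finset.univ fun i _ => (hz i).smul (b i)
  convert this using 1
  funext s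
  simp

variable {c : J → S → ℝ} {τ : J → S → S} {V : Set S} {v : S → ℝ} {κ R : ℝ} {Φ : (S → ℝ) → ℝ}

theorem JumpBounds.pow (h : JumpBounds c τ V v κ R) (k : ℕ) :
    JumpBounds c τ V (fun s => v s ^ k) κ (R ^ k) where
  rate_nonneg := h.rate_nonneg
  rate_le := h.rate_le
  weight_nonneg s := pow_nonneg (h.weight_nonneg s) k
  weight_le j s := by
    rw [← mul_pow]
    exact pow_le_pow_left₀ (h.weight_nonneg _) (h.weight_le j s) k
  inv := h.inv
  kappa_nonneg := h.kappa_nonneg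
  ratio_nonneg := pow_nonneg h.ratio_nonneg k

variable [Fintype J] [Fintype I]

/-- A product rule: by linearity the evolved functional of a finite combination is a finite sum of
products of a coefficient and a function of time, so nothing has to be differentiated inside the
functional. -/
theorem JumpBounds.hasDerivAt_evol_comb {W : S → ℝ} (h : JumpBounds c τ V W κ R)
    (hΦ : PosFun V W Φ) {z : I → S → ℝ} (hz : ∀ i, Dom W (z i)) {b : I → ℝ → ℝ} {b' : I → ℝ}
    {s : ℝ} (hs : 0 ≤ s) (hb : ∀ i, HasDerivAt (b i) (b' i) s) :
    HasDerivAt (fun s => evol (jumpGen c τ) Φ s fun x => ∑ i, b i s * z i x)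
      (evol (jumpGen c τ) Φ s
        ((fun x => ∑ i, b' i * z i x) + jumpGen c τ fun x => ∑ i, b i s * z i x)) s := by
  have e : ∀ (r : ℝ) (b : I → ℝ), (evol (jumpGen c τ) Φ r fun x => ∑ i, b i * z i x)
      = ∑ i, b i * evol (jumpGen c τ) Φ r (z i) := by
    intro r b
    simp only [evol]
    rw [Finset.sum_congr rfl fun i _ => (tsum_mul_left (a := b i)
      (f := fun n : ℕ => r ^ n / n.factorial * Φ ((jumpGen c τ ^ n) (z i)))).symm,
      ← Summable.tsum_finsetSum fun i _ => (h.summable_evol hΦ (hz i) r).mul_left _]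
    refine tsum_congr fun n => ?_
    have : (fun x => ∑ i, b i * z i x) = ∑ i, b i • z i := by
      funext x; simp
    rw [this, map_sum, hΦ.sum]
    · rw [Finset.mul_sum]
      refine Finset.sum_congr rfl fun i _ => ?_
      rw [map_smul, hΦ.smul _ _ (h.dom_gen_pow (hz i) n)]
      ring
    · intro i _
      rw [map_smul]
      exact (h.dom_gen_pow (hz i) n).smul _
  have hP := h.posFun_evol hΦ hs
  have e2 : jumpGen c τ (fun x => ∑ i, b i s * z i x) = ∑ i, b i s • jumpGen c τ (z i) := by
    have : (fun x => ∑ i, b i s * z i x) = ∑ i, b i s • z i := by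
      funext x; simp
    rw [this, map_sum]
    simp only [map_smul]
  rw [hP.add _ _ (Dom.comb hz b') (h.dom_gen (Dom.comb hz _)), e s b', e2,
    hP.sum _ fun i _ => (h.dom_gen (hz i)).smul _,
    Finset.sum_congr rfl fun i _ => hP.smul (b i s) _ (h.dom_gen (hz i)),
    ← Finset.sum_add_distrib]
  simp only [e _ fun i => b i _]
  have := HasDerivAt.fun_sum (u := Finset.univ) fun i _ =>
    (hb i).mul (h.hasDerivAt_evol hΦ (hz i) s)
  exact this

/-- Itô's formula for the powers of a martingale that is a linear combination, with time-dependent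
coefficients, of finitely many functions of the process. -/
theorem JumpBounds.hasDerivAt_evol_pow (h : JumpBounds c τ V v κ R) {k : ℕ} (hk : 1 ≤ k)
    (hΦ : PosFun V (fun s => v s ^ k) Φ) {z : I → S → ℝ} (hz : ∀ i, Dom v (z i))
    {b : I → ℝ → ℝ} {b' : I → ℝ} {s : ℝ} (hs : 0 ≤ s) (hb : ∀ i, HasDerivAt (b i) (b' i) s)
    {m : ℝ → S → ℝ} (hm : ∀ s x, m s x = ∑ i, b i s * z i x)
    (drift : ∀ x ∈ V, ∑ i, b' i * z i x + jumpGen c τ (m s) x = 0) :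
    HasDerivAt (fun s => evol (jumpGen c τ) Φ s fun x => m s x ^ k)
      (evol (jumpGen c τ) Φ s fun x => ∑ j, c j x * (m s (τ j x) ^ k - m s x ^ k
        - k * m s x ^ (k - 1) * (m s (τ j x) - m s x))) s := by
  have hW := h.pow k
  -- The `k`-th power is expanded into a finite combination of `k`-fold products of the `z i`, with
  -- coefficients `B p`; this brings it under the rule for linear combinations.
  set B : (Fin k → I) → ℝ → ℝ := fun p s => ∏ l, b (p l) s
  have hB : ∀ p, HasDerivAt (B p) (deriv (B p) s) s := fun p =>
    (DifferentiableAt.fun_finsetProd fun l _ => (hb (p l)).differentiableAt).hasDerivAt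
  have hexp : ∀ s x, m s x ^ k = ∑ p : Fin k → I, B p s * ∏ l, z (p l) x := by
    intro s x
    rw [hm, Fintype.sum_pow]
    exact Finset.sum_congr rfl fun p _ => Finset.prod_mul_distrib
  have hd : Dom v (m s) := by
    have := Dom.comb hz fun i => b i s
    convert this using 1
    funext x
    exact hm s x
  have hmk : (fun x => m s x ^ k) = fun x => ∑ p : Fin k → I, B p s * ∏ l, z (p l) x :=
    funext (hexp s)
  have key := hW.hasDerivAt_evol_comb hΦ (fun p : Fin k → I => Dom.finset_prod hz p) hs hB
  simp only [← hexp] at key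
  convert key using 1
  refine (hW.posFun_evol hΦ hs).congr ?_ ?_ ?_
  · have h1 : Dom (fun x => v x ^ k) (jumpGen c τ fun x => m s x ^ k) := hW.dom_gen (hd.pow k)
    have h2 : Dom (fun x => v x ^ k) fun x => m s x ^ (k - 1) * jumpGen c τ (m s) x ^ 1 :=
      hd.pow_mul_pow (h.dom_gen hd) (Nat.sub_add_cancel hk)
    convert h1.sub (h2.smul k) using 1
    funext x
    simp only [Pi.sub_apply, Pi.smul_apply, jumpGen_apply, smul_eq_mul, pow_one, Finset.mul_sum,
      ← Finset.sum_sub_distrib]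
    exact Finset.sum_congr rfl fun j _ => by ring
  · refine Dom.add (Dom.comb (fun p : Fin k → I => Dom.finset_prod hz p) _) ?_
    exact hW.dom_gen (hd.pow k)
  · intro x hx
    have d1 : HasDerivAt (fun s => m s x ^ k)
        (∑ p : Fin k → I, deriv (B p) s * ∏ l, z (p l) x) s := by
      simp only [hexp]
      exact HasDerivAt.fun_sum fun p _ => (hB p).mul_const _
    have d2 : HasDerivAt (fun s => m s x) (∑ i, b' i * z i x) s := by
      simp only [hm]
      exact HasDerivAt.fun_sum fun i _ => (hb i).mul_const _
    have e := d1.unique (d2.fun_pow k)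
    -- The absence of drift replaces the time derivative of `m` by minus its generator. This cancels
    -- the first-order part of the jumps and leaves the second-order Taylor remainder.
    rw [Pi.add_apply, e, eq_neg_of_add_eq_zero_left (drift x hx), jumpGen_apply, jumpGen_apply]
    rw [mul_neg, Finset.mul_sum, ← Finset.sum_neg_distrib, ← Finset.sum_add_distrib]
    exact Finset.sum_congr rfl fun j _ => by ring

end Ito

/-! ### Taylor remainders of powers. -/

theorem abs_pow_taylor_le (m d : ℝ) (k : ℕ) :
    |(m + d) ^ (k + 2) - m ^ (k + 2) - (k + 2) * m ^ (k + 1) * d|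
      ≤ (k + 2) ^ 2 * (d ^ 2 * (|m| + |d|) ^ k) := by
  induction k with
  | zero =>
    have : (m + d) ^ (0 + 2) - m ^ (0 + 2) - ((0 : ℕ) + 2) * m ^ (0 + 1) * d = d ^ 2 := by
      push_cast; ring
    rw [this, abs_of_nonneg (sq_nonneg d)]
    simp
    nlinarith [sq_nonneg d]
  | succ k ih =>
    -- The next remainder is `m + d` times the present one plus `(k + 2) m^{k+1} d²`; the constants
    -- close up because `(k + 2)² + (k + 2) ≤ (k + 3)²`.
    have e : (m + d) ^ (k + 1 + 2) - m ^ (k + 1 + 2) - ((k + 1 : ℕ) + 2) * m ^ (k + 1 + 1) * d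
        = (m + d) * ((m + d) ^ (k + 2) - m ^ (k + 2) - (k + 2) * m ^ (k + 1) * d)
          + (k + 2) * m ^ (k + 1) * d ^ 2 := by
      push_cast; ring
    rw [e]
    have h0 : 0 ≤ |m| + |d| := by positivity
    have h1 : |m| ^ (k + 1) ≤ (|m| + |d|) ^ (k + 1) :=
      pow_le_pow_left₀ (abs_nonneg _) (le_add_of_nonneg_right (abs_nonneg _)) _
    calc _ ≤ |m + d| * |(m + d) ^ (k + 2) - m ^ (k + 2) - (k + 2) * m ^ (k + 1) * d|
          + (k + 2) * |m| ^ (k + 1) * d ^ 2 := by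
          refine (abs_add_le _ _).trans_eq ?_
          rw [abs_mul, abs_mul, abs_mul, abs_pow, abs_of_nonneg (sq_nonneg d),
            abs_of_nonneg (by positivity : (0 : ℝ) ≤ k + 2)]
      _ ≤ (|m| + |d|) * ((k + 2) ^ 2 * (d ^ 2 * (|m| + |d|) ^ k))
          + (k + 2) * (|m| + |d|) ^ (k + 1) * d ^ 2 := by
          gcongr
          exact abs_add_le _ _
      _ = ((k + 2) ^ 2 + (k + 2)) * (d ^ 2 * (|m| + |d|) ^ (k + 1)) := by ring
      _ ≤ _ := by
          refine mul_le_mul_of_nonneg_right ?_ (by positivity)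
          push_cast
          nlinarith

/-- The increment enters only through `d²` and `d^{k+2}`, which are controlled separately: the first
by the quadratic variation, the second by the size of the jumps. -/
theorem pow_taylor_le {k : ℕ} (hk : Even k) (m d : ℝ) :
    (m + d) ^ (k + 2) - m ^ (k + 2) - (k + 2) * m ^ (k + 1) * d
      ≤ (k + 2) ^ 2 * 2 ^ k * (m ^ k * d ^ 2 + d ^ (k + 2)) := by
  refine (le_abs_self _).trans ((abs_pow_taylor_le m d k).trans ?_)
  have h : (|m| + |d|) ^ k ≤ 2 ^ k * (m ^ k + d ^ k) := by
    rw [← hk.pow_abs m, ← hk.pow_abs d]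
    rcases le_total |m| |d| with h | h
    · calc (|m| + |d|) ^ k ≤ (2 * |d|) ^ k := by gcongr; linarith
        _ ≤ _ := by rw [mul_pow]; gcongr; linarith [pow_nonneg (abs_nonneg m) k]
    · calc (|m| + |d|) ^ k ≤ (2 * |m|) ^ k := by gcongr; linarith
        _ ≤ _ := by rw [mul_pow]; gcongr; linarith [pow_nonneg (abs_nonneg d) k]
  calc ((k : ℝ) + 2) ^ 2 * (d ^ 2 * (|m| + |d|) ^ k)
      ≤ (k + 2) ^ 2 * (d ^ 2 * (2 ^ k * (m ^ k + d ^ k))) := by gcongr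
    _ = _ := by ring


/-! ### Pairs of states at two times -/

section Pair

variable {S J I I' : Type*}

/-- The rates of the process on pairs whose first coordinate is frozen. -/
def pairRate (c : J → S → ℝ) (j : J) (p : S × S) : ℝ := c j p.2

/-- The jumps of the process on pairs whose first coordinate is frozen. -/
def pairJump (τ : J → S → S) (j : J) (p : S × S) : S × S := (p.1, τ j p.2)

/-- The functional on pairs that puts both coordinates at the same state. -/
def diagFun (Φ : (S → ℝ) → ℝ) (g : S × S → ℝ) : ℝ := Φ fun s => g (s, s)

variable {c : J → S → ℝ} {τ : J → S → S} {V : Set S} {v : S → ℝ} {κ R : ℝ} {Φ : (S → ℝ) → ℝ}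

theorem JumpBounds.pair (h : JumpBounds c τ V v κ R) :
    JumpBounds (pairRate c) (pairJump τ) (V ×ˢ V) (fun p => v p.1 + v p.2) κ (R + 1) where
  rate_nonneg j p := h.rate_nonneg j p.2
  rate_le j p := h.rate_le j p.2
  weight_nonneg p := add_nonneg (h.weight_nonneg _) (h.weight_nonneg _)
  weight_le j p := by
    have h1 := h.weight_le j p.2
    have h2 := h.weight_nonneg p.1
    have h3 := h.weight_nonneg p.2
    have h4 := h.ratio_nonneg
    simp only [pairJump]
    nlinarith [mul_nonneg h4 h2]
  inv j p hp hj := ⟨hp.1, h.inv j p.2 hp.2 hj⟩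
  kappa_nonneg := h.kappa_nonneg
  ratio_nonneg := add_nonneg h.ratio_nonneg zero_le_one

theorem Dom.diag {k : ℕ} {g : S × S → ℝ} (hg : Dom (fun p : S × S => (v p.1 + v p.2) ^ k) g) :
    Dom (fun s => v s ^ k) fun s => g (s, s) := by
  obtain ⟨C, hC⟩ := hg
  refine ⟨C * 2 ^ k, fun s => (hC (s, s)).trans_eq ?_⟩
  rw [mul_assoc, ← mul_pow, two_mul]

theorem PosFun.diag {k : ℕ} (hΦ : PosFun V (fun s => v s ^ k) Φ) :
    PosFun (V ×ˢ V) (fun p : S × S => (v p.1 + v p.2) ^ k) (diagFun Φ) where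
  add _ _ hf hg := hΦ.add _ _ hf.diag hg.diag
  smul r _ hf := hΦ.smul r _ hf.diag
  nonneg _ hf h := hΦ.nonneg _ hf.diag fun s hs => h (s, s) ⟨hs, hs⟩

theorem Dom.snd (hv : ∀ s, 0 ≤ v s) {f : S → ℝ} (hf : Dom v f) :
    Dom (fun p : S × S => v p.1 + v p.2) fun p => f p.2 := by
  obtain ⟨C, hC⟩ := hf
  refine ⟨|C|, fun p => (hC p.2).trans ?_⟩
  calc C * v p.2 ≤ |C| * v p.2 := mul_le_mul_of_nonneg_right (le_abs_self C) (hv _)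
    _ ≤ _ := mul_le_mul_of_nonneg_left (le_add_of_nonneg_left (hv _)) (abs_nonneg C)

theorem Dom.fst (hv : ∀ s, 0 ≤ v s) {f : S → ℝ} (hf : Dom v f) :
    Dom (fun p : S × S => v p.1 + v p.2) fun p => f p.1 := by
  obtain ⟨C, hC⟩ := hf
  refine ⟨|C|, fun p => (hC p.1).trans ?_⟩
  calc C * v p.1 ≤ |C| * v p.1 := mul_le_mul_of_nonneg_right (le_abs_self C) (hv _)
    _ ≤ _ := mul_le_mul_of_nonneg_left (le_add_of_nonneg_right (hv _)) (abs_nonneg C)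

variable [Fintype J]

/-- The frozen coordinate is a mere parameter, so the pair generator acts on slices. Consequently
`diagFun`, evolved, plays the role of the joint law of the process at the start and at the end of a
time step. -/
theorem jumpGen_pair_pow (g : S × S → ℝ) (n : ℕ) (s s' : S) :
    (jumpGen (pairRate c) (pairJump τ) ^ n) g (s, s')
      = (jumpGen c τ ^ n) (fun y => g (s, y)) s' := by
  induction n generalizing s' with
  | zero => rfl
  | succ n ih =>
    rw [pow_succ', pow_succ', Module.End.mul_apply, Module.End.mul_apply, jumpGen_apply,
      jumpGen_apply]
    simp only [pairRate, pairJump, ih]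

theorem evol_pair_snd (t : ℝ) (g : S → ℝ) :
    evol (jumpGen (pairRate c) (pairJump τ)) (diagFun Φ) t (fun p => g p.2)
      = evol (jumpGen c τ) Φ t g := by
  simp only [evol, diagFun, jumpGen_pair_pow]

theorem evol_pair_fst (t : ℝ) (g : S → ℝ) (hΦ : Φ 0 = 0) :
    evol (jumpGen (pairRate c) (pairJump τ)) (diagFun Φ) t (fun p => g p.1) = Φ g := by
  have h0 : ∀ r : S → ℝ, ∀ n ≠ 0, (fun s => (jumpGen c τ ^ n) (fun _ => r s) s) = 0 := by
    intro r n hn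
    obtain ⟨n, rfl⟩ := Nat.exists_eq_succ_of_ne_zero hn
    funext s
    have : jumpGen c τ (fun _ => r s) = 0 := by
      funext x; simp [jumpGen_apply]
    rw [Nat.succ_eq_add_one, pow_succ, Module.End.mul_apply, this, map_zero, Pi.zero_apply]
  simp only [evol, diagFun, jumpGen_pair_pow]
  rw [tsum_eq_single 0 fun n hn => by rw [h0 g n hn, hΦ, mul_zero]]
  simp

variable [Fintype I] [Fintype I']

/-- A moment bound for the increments of a martingale that is a linear combination of functions of
the process. -/
theorem JumpBounds.martingale_moment_le (h : JumpBounds c τ V v κ R) {K : ℕ} (hK : Even K)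
    (hΦ : PosFun V (fun s => v s ^ (K + 2)) Φ) {z : I → S → ℝ} (hz : ∀ i, Dom v (z i))
    {b b' : I → ℝ → ℝ} (hb : ∀ i s, HasDerivAt (b i) (b' i s) s)
    {m : ℝ → S → ℝ} (hm : ∀ s x, m s x = ∑ i, b i s * z i x)
    (drift : ∀ s, ∀ x ∈ V, ∑ i, b' i s * z i x + jumpGen c τ (m s) x = 0)
    {t ρ : ℝ} (ht : 0 ≤ t) (hρ : 0 < ρ) {g g' : ℝ → ℝ} (hgc : ContinuousOn g (Set.Icc 0 t))
    (hg : ∀ s ∈ Set.Ioo 0 t, HasDerivAt g (g' s) s) (hg1 : g t - g 0 ≤ 1)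
    (hg' : ∀ s ∈ Set.Ioo 0 t, 0 ≤ g' s)
    {ζ : I' → ℝ → S → ℝ} (hζ : ∀ i s, Dom v (ζ i s)) {e e' : I' → ℝ → ℝ}
    (he : ∀ i s, 0 ≤ e i s) (he' : ∀ i s, 0 ≤ e' i s)
    (hδ : ∀ s ∈ Set.Ioo 0 t, ∀ x ∈ V,
      ∑ j, c j x * (m s (τ j x) - m s x) ^ 2 ≤ ∑ i, e i s * ζ i s x ^ 2)
    (hδ' : ∀ s ∈ Set.Ioo 0 t, ∀ x ∈ V,
      ∑ j, c j x * (m s (τ j x) - m s x) ^ (K + 2) ≤ ∑ i, e' i s * ζ i s x ^ (K + 2))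
    (hζ1 : ∀ s ∈ Set.Ioo 0 t, ∀ i, evol (jumpGen c τ) Φ s (fun x => ζ i s x ^ (K + 2)) ≤ 1)
    (hes : ∀ s ∈ Set.Ioo 0 t, ∑ i, e i s ≤ ρ ^ 2 * g' s)
    (hes' : ∀ s ∈ Set.Ioo 0 t, ∑ i, e' i s ≤ ρ ^ (K + 2) * g' s) :
    evol (jumpGen (pairRate c) (pairJump τ)) (diagFun Φ) t
        (fun p => (m t p.2 - m 0 p.1) ^ (K + 2))
      ≤ ((3 * ((K + 2) ^ 2 * 2 ^ K) + 1) * ρ) ^ (K + 2) := by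
  set C : ℝ := (K + 2) ^ 2 * 2 ^ K
  have hC0 : 0 ≤ C := by positivity
  have h2 := h.pair
  have hΦ2 := hΦ.diag
  set W : S × S → ℝ := fun p => (v p.1 + v p.2) ^ (K + 2)
  set L := jumpGen (pairRate c) (pairJump τ)
  have hKe : Even (K + 2) := hK.add even_two
  have hdm : ∀ s, Dom v (m s) := fun s => by
    have := Dom.comb hz fun i => b i s
    convert this using 1
    funext x
    exact hm s x
  set D : ℝ → S × S → ℝ := fun s p => m s p.2 - m 0 p.1
  have hD : ∀ s, Dom (fun p : S × S => v p.1 + v p.2) (D s) := fun s =>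
    ((hdm s).snd h.weight_nonneg).sub ((hdm 0).fst h.weight_nonneg)
  have hζ2 : ∀ i s, Dom (fun p : S × S => v p.1 + v p.2) (fun p => ζ i s p.2) := fun i s =>
    (hζ i s).snd h.weight_nonneg
  set F : ℝ → ℝ := fun s => evol L (diagFun Φ) s fun p => D s p ^ (K + 2)
  set F' : ℝ → ℝ := fun s => evol L (diagFun Φ) s fun p =>
    ∑ j, pairRate c j p * (D s (pairJump τ j p) ^ (K + 2) - D s p ^ (K + 2)
        - (K + 2 : ℕ) * D s p ^ (K + 2 - 1) * (D s (pairJump τ j p) - D s p))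
  -- The frozen starting value is one more function of the pair, with the constant coefficient `-1`;
  -- it occupies the extra index of `Option I`.
  have hF : ∀ s, 0 ≤ s → HasDerivAt F (F' s) s := by
    intro s hs
    refine h2.hasDerivAt_evol_pow (I := Option I) (by omega) hΦ2
      (z := fun i => i.elim (fun p => m 0 p.1) fun i p => z i p.2)
      (b := fun i => i.elim (fun _ => -1) b) (b' := fun i => i.elim 0 fun i => b' i s)
      ?_ hs ?_ ?_ ?_
    · rintro (_ | i)
      · exact (hdm 0).fst h.weight_nonneg
      · exact (hz i).snd h.weight_nonneg
    · rintro (_ | i)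
      · exact hasDerivAt_const s (-1 : ℝ)
      · exact hb i s
    · intro s p
      simp only [D, Fintype.sum_option, Option.elim]
      rw [hm s]
      ring
    · intro p hp
      have := drift s p.2 hp.2
      rw [jumpGen_apply] at this ⊢
      simp only [D, Fintype.sum_option, Option.elim, pairRate, pairJump, zero_mul, zero_add]
      rw [← this]
      congr 1
      exact Finset.sum_congr rfl fun j _ => by ring
  -- A differential inequality valid while the moment stays below the level `f ^ (K + 2)`.
  have hbound : ∀ f > 0, ∀ s ∈ Set.Ioo 0 t, F s ≤ f ^ (K + 2) →
      F' s ≤ C * (2 * f ^ K * ρ ^ 2 + ρ ^ (K + 2)) * g' s := by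
    intro f hf s hs hFs
    have hP := (h2.pow (K + 2)).posFun_evol hΦ2 hs.1.le
    have hDk : Dom W fun p => D s p ^ (K + 2) := (hD s).pow _
    have hζk : ∀ i, Dom W fun p => ζ i s p.2 ^ (K + 2) := fun i => (hζ2 i s).pow _
    set G : S × S → ℝ := fun p => ∑ i, (C * e i s * f ^ K * ((f ^ (K + 2))⁻¹ * D s p ^ (K + 2)
        + ζ i s p.2 ^ (K + 2)) + C * e' i s * ζ i s p.2 ^ (K + 2))
    have hGe : G = ∑ i, ((C * e i s * f ^ K * (f ^ (K + 2))⁻¹) • (fun p => D s p ^ (K + 2))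
        + (C * e i s * f ^ K + C * e' i s) • fun p => ζ i s p.2 ^ (K + 2)) := by
      funext p
      simp only [G, Finset.sum_apply, Pi.add_apply, Pi.smul_apply, smul_eq_mul]
      exact Finset.sum_congr rfl fun i _ => by ring
    have hGd : Dom W G := by
      rw [hGe]
      exact Dom.sum _ fun i _ => (hDk.smul _).add ((hζk i).smul _)
    have step : F' s ≤ evol L (diagFun Φ) s G := by
      refine hP.mono ?_ hGd fun p hp => ?_
      · have h3 : Dom (fun p : S × S => v p.1 + v p.2) (L (D s)) := h2.dom_gen (hD s)
        have h4 : Dom W fun p => D s p ^ (K + 1) * L (D s) p ^ 1 := (hD s).pow_mul_pow h3 rfl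
        have h5 : Dom W (L fun p => D s p ^ (K + 2)) := (h2.pow (K + 2)).dom_gen hDk
        convert h5.sub (h4.smul ((K + 2 : ℕ) : ℝ)) using 1
        funext p
        simp only [L, Pi.sub_apply, Pi.smul_apply, jumpGen_apply, smul_eq_mul, pow_one,
          Finset.mul_sum, ← Finset.sum_sub_distrib]
        exact Finset.sum_congr rfl fun j _ => by
          rw [show K + 2 - 1 = K + 1 by omega]; ring
      · have hd : ∀ j, D s (pairJump τ j p) = D s p + (m s (τ j p.2) - m s p.2) := fun j => by
          simp only [D, pairJump]; ring
        calc _ ≤ ∑ j, c j p.2 * (C * (D s p ^ K * (m s (τ j p.2) - m s p.2) ^ 2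
                  + (m s (τ j p.2) - m s p.2) ^ (K + 2))) := by
              refine Finset.sum_le_sum fun j _ =>
                mul_le_mul_of_nonneg_left ?_ (h.rate_nonneg j p.2)
              have := pow_taylor_le hK (D s p) (m s (τ j p.2) - m s p.2)
              rw [hd]
              refine le_of_eq_of_le ?_ this
              rw [show K + 2 - 1 = K + 1 by omega]; push_cast; ring
          _ = C * (D s p ^ K * ∑ j, c j p.2 * (m s (τ j p.2) - m s p.2) ^ 2
                + ∑ j, c j p.2 * (m s (τ j p.2) - m s p.2) ^ (K + 2)) := by
              rw [Finset.mul_sum, ← Finset.sum_add_distrib, Finset.mul_sum]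
              exact Finset.sum_congr rfl fun j _ => by ring
          _ ≤ C * (D s p ^ K * ∑ i, e i s * ζ i s p.2 ^ 2 + ∑ i, e' i s * ζ i s p.2 ^ (K + 2)) := by
              have := hδ s hs p.2 hp.2
              have := hδ' s hs p.2 hp.2
              have := hK.pow_nonneg (D s p)
              gcongr
          _ = ∑ i, (C * e i s * (D s p ^ K * ζ i s p.2 ^ 2)
              + C * e' i s * ζ i s p.2 ^ (K + 2)) := by
              rw [Finset.mul_sum, ← Finset.sum_add_distrib, Finset.mul_sum]
              exact Finset.sum_congr rfl fun j _ => by ring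
          _ ≤ G p := by
              refine Finset.sum_le_sum fun i _ => ?_
              have hce : 0 ≤ C * e i s := mul_nonneg hC0 (he i s)
              rw [mul_assoc _ (f ^ K)]
              refine add_le_add (mul_le_mul_of_nonneg_left ?_ hce) le_rfl
              -- The increment is measured in units of `f`. The mixed term is then bounded by `X^K
              -- Y² ≤ X^{K+2} + Y^{K+2}`, and both resulting moments are at most one.
              set X := |D s p| / f
              set Y := |ζ i s p.2|
              have hX : |D s p| = f * X := by simp only [X]; field_simp
              have hX0 : 0 ≤ X := by positivity
              have hY0 : 0 ≤ Y := by positivity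
              rw [← hK.pow_abs, ← hKe.pow_abs (D s p), ← hKe.pow_abs (ζ i s p.2),
                ← sq_abs (ζ i s p.2),
                hX, mul_pow, mul_pow, inv_mul_cancel_left₀ (by positivity), mul_assoc]
              refine mul_le_mul_of_nonneg_left ?_ (by positivity)
              rcases le_total X Y with hXY | hXY
              · calc X ^ K * Y ^ 2 ≤ Y ^ K * Y ^ 2 := by gcongr
                  _ ≤ X ^ (K + 2) + Y ^ (K + 2) := by
                    rw [← pow_add]; linarith [pow_nonneg hX0 (K + 2)]
              · calc X ^ K * Y ^ 2 ≤ X ^ K * X ^ 2 := by gcongr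
                  _ ≤ X ^ (K + 2) + Y ^ (K + 2) := by
                    rw [← pow_add]; linarith [pow_nonneg hY0 (K + 2)]
    refine step.trans ?_
    rw [hGe, hP.sum _ fun i _ => (hDk.smul _).add ((hζk i).smul _)]
    have hi : ∀ i, evol L (diagFun Φ) s
        ((C * e i s * f ^ K * (f ^ (K + 2))⁻¹) • (fun p => D s p ^ (K + 2))
        + (C * e i s * f ^ K + C * e' i s) • fun p => ζ i s p.2 ^ (K + 2))
        ≤ C * (2 * f ^ K * e i s + e' i s) := by
      intro i
      rw [hP.add _ _ (hDk.smul _) ((hζk i).smul _), hP.smul _ _ hDk, hP.smul _ _ (hζk i)]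
      have h1 : evol L (diagFun Φ) s (fun p => ζ i s p.2 ^ (K + 2)) ≤ 1 := by
        have := hζ1 s hs i
        rwa [← evol_pair_snd] at this
      have hce : 0 ≤ C * e i s := mul_nonneg hC0 (he i s)
      have hce' : 0 ≤ C * e' i s := mul_nonneg hC0 (he' i s)
      calc _ ≤ C * e i s * f ^ K * (f ^ (K + 2))⁻¹ * f ^ (K + 2)
            + (C * e i s * f ^ K + C * e' i s) * 1 :=
            add_le_add (mul_le_mul_of_nonneg_left hFs (by positivity))
              (mul_le_mul_of_nonneg_left h1 (by positivity))
        _ = _ := by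
          rw [inv_mul_cancel_right₀ (by positivity)]; ring
    refine (Finset.sum_le_sum fun i _ => hi i).trans ?_
    rw [← Finset.mul_sum, Finset.sum_add_distrib, ← Finset.mul_sum, mul_assoc C]
    refine mul_le_mul_of_nonneg_left ?_ hC0
    calc 2 * f ^ K * ∑ i, e i s + ∑ i, e' i s
        ≤ 2 * f ^ K * (ρ ^ 2 * g' s) + ρ ^ (K + 2) * g' s :=
          add_le_add (mul_le_mul_of_nonneg_left (hes s hs) (by positivity)) (hes' s hs)
      _ = _ := by ring
  have hFc : ContinuousOn F (Set.Icc 0 t) := fun s hs =>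
    (hF s hs.1).continuousAt.continuousWithinAt
  obtain ⟨s₀, hs₀, hmax⟩ := isCompact_Icc.exists_isMaxOn (Set.nonempty_Icc.2 ht) hFc
  have hgm : MonotoneOn g (Set.Icc 0 t) := by
    refine monotoneOn_of_deriv_nonneg (convex_Icc 0 t) hgc ?_ ?_ <;> rw [interior_Icc]
    · exact fun s hs => (hg s hs).differentiableAt.differentiableWithinAt
    · exact fun s hs => (hg s hs).deriv ▸ hg' s hs
  suffices hfin : F s₀ ≤ ((3 * C + 1) * ρ) ^ (K + 2) from
    (hmax (Set.right_mem_Icc.2 ht)).trans hfin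
  -- If the maximum `F s₀ = f ^ (K + 2)` is too large, then `f > (3C + 1) ρ`. Integrating the
  -- differential inequality at level `f` up to `s₀`, where `g` grows by at most one, gives `F s₀ ≤
  -- 3 C f^K ρ²`, which is less than `f ^ (K + 2)`.
  by_contra! hlt
  set f : ℝ := F s₀ ^ (1 / ((K + 2 : ℕ) : ℝ))
  have hA : 0 < (3 * C + 1) * ρ := by positivity
  have hF0 : 0 < F s₀ := (pow_pos hA _).trans hlt
  have hf : 0 < f := Real.rpow_pos_of_pos hF0 _
  have hfk : f ^ (K + 2) = F s₀ := by
    simp only [f]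
    rw [← Real.rpow_natCast, ← Real.rpow_mul hF0.le, one_div, inv_mul_cancel₀ (by positivity),
      Real.rpow_one]
  have hfρ : (3 * C + 1) * ρ < f := by
    rw [← hfk] at hlt
    exact lt_of_pow_lt_pow_left₀ _ hf.le hlt
  set M : ℝ := C * (2 * f ^ K * ρ ^ 2 + ρ ^ (K + 2))
  have hmono : MonotoneOn (fun s => M * g s - F s) (Set.Icc 0 s₀) := by
    refine monotoneOn_of_deriv_nonneg (convex_Icc 0 s₀) ?_ ?_ ?_
    · exact (hgc.const_smul M |>.sub hFc).mono (Set.Icc_subset_Icc le_rfl hs₀.2)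
    all_goals
      rw [interior_Icc]
      intro s hs
      have hs' : s ∈ Set.Ioo 0 t := ⟨hs.1, hs.2.trans_le hs₀.2⟩
      have hd := ((hg s hs').const_mul M).sub (hF s hs.1.le)
    · exact hd.differentiableAt.differentiableWithinAt
    · have e : deriv (fun s => M * g s - F s) s = M * g' s - F' s := hd.deriv
      rw [e, sub_nonneg]
      exact hbound f hf s hs' (hfk ▸ hmax ⟨hs.1.le, hs'.2.le⟩)
  have hF00 : F 0 = 0 := by
    simp only [F, evol_zero, diagFun, D, sub_self]
    simp only [ne_eq, Nat.add_eq_zero_iff, OfNat.ofNat_ne_zero, and_false, not_false_eq_true,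
      zero_pow]
    exact hΦ.zero
  have h1 := hmono (Set.left_mem_Icc.2 hs₀.1) (Set.right_mem_Icc.2 hs₀.1) hs₀.1
  have h3 : g s₀ - g 0 ≤ 1 :=
    (sub_le_sub_right (hgm hs₀ (Set.right_mem_Icc.2 ht) hs₀.2) _).trans hg1
  have hM : 0 ≤ M := by positivity
  have h4 : F s₀ ≤ M := by
    simp only [hF00] at h1
    nlinarith
  have hρf : ρ ≤ f := by nlinarith
  have h5 : M ≤ C * (3 * (f ^ K * ρ ^ 2)) := by
    refine mul_le_mul_of_nonneg_left ?_ hC0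
    have : ρ ^ (K + 2) ≤ f ^ K * ρ ^ 2 := by
      rw [pow_add]; gcongr
    linarith
  have h6 : 3 * C * ρ ^ 2 < f ^ 2 := by
    have : ((3 * C + 1) * ρ) ^ 2 < f ^ 2 := pow_lt_pow_left₀ hfρ hA.le two_ne_zero
    nlinarith [sq_nonneg ρ, mul_nonneg hC0 (sq_nonneg ρ),
      mul_nonneg (mul_nonneg hC0 hC0) (sq_nonneg ρ)]
  have h7 : F s₀ < f ^ K * f ^ 2 :=
    (h4.trans h5).trans_lt (by
      have := mul_lt_mul_of_pos_left h6 (pow_pos hf K)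
      linarith)
  rw [← pow_add, hfk] at h7
  exact lt_irrefl _ h7

end Pair


/-! ### The rates -/

section Rates

variable {N : ℕ}

theorem rpow_neg_half_pos (hN : 2 ≤ N) : 0 < (N : ℝ) ^ (-(1 / 2) : ℝ) :=
  Real.rpow_pos_of_pos (by positivity) _

theorem rpow_neg_half_sq (hN : 2 ≤ N) : ((N : ℝ) ^ (-(1 / 2) : ℝ)) ^ 2 = 1 / N := by
  rw [← Real.rpow_natCast, ← Real.rpow_mul (by positivity), one_div, one_div,
    show (-2⁻¹ : ℝ) * ((2 : ℕ) : ℝ) = -1 by norm_num, Real.rpow_neg_one]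

/-- For `N ≥ 2` the quantity is at most `1/√2 < 3/4`. This keeps `rateR`, hence all ratios of rates,
away from zero uniformly in `N`. -/
theorem rpow_neg_half_le (hN : 2 ≤ N) : (N : ℝ) ^ (-(1 / 2) : ℝ) ≤ 3 / 4 := by
  have h := rpow_neg_half_sq hN
  have h0 := rpow_neg_half_pos hN
  have h1 : (1 : ℝ) / N ≤ 1 / 2 := by
    have : (2 : ℝ) ≤ N := by exact_mod_cast hN
    gcongr
  nlinarith

theorem rateR_ge (hN : 2 ≤ N) : 1 / 8 ≤ rateR N := by
  have := rpow_neg_half_le hN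
  unfold rateR; linarith

theorem rateR_pos (hN : 2 ≤ N) : 0 < rateR N := lt_of_lt_of_le (by norm_num) (rateR_ge hN)

theorem rateR_le (hN : 2 ≤ N) : rateR N ≤ 1 := by
  have := rpow_neg_half_pos hN
  unfold rateR; linarith

theorem rateL_ge (hN : 2 ≤ N) : 1 / 2 ≤ rateL N := by
  have := rpow_neg_half_pos hN
  unfold rateL; linarith

theorem rateL_pos (hN : 2 ≤ N) : 0 < rateL N := lt_of_lt_of_le (by norm_num) (rateL_ge hN)

theorem rateL_le (hN : 2 ≤ N) : rateL N ≤ 1 := by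
  have := rpow_neg_half_le hN
  unfold rateL; linarith

theorem rateR_add_rateL : rateR N + rateL N = 1 := by
  unfold rateR rateL; ring

theorem rateL_sub_rateR : rateL N - rateR N = (N : ℝ) ^ (-(1 / 2) : ℝ) := by
  unfold rateR rateL; ring

theorem tau_pos (hN : 2 ≤ N) : 0 < tau N := div_pos (rateR_pos hN) (rateL_pos hN)

theorem tau_le_one (hN : 2 ≤ N) : tau N ≤ 1 := by
  rw [tau, div_le_one (rateL_pos hN)]
  have := rpow_neg_half_pos hN
  have := @rateL_sub_rateR N
  linarith

theorem sqrt_mul_sqrt_tau (hN : 2 ≤ N) : √(rateR N * rateL N) * √(tau N) = rateR N := by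
  have hL := rateL_pos hN
  have hR := rateR_pos hN
  rw [← Real.sqrt_mul (by positivity), tau,
    show rateR N * rateL N * (rateR N / rateL N) = rateR N ^ 2 by field_simp,
    Real.sqrt_sq hR.le]

theorem sqrt_mul_sqrt_tau_inv (hN : 2 ≤ N) : √(rateR N * rateL N) * (√(tau N))⁻¹ = rateL N := by
  have hL := rateL_pos hN
  have hR := rateR_pos hN
  rw [← Real.sqrt_inv, ← Real.sqrt_mul (by positivity), tau,
    show rateR N * rateL N * (rateR N / rateL N)⁻¹ = rateL N ^ 2 by field_simp,
    Real.sqrt_sq hL.le]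

theorem abs_tau_sub_one_le (hN : 2 ≤ N) : |tau N - 1| ≤ 8 * (N : ℝ) ^ (-(1 / 2) : ℝ) := by
  have hL := rateL_pos hN
  have h0 := rpow_neg_half_pos hN
  have e : tau N - 1 = -((N : ℝ) ^ (-(1 / 2) : ℝ) / rateL N) := by
    rw [← rateL_sub_rateR, tau]; field_simp; ring
  rw [e, abs_neg, abs_of_pos (by positivity), div_le_iff₀ hL]
  nlinarith [rateL_ge hN]

theorem abs_tau_inv_sub_one_le (hN : 2 ≤ N) :
    |(tau N)⁻¹ - 1| ≤ 8 * (N : ℝ) ^ (-(1 / 2) : ℝ) := by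
  have hR := rateR_pos hN
  have h0 := rpow_neg_half_pos hN
  have e : (tau N)⁻¹ - 1 = (N : ℝ) ^ (-(1 / 2) : ℝ) / rateR N := by
    rw [← rateL_sub_rateR, tau]; field_simp
  rw [e, abs_of_pos (by positivity), div_le_iff₀ hR]
  nlinarith [rateR_ge hN]

end Rates

/-! ### The exclusion process as a jump process -/

section ASEP

variable {N : ℕ}

/-- The rate of the jump over the bond `(x, x + 1)`, to the right or to the left. -/
noncomputable def rate (a : ZMod N → ℝ) (j : ZMod N × Bool) (s : State N) : ℝ :=
  if j.2 then a j.1 * (rateR N * if s.1 j.1 = true ∧ s.1 (j.1 + 1) = false then 1 else 0)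
  else a j.1 * (rateL N * if s.1 (j.1 + 1) = true ∧ s.1 j.1 = false then 1 else 0)

/-- The jump over the bond `(x, x + 1)`, to the right or to the left. -/
def jump (j : ZMod N × Bool) (s : State N) : State N :=
  if j.2 then jumpRight j.1 s else jumpLeft j.1 s

/-- The exponential of the height function at a site. -/
noncomputable def expHeight (y : ZMod N) (s : State N) : ℝ := tau N ^ ((s.2 y : ℝ) / 2)

/-- The configurations that are compatible with their height function. -/
def validStates (N : ℕ) : Set (State N) :=
  {s | ∀ x, s.2 x - s.2 (x - 1) = if s.1 x = true then 1 else -1}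

/-- The factor by which the exponential of the height function at `x` changes in a jump. -/
noncomputable def jumpFactor (N : ℕ) (b : Bool) : ℝ := if b then (tau N)⁻¹ else tau N

theorem expHeight_pos (hN : 2 ≤ N) (y : ZMod N) (s : State N) : 0 < expHeight y s :=
  Real.rpow_pos_of_pos (tau_pos hN) _

theorem expHeight_jump (hN : 2 ≤ N) (y : ZMod N) (j : ZMod N × Bool) (s : State N) :
    expHeight y (jump j s) = (if y = j.1 then jumpFactor N j.2 else 1) * expHeight y s := by
  obtain ⟨x, b⟩ := j
  have hτ := tau_pos hN
  by_cases hy : y = x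
  · subst hy
    cases b
    · simp only [expHeight, jump, jumpLeft, jumpFactor, Function.update_self, if_true,
        Bool.false_eq_true, if_false]
      push_cast
      rw [add_div, Real.rpow_add hτ, div_self two_ne_zero, Real.rpow_one, mul_comm]
    · simp only [expHeight, jump, jumpRight, jumpFactor, Function.update_self, if_true]
      push_cast
      rw [sub_div, Real.rpow_sub hτ, div_self two_ne_zero, Real.rpow_one, div_eq_inv_mul]
  · cases b <;> simp [expHeight, jump, jumpLeft, jumpRight, hy]

theorem rate_nonneg (hN : 2 ≤ N) {a : ZMod N → ℝ} (ha : ∀ x, 0 ≤ a x) (j : ZMod N × Bool)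
    (s : State N) : 0 ≤ rate a j s := by
  have := rateR_pos hN
  have := rateL_pos hN
  have := ha j.1
  unfold rate
  split_ifs <;> positivity

theorem rate_le (hN : 2 ≤ N) {A : ℝ} {a : ZMod N → ℝ} (ha : ∀ x, 0 ≤ a x) (haA : ∀ x, a x ≤ A)
    (j : ZMod N × Bool) (s : State N) : rate a j s ≤ A := by
  have := rateR_le hN
  have := rateL_le hN
  have := rateR_pos hN
  have := rateL_pos hN
  have h1 := ha j.1
  have h2 := haA j.1
  unfold rate
  split_ifs <;> nlinarith

theorem jumpFactor_le (hN : 2 ≤ N) (b : Bool) : jumpFactor N b ≤ (tau N)⁻¹ := by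
  have h1 := tau_pos hN
  have h2 := tau_le_one hN
  cases b
  · exact h2.trans ((one_le_inv₀ h1).2 h2)
  · exact le_rfl

theorem abs_jumpFactor_sub_one_le (hN : 2 ≤ N) (b : Bool) :
    |jumpFactor N b - 1| ≤ 8 * (N : ℝ) ^ (-(1 / 2) : ℝ) := by
  cases b
  · exact abs_tau_sub_one_le hN
  · exact abs_tau_inv_sub_one_le hN

theorem add_one_ne (hN : 2 ≤ N) (x : ZMod N) : x + 1 ≠ x := by
  have : Fact (1 < N) := ⟨by omega⟩
  simp

theorem sub_one_ne (hN : 2 ≤ N) (x : ZMod N) : x - 1 ≠ x := by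
  have : Fact (1 < N) := ⟨by omega⟩
  simp

/-- A jump of nonzero rate exchanges a particle with a hole, so the two height slopes next to the
moved height are exchanged as well. -/
theorem jump_mem_validStates (hN : 2 ≤ N) {a : ZMod N → ℝ} (j : ZMod N × Bool) {s : State N}
    (hs : s ∈ validStates N) (hj : rate a j s ≠ 0) : jump j s ∈ validStates N := by
  obtain ⟨x, b⟩ := j
  intro y
  have hy := hs y
  have hx1 := add_one_ne hN x
  have hx2 := sub_one_ne hN x
  cases b
  · have h : s.1 (x + 1) = true ∧ s.1 x = false := by
      by_contra h
      exact hj (by simp [rate, h])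
    by_cases hyx : y = x
    · subst hyx
      simp [jump, jumpLeft, hx2] at hy ⊢
      simp [h.2] at hy
      omega
    · by_cases hyx1 : y = x + 1
      · subst hyx1
        simp [jump, jumpLeft, hx1] at hy ⊢
        simp [h.1] at hy
        omega
      · have : y - 1 ≠ x := fun h => hyx1 (by rw [← h]; ring)
        simpa [jump, jumpLeft, hyx, hyx1, this] using hy
  · have h : s.1 x = true ∧ s.1 (x + 1) = false := by
      by_contra h
      exact hj (by simp [rate, h])
    by_cases hyx : y = x
    · subst hyx
      simp [jump, jumpRight, hx2, hx1.symm] at hy ⊢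
      simp [h.1] at hy
      omega
    · by_cases hyx1 : y = x + 1
      · subst hyx1
        simp [jump, jumpRight, hx1] at hy ⊢
        simp [h.2] at hy
        omega
      · have : y - 1 ≠ x := fun h => hyx1 (by rw [← h]; ring)
        simpa [jump, jumpRight, hyx, hyx1, this] using hy

/-- Neighbouring heights differ by one, so a neighbouring value of the transform is a multiple by
`√τ` or its inverse. This is what lets the Laplacian be read off from the local occupation
variables. -/
theorem expHeight_add_one (hN : 2 ≤ N) {s : State N} (hs : s ∈ validStates N) (x : ZMod N) :
    expHeight x s
      = (if s.1 x = true then √(tau N) else (√(tau N))⁻¹) * expHeight (x - 1) s := by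
  have hτ := tau_pos hN
  have h := hs x
  have e : ((s.2 x : ℤ) : ℝ) = s.2 (x - 1) + ((if s.1 x = true then 1 else -1 : ℤ) : ℝ) := by
    rw [← h]; push_cast; ring
  rw [expHeight, e, add_div, Real.rpow_add hτ, mul_comm, expHeight]
  congr 1
  split_ifs
  · rw [Real.sqrt_eq_rpow]; norm_num
  · rw [Real.sqrt_eq_rpow, ← Real.rpow_neg hτ.le]; norm_num

variable [NeZero N]

theorem generator_eq (a : ZMod N → ℝ) : generator a = jumpGen (rate a) jump := by
  funext f s
  rw [jumpGen_apply, Fintype.sum_prod_type, generator]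
  refine Finset.sum_congr rfl fun x _ => ?_
  simp only [Fintype.sum_bool, rate, jump, if_true, Bool.false_eq_true, if_false]
  split_ifs <;> ring

/-- The weight that dominates the exponentials of the height function. -/
noncomputable def heightWeight (s : State N) : ℝ := 1 + ∑ y, expHeight y s

theorem heightWeight_nonneg (hN : 2 ≤ N) (s : State N) : 0 ≤ heightWeight s :=
  add_nonneg zero_le_one (Finset.sum_nonneg fun y _ => (expHeight_pos hN y s).le)

theorem dom_expHeight (hN : 2 ≤ N) (y : ZMod N) : Dom heightWeight (expHeight y) := by
  refine ⟨1, fun s => ?_⟩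
  rw [abs_of_pos (expHeight_pos hN y s), one_mul, heightWeight]
  have := Finset.single_le_sum (f := fun y => expHeight y s)
    (fun y _ => (expHeight_pos hN y s).le) (Finset.mem_univ y)
  linarith

/-- Each jump multiplies one summand of the weight by `τ` or `τ⁻¹` and leaves the others alone. The
ratio may depend on `N`: it enters only qualitatively, for convergence of the series. -/
theorem jumpBounds (hN : 2 ≤ N) {A : ℝ} {a : ZMod N → ℝ} (ha : ∀ x, 0 ≤ a x)
    (haA : ∀ x, a x ≤ A) :
    JumpBounds (rate a) jump (validStates N) heightWeight A (tau N)⁻¹ where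
  rate_nonneg := rate_nonneg hN ha
  rate_le := rate_le hN ha haA
  weight_nonneg := heightWeight_nonneg hN
  weight_le j s := by
    have h1 : 1 ≤ (tau N)⁻¹ := (one_le_inv₀ (tau_pos hN)).2 (tau_le_one hN)
    rw [heightWeight, heightWeight, mul_add, mul_one, Finset.mul_sum]
    refine add_le_add h1 (Finset.sum_le_sum fun y _ => ?_)
    rw [expHeight_jump hN]
    refine mul_le_mul_of_nonneg_right ?_ (expHeight_pos hN y s).le
    split_ifs
    · exact jumpFactor_le hN _
    · exact h1
  inv j _ hs hj := jump_mem_validStates hN j hs hj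
  kappa_nonneg := (ha 0).trans (haA 0)
  ratio_nonneg := (inv_pos.2 (tau_pos hN)).le

theorem initial_mem_validStates (hN : 2 ≤ N) {η : ZMod N → Bool}
    (hη : 2 * (Finset.univ.filter fun x => η x = true).card = N) :
    ((η, initialHeight η) : State N) ∈ validStates N := by
  set f : ZMod N → ℤ := fun x => 2 * (if η x = true then 1 else 0) - 1
  have hf : ∀ x, f x = if η x = true then 1 else -1 := fun x => by
    simp only [f]; split_ifs <;> norm_num
  have hsum : ∑ y ∈ Finset.range N, f (y : ZMod N) = 0 := by
    have : ∑ y ∈ Finset.range N, f (y : ZMod N) = ∑ x, f x := by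
      refine Finset.sum_bij (fun y _ => (y : ZMod N)) (fun _ _ => Finset.mem_univ _) ?_ ?_
        fun _ _ => rfl
      · intro y hy z hz h
        have := congrArg ZMod.val h
        rwa [ZMod.val_cast_of_lt (Finset.mem_range.1 hy),
          ZMod.val_cast_of_lt (Finset.mem_range.1 hz)] at this
      · exact fun x _ => ⟨x.val, Finset.mem_range.2 (ZMod.val_lt x), ZMod.natCast_zmod_val x⟩
    rw [this]
    simp only [f, Finset.sum_sub_distrib, ← Finset.mul_sum, Finset.sum_boole]
    simp only [Finset.sum_const, Finset.card_univ, ZMod.card, mul_one, nsmul_eq_mul]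
    have : ((2 * (Finset.univ.filter fun x => η x = true).card : ℕ) : ℤ) = N := by rw [hη]
    push_cast at this
    linarith
  have hI : ∀ n, Finset.range (n + 1) = insert 0 (Finset.Ioc 0 n) := fun n => by
    ext y; simp
  -- The height omits the site `0`; adding the constant `f 0` turns it into a partial sum over `0,
  -- …, x`, and the constant drops out of differences.
  have hh : ∀ x, initialHeight η x + f 0 = ∑ y ∈ Finset.range (x.val + 1), f (y : ZMod N) := by
    intro x
    rw [hI, Finset.sum_insert (by simp), add_comm, Nat.cast_zero]
    rfl
  intro x
  show initialHeight η x - initialHeight η (x - 1) = if η x = true then 1 else -1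
  rw [← hf x]
  have h1 := hh x
  have h2 := hh (x - 1)
  -- Half filling matters only at the seam: the slopes sum to zero around the torus, so the height
  -- function closes up.
  rcases eq_or_ne x 0 with rfl | hx
  · have e : (0 - 1 : ZMod N).val + 1 = N := by
      obtain ⟨n, rfl⟩ : ∃ n, N = n + 1 := ⟨N - 1, by omega⟩
      rw [zero_sub, ZMod.val_neg_one]
    rw [e, hsum] at h2
    simp at h1
    linarith
  · have e : (x - 1).val + 1 = x.val := by
      have hv : x.val ≠ 0 := (ZMod.val_ne_zero x).2 hx
      have : Fact (1 < N) := ⟨by omega⟩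
      have := ZMod.val_sub (a := x) (b := 1) (by rw [ZMod.val_one]; omega)
      rw [ZMod.val_one] at this
      omega
    rw [e] at h2
    rw [Finset.sum_range_succ, ZMod.natCast_zmod_val] at h1
    linarith

theorem sum_laplacian_mul (f : ZMod N → ℝ) (y : ZMod N) :
    ∑ z, laplacian N y z * f z = f (y + 1) + f (y - 1) - 2 * f y := by
  simp only [laplacian, sub_mul, add_mul, ite_mul, one_mul, zero_mul, mul_assoc,
    Finset.sum_add_distrib, Finset.sum_sub_distrib, ← Finset.mul_sum, Finset.sum_ite_eq',
    Finset.mem_univ, if_true]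

theorem sum_hill_mul (a f : ZMod N → ℝ) (y : ZMod N) :
    ∑ z, hill a y z * f z = √(rateR N * rateL N) * a y * (f (y + 1) + f (y - 1) - 2 * f y)
      - nu N * (a y - 1) * f y := by
  rw [← sum_laplacian_mul, Finset.mul_sum]
  simp only [hill, sub_mul, Finset.sum_sub_distrib, mul_assoc, ite_mul, one_mul, zero_mul,
    ← Finset.mul_sum, Finset.sum_ite_eq', Finset.mem_univ, if_true]

/-- The Gärtner transform linearises the drift of the exclusion process. -/
theorem jumpGen_expHeight (hN : 2 ≤ N) (a : ZMod N → ℝ) {s : State N} (hs : s ∈ validStates N)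
    (y : ZMod N) :
    jumpGen (rate a) jump (expHeight y) s
      = ∑ z, hill a y z * expHeight z s - nu N * expHeight y s := by
  have hq := Real.sqrt_pos.2 (tau_pos hN)
  have h1 := sqrt_mul_sqrt_tau hN
  have h2 := sqrt_mul_sqrt_tau_inv hN
  have h3 := @rateR_add_rateL N
  have hR := rateR_pos hN
  have hL := rateL_pos hN
  rw [sum_hill_mul, jumpGen_apply, Fintype.sum_prod_type, Finset.sum_eq_single y]
  rotate_left
  · intro x _ hx
    simp [expHeight_jump hN, hx.symm]
  · simp
  · simp only [Fintype.sum_bool, expHeight_jump hN, if_true, jumpFactor,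
      Bool.false_eq_true, if_false]
    have e1 := expHeight_add_one hN hs (y + 1)
    have e2 := expHeight_add_one hN hs y
    rw [add_sub_cancel_right] at e1
    have e3 : expHeight (y - 1) s
        = (if s.1 y = true then (√(tau N))⁻¹ else √(tau N)) * expHeight y s := by
      rw [e2]; split_ifs <;> field_simp
    have t1 : rateR N * (tau N)⁻¹ = rateL N := by rw [tau]; field_simp
    have t2 : rateL N * tau N = rateR N := by rw [tau]; field_simp
    rw [e3, e1, nu]
    simp only [rate, if_true, Bool.false_eq_true, if_false]
    set X := expHeight y s
    set q := √(tau N)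
    set w := √(rateR N * rateL N)
    -- With equal occupations at `y` and `y + 1` no jump moves the height at `y`; otherwise exactly
    -- one direction is open. Each case is a linear consequence of `√(rℓ) √τ = r`, `√(rℓ) / √τ = ℓ`
    -- and `r + ℓ = 1`.
    rcases hA : s.1 y <;> rcases hB : s.1 (y + 1) <;> simp
    · linear_combination (-a y * X) * h1 + (-a y * X) * h2 + (-a y * X) * h3
    · linear_combination (-2 * a y * X) * h1 + (a y * X) * t2 + (-a y * X) * h3
    · linear_combination (-2 * a y * X) * h2 + (a y * X) * t1 + (-a y * X) * h3
    · linear_combination (-a y * X) * h1 + (-a y * X) * h2 + (-a y * X) * h3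

/-- A jump over a bond moves the height at its left end only, so the increment of a linear
combination is a single term and the quadratic variation is diagonal in space. -/
theorem jump_comb_sub (hN : 2 ≤ N) (b : ZMod N → ℝ) (j : ZMod N × Bool) (s : State N) :
    ∑ y, b y * expHeight y (jump j s) - ∑ y, b y * expHeight y s
      = b j.1 * ((jumpFactor N j.2 - 1) * expHeight j.1 s) := by
  rw [← Finset.sum_sub_distrib, Finset.sum_eq_single j.1]
  · rw [expHeight_jump hN, if_pos rfl]; ring
  · intro y _ hy
    rw [expHeight_jump hN, if_neg hy]; ring
  · simp

/-- Each bond carries two directions of rate at most `A`, with relative jumps at most `8 N^{-1/2}`.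
Bounding rates crudely discards the exact form of the bracket, which suffices for upper moment
bounds. -/
theorem sum_rate_mul_jump_pow_le (hN : 2 ≤ N) {A : ℝ} {a : ZMod N → ℝ} (ha : ∀ x, 0 ≤ a x)
    (haA : ∀ x, a x ≤ A) (b : ZMod N → ℝ) (s : State N) {k : ℕ} (hk : Even k) :
    ∑ j, rate a j s * (∑ y, b y * expHeight y (jump j s) - ∑ y, b y * expHeight y s) ^ k
      ≤ ∑ y, 2 * A * (8 * (N : ℝ) ^ (-(1 / 2) : ℝ)) ^ k * (b y ^ k * expHeight y s ^ k) := by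
  rw [Fintype.sum_prod_type]
  refine Finset.sum_le_sum fun x _ => ?_
  have h : ∀ β : Bool, rate a (x, β) s
      * (∑ y, b y * expHeight y (jump (x, β) s) - ∑ y, b y * expHeight y s) ^ k
      ≤ A * ((8 * (N : ℝ) ^ (-(1 / 2) : ℝ)) ^ k * (b x ^ k * expHeight x s ^ k)) := by
    intro β
    have hb := hk.pow_nonneg (b x)
    have he := hk.pow_nonneg (expHeight x s)
    refine mul_le_mul (rate_le hN ha haA _ s) ?_ (hk.pow_nonneg _) ((ha x).trans (haA x))
    rw [jump_comb_sub hN, mul_pow, mul_pow, mul_left_comm]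
    refine mul_le_mul_of_nonneg_right ?_ (mul_nonneg hb he)
    rw [← hk.pow_abs]
    exact pow_le_pow_left₀ (abs_nonneg _) (abs_jumpFactor_sub_one_le hN β) k
  rw [Fintype.sum_bool]
  linarith [h true, h false]

end ASEP


/-! ### Exponentials of matrices -/

section MatrixExp

variable {n : Type*} [Fintype n] [DecidableEq n]

theorem hasDerivAt_matrix_exp_apply (H : Matrix n n ℝ) (t : ℝ) (x y : n) :
    HasDerivAt (fun t : ℝ => NormedSpace.exp (t • H) x y)
      (∑ z, NormedSpace.exp (t • H) x z * H z y) t := by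
  let _ : NormedRing (Matrix n n ℝ) := Matrix.linftyOpNormedRing
  let _ : NormedAlgebra ℝ (Matrix n n ℝ) := Matrix.linftyOpNormedAlgebra
  have h := hasDerivAt_exp_smul_const (𝕂 := ℝ) H t
  let l : Matrix n n ℝ →L[ℝ] ℝ := LinearMap.toContinuousLinearMap (Matrix.entryLinearMap ℝ ℝ x y)
  have := l.hasFDerivAt.comp_hasDerivAt t h
  exact this

theorem continuous_matrix_exp : Continuous (NormedSpace.exp : Matrix n n ℝ → Matrix n n ℝ) := by
  let _ : NormedRing (Matrix n n ℝ) := Matrix.linftyOpNormedRing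
  let _ : NormedAlgebra ℝ (Matrix n n ℝ) := Matrix.linftyOpNormedAlgebra
  let _ : NormedAlgebra ℚ (Matrix n n ℝ) := NormedAlgebra.restrictScalars ℚ ℝ _
  exact NormedSpace.exp_continuous

theorem matrix_exp_nonneg_of_nonneg {H : Matrix n n ℝ} (hH : ∀ x y, 0 ≤ H x y) (x y : n) :
    0 ≤ NormedSpace.exp H x y := by
  let _ : NormedRing (Matrix n n ℝ) := Matrix.linftyOpNormedRing
  let _ : NormedAlgebra ℝ (Matrix n n ℝ) := Matrix.linftyOpNormedAlgebra
  let _ : NormedAlgebra ℚ (Matrix n n ℝ) := NormedAlgebra.restrictScalars ℚ ℝ _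
  have h := NormedSpace.exp_series_hasSum_exp' (𝕂 := ℝ) H
  let l : Matrix n n ℝ →L[ℝ] ℝ := LinearMap.toContinuousLinearMap (Matrix.entryLinearMap ℝ ℝ x y)
  have h2 := l.hasSum h
  refine h2.nonneg fun k => ?_
  have hp : ∀ k : ℕ, ∀ x y, 0 ≤ (H ^ k) x y := by
    intro k
    induction k with
    | zero =>
      intro x y
      rw [pow_zero, Matrix.one_apply]
      split_ifs <;> norm_num
    | succ k ih =>
      intro x y
      rw [pow_succ, Matrix.mul_apply]
      exact Finset.sum_nonneg fun z _ => mul_nonneg (ih x z) (hH z y)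
  exact mul_nonneg (by positivity) (hp k x y)

/-- The exponential of a matrix with nonnegative off-diagonal entries is nonnegative. -/
theorem matrix_exp_nonneg {H : Matrix n n ℝ} (hH : ∀ x y, x ≠ y → 0 ≤ H x y) {t : ℝ} (ht : 0 ≤ t)
    (x y : n) : 0 ≤ NormedSpace.exp (t • H) x y := by
  -- Adding this multiple of the identity makes the diagonal nonnegative; since it commutes with
  -- `H`, it changes the exponential only by a positive scalar.
  set l : ℝ := ∑ x, |H x x|
  have hl : ∀ x y, 0 ≤ (H + Matrix.diagonal fun _ => l : Matrix n n ℝ) x y := by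
    intro x y
    rw [Matrix.add_apply]
    rcases eq_or_ne x y with rfl | hxy
    · rw [Matrix.diagonal_apply_eq]
      have : |H x x| ≤ l :=
        Finset.single_le_sum (f := fun x => |H x x|) (fun _ _ => abs_nonneg _) (Finset.mem_univ x)
      linarith [neg_abs_le (H x x)]
    · rw [Matrix.diagonal_apply_ne _ hxy, add_zero]
      exact hH x y hxy
  have e : t • H = t • (H + Matrix.diagonal fun _ => l) + Matrix.diagonal fun _ => -(t * l) := by
    ext x y
    simp only [Matrix.smul_apply, Matrix.add_apply, Matrix.diagonal_apply, smul_eq_mul]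
    split_ifs <;> ring
  have hc : Commute (t • (H + Matrix.diagonal fun _ => l))
      (Matrix.diagonal fun _ : n => -(t * l)) := by
    rw [show (Matrix.diagonal fun _ : n => -(t * l)) = (-(t * l)) • (1 : Matrix n n ℝ) from
      (Matrix.smul_one_eq_diagonal _).symm]
    exact (Commute.one_right (t • (H + Matrix.diagonal fun _ => l))).smul_right _
  rw [e, Matrix.exp_add_of_commute _ _ hc, Matrix.exp_diagonal, Matrix.mul_diagonal]
  refine mul_nonneg (matrix_exp_nonneg_of_nonneg (fun x y => ?_) x y) ?_
  · exact mul_nonneg ht (hl x y)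
  · rw [Pi.coe_exp]
    simp only [← Real.exp_eq_exp_ℝ]
    exact (Real.exp_pos _).le

end MatrixExp

/-! ### The kernels -/

section Kernels

variable {N : ℕ}

theorem laplacian_nonneg {x y : ZMod N} (h : x ≠ y) : 0 ≤ laplacian N x y := by
  rw [laplacian, if_neg h.symm]
  have h1 : (0 : ℝ) ≤ if y = x + 1 then 1 else 0 := by split_ifs <;> norm_num
  have h2 : (0 : ℝ) ≤ if y = x - 1 then 1 else 0 := by split_ifs <;> norm_num
  linarith

theorem laplacian_add (x y z : ZMod N) : laplacian N (x + z) (y + z) = laplacian N x y := by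
  have h1 : y + z = x + z + 1 ↔ y = x + 1 := by
    rw [add_right_comm, add_left_inj]
  have h2 : y + z = x + z - 1 ↔ y = x - 1 := by
    rw [add_sub_right_comm, add_left_inj]
  simp only [laplacian, h1, h2, add_left_inj]

variable [NeZero N]

theorem kernelQ_nonneg {a : ZMod N → ℝ} (ha : ∀ x, 0 ≤ a x) {t : ℝ} (ht : 0 ≤ t) (x y : ZMod N) :
    0 ≤ kernelQ a t x y := by
  refine matrix_exp_nonneg (fun x y hxy => ?_) ht x y
  rw [hill, if_neg hxy.symm, mul_zero, sub_zero]
  exact mul_nonneg (mul_nonneg (Real.sqrt_nonneg _) (ha x)) (laplacian_nonneg hxy)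

theorem kernelQ_zero (a : ZMod N → ℝ) (x y : ZMod N) :
    kernelQ a 0 x y = if x = y then 1 else 0 := by
  rw [kernelQ, zero_smul, NormedSpace.exp_zero, Matrix.one_apply]

theorem hasDerivAt_kernelQ (a : ZMod N → ℝ) (t : ℝ) (x y : ZMod N) :
    HasDerivAt (fun t => kernelQ a t x y) (∑ z, kernelQ a t x z * hill a z y) t :=
  hasDerivAt_matrix_exp_apply _ _ _ _

theorem heatKernel_eq (t : ℝ) (x y : ZMod N) :
    heatKernel N t x y = NormedSpace.exp (t • ((1 / 2 : ℝ) • laplacian N)) x y := by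
  rw [heatKernel, smul_smul, mul_one_div]

theorem heatKernel_nonneg {t : ℝ} (ht : 0 ≤ t) (x y : ZMod N) : 0 ≤ heatKernel N t x y := by
  rw [heatKernel_eq]
  exact matrix_exp_nonneg (fun x y hxy => mul_nonneg (by norm_num) (laplacian_nonneg hxy)) ht x y

theorem heatKernel_zero (x y : ZMod N) : heatKernel N 0 x y = if x = y then 1 else 0 := by
  rw [heatKernel, zero_div, zero_smul, NormedSpace.exp_zero, Matrix.one_apply]

theorem hasDerivAt_sum_heatKernel (f : ZMod N → ℝ) (t : ℝ) (x : ZMod N) :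
    HasDerivAt (fun t => ∑ y, heatKernel N t x y * f y)
      (∑ y, heatKernel N t x y * ((f (y + 1) + f (y - 1) - 2 * f y) / 2)) t := by
  have h : ∀ y, HasDerivAt (fun t => heatKernel N t x y * f y)
      ((∑ z, heatKernel N t x z * ((1 / 2 : ℝ) • laplacian N) z y) * f y) t := fun y => by
    simp only [heatKernel_eq]
    exact (hasDerivAt_matrix_exp_apply _ t x y).mul_const _
  refine (HasDerivAt.fun_sum fun y (_ : y ∈ Finset.univ) => h y).congr_deriv ?_
  rw [Finset.sum_congr rfl fun y _ => Finset.sum_mul _ _ _, Finset.sum_comm]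
  refine Finset.sum_congr rfl fun z _ => ?_
  rw [← sum_laplacian_mul, Finset.sum_div, Finset.mul_sum]
  refine Finset.sum_congr rfl fun y _ => ?_
  simp only [heatKernel_eq, Matrix.smul_apply, smul_eq_mul]
  ring

theorem sum_heatKernel (t : ℝ) (x : ZMod N) : ∑ y, heatKernel N t x y = 1 := by
  have h : ∀ t, HasDerivAt (fun t => ∑ y, heatKernel N t x y * 1) 0 t := fun t => by
    convert hasDerivAt_sum_heatKernel (fun _ => (1 : ℝ)) t x using 1
    symm
    exact Finset.sum_eq_zero fun y _ => by norm_num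
  have := is_const_of_deriv_eq_zero (fun t => (h t).differentiableAt) (fun t => (h t).deriv) t 0
  simpa [heatKernel_zero] using this

/-- Relabelling the sites by a translation is an algebra automorphism that fixes the Laplacian,
hence also its exponential. -/
theorem heatKernel_add (t : ℝ) (x y z : ZMod N) :
    heatKernel N t (x + z) (y + z) = heatKernel N t x y := by
  let φ : Matrix (ZMod N) (ZMod N) ℝ ≃ₐ[ℝ] Matrix (ZMod N) (ZMod N) ℝ :=
    Matrix.reindexAlgEquiv ℝ ℝ (Equiv.addRight z)
  have hφ : Continuous φ := by
    exact LinearMap.continuous_of_finiteDimensional φ.toLinearMap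
  let _ : NormedRing (Matrix (ZMod N) (ZMod N) ℝ) := Matrix.linftyOpNormedRing
  let _ : NormedAlgebra ℝ (Matrix (ZMod N) (ZMod N) ℝ) := Matrix.linftyOpNormedAlgebra
  let _ : NormedAlgebra ℚ (Matrix (ZMod N) (ZMod N) ℝ) := NormedAlgebra.restrictScalars ℚ ℝ _
  have h := NormedSpace.map_exp φ hφ ((t / 2) • laplacian N)
  have e : φ ((t / 2) • laplacian N) = (t / 2) • laplacian N := by
    rw [map_smul]
    congr 1
    ext x y
    simp only [φ, Matrix.coe_reindexAlgEquiv, Matrix.reindex_apply, Matrix.submatrix_apply]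
    have := laplacian_add (x - z) (y - z) z
    simp only [sub_add_cancel] at this
    rw [this]
    simp [sub_eq_add_neg]
  rw [e] at h
  have h3 : φ (NormedSpace.exp ((t / 2) • laplacian N)) (x + z) (y + z)
      = heatKernel N t (x + z) (y + z) := congrFun (congrFun h (x + z)) (y + z)
  rw [← h3]
  simp [φ, heatKernel]

end Kernels

/-! ### Distances on the torus -/

section Dist

variable {N : ℕ} [NeZero N]

theorem card_arc (x x' : ZMod N) : (arc x x').card = (x' - x).val := by
  have : arc x x' = (Finset.Ioc 0 (x' - x).val).image fun n : ℕ => x + (n : ZMod N) := by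
    ext y
    simp only [arc, Finset.mem_filter, Finset.mem_univ, true_and, Finset.mem_image, Finset.mem_Ioc]
    constructor
    · intro h
      exact ⟨(y - x).val, h, by rw [ZMod.natCast_zmod_val]; ring⟩
    · rintro ⟨n, hn, rfl⟩
      rw [add_sub_cancel_left, ZMod.val_cast_of_lt (hn.2.trans_lt (ZMod.val_lt _))]
      exact hn
  rw [this, Finset.card_image_of_injOn]
  · simp
  · intro m hm n hn h
    have hm' : m < N := (Finset.mem_Ioc.1 hm).2.trans_lt (ZMod.val_lt _)
    have hn' : n < N := (Finset.mem_Ioc.1 hn).2.trans_lt (ZMod.val_lt _)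
    have := congrArg ZMod.val (add_left_cancel h)
    rwa [ZMod.val_cast_of_lt hm', ZMod.val_cast_of_lt hn'] at this

theorem torusDist_eq (x x' : ZMod N) : torusDist x x' = (x' - x).valMinAbs.natAbs := by
  rw [torusDist, card_arc, card_arc, ZMod.valMinAbs_natAbs_eq_min]
  rcases eq_or_ne (x' - x) 0 with h | h
  · rw [h]; simp
  · rw [← neg_sub x' x, ZMod.neg_val, if_neg h]

theorem torusDist_self (x : ZMod N) : torusDist x x = 0 := by
  rw [torusDist_eq]; simp

theorem torusDist_le (x x' : ZMod N) : torusDist x x' ≤ N := by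
  rw [torusDist_eq]
  exact (ZMod.natAbs_valMinAbs_le _).trans (Nat.div_le_self _ _)

theorem torusDist_pos {x x' : ZMod N} (h : x ≠ x') : 1 ≤ torusDist x x' := by
  rw [torusDist_eq, Nat.one_le_iff_ne_zero, Int.natAbs_ne_zero, Ne, ZMod.valMinAbs_eq_zero,
    sub_eq_zero]
  exact h.symm

theorem torusDist_sq_le (x x' : ZMod N) (m : ℤ) (h : (m : ZMod N) = x' - x) :
    (torusDist x x' : ℝ) ^ 2 ≤ (m : ℝ) ^ 2 := by
  have h1 : torusDist x x' ≤ m.natAbs := by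
    rw [torusDist_eq, ← h]
    exact ZMod.natAbs_min_of_le_div_two N _ m (by simp) (ZMod.natAbs_valMinAbs_le _)
  have h2 : (torusDist x x' : ℝ) ≤ |(m : ℝ)| := by
    rw [← Int.cast_abs, Int.abs_eq_natAbs]
    exact_mod_cast h1
  rw [← sq_abs (m : ℝ)]
  exact pow_le_pow_left₀ (Nat.cast_nonneg _) h2 2

/-- Let `m` be the shortest integer representative of the displacement. The neighbours have
representatives `m ± 1`, for which the second difference of the square is exactly `2`; wrapping
around the torus only shortens distances. -/
theorem torusDist_sq_laplacian_le (x y : ZMod N) :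
    (torusDist x (y + 1) : ℝ) ^ 2 + (torusDist x (y - 1) : ℝ) ^ 2 - 2 * (torusDist x y : ℝ) ^ 2
      ≤ 2 := by
  set m := (y - x).valMinAbs
  have hm : (m : ZMod N) = y - x := ZMod.coe_valMinAbs _
  have h1 := torusDist_sq_le x (y + 1) (m + 1) (by push_cast; rw [hm]; ring)
  have h2 := torusDist_sq_le x (y - 1) (m - 1) (by push_cast; rw [hm]; ring)
  have h3 : (torusDist x y : ℝ) ^ 2 = (m : ℝ) ^ 2 := by
    rw [torusDist_eq, ← sq_abs (m : ℝ), ← Int.cast_abs, Int.abs_eq_natAbs]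
    simp [m]
  push_cast at h1 h2
  rw [h3]
  nlinarith

/-- The second moment vanishes at time zero and, since half the Laplacian of the squared distance is
at most one, grows at rate at most one. -/
theorem sum_heatKernel_mul_torusDist_sq_le {t : ℝ} (ht : 0 ≤ t) (x : ZMod N) :
    ∑ y, heatKernel N t x y * (torusDist x y : ℝ) ^ 2 ≤ t := by
  set u : ℝ → ℝ := fun t => ∑ y, heatKernel N t x y * (torusDist x y : ℝ) ^ 2
  have hu := hasDerivAt_sum_heatKernel (fun y => (torusDist x y : ℝ) ^ 2) (x := x)
  have hmono : MonotoneOn (fun t => t - u t) (Set.Ici 0) := by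
    refine monotoneOn_of_deriv_nonneg (convex_Ici 0) ?_ ?_ ?_
    · exact fun t _ => ((hasDerivAt_id t).sub (hu t)).continuousAt.continuousWithinAt
    · exact fun t _ => ((hasDerivAt_id t).sub (hu t)).differentiableAt.differentiableWithinAt
    · intro t ht
      rw [interior_Ici] at ht
      have e := ((hasDerivAt_id t).sub (hu t)).deriv
      have e : deriv (fun t => t - u t) t = _ := e
      rw [e, sub_nonneg, ← sum_heatKernel t x]
      refine Finset.sum_le_sum fun y _ => ?_
      have := torusDist_sq_laplacian_le x y
      have h0 := heatKernel_nonneg (le_of_lt ht) x y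
      nlinarith
  have h := hmono Set.self_mem_Ici ht ht
  have h0 : u 0 = 0 := by
    simp [u, heatKernel_zero, torusDist_self]
  simp only [h0] at h
  linarith

end Dist


/-! ### Convexity bounds and integrable power singularities. -/

theorem add_pow_le_of_even {k : ℕ} (hk : Even k) (x y : ℝ) :
    (x + y) ^ k ≤ 2 ^ k * (x ^ k + y ^ k) := by
  rw [← hk.pow_abs x, ← hk.pow_abs y, ← hk.pow_abs (x + y)]
  have h := abs_add_le x y
  have hx := pow_nonneg (abs_nonneg x) k
  have hy := pow_nonneg (abs_nonneg y) k
  rcases le_total |x| |y| with h' | h'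
  · calc |x + y| ^ k ≤ (2 * |y|) ^ k := by gcongr; linarith
      _ ≤ _ := by rw [mul_pow]; gcongr; linarith
  · calc |x + y| ^ k ≤ (2 * |x|) ^ k := by gcongr; linarith
      _ ≤ _ := by rw [mul_pow]; gcongr; linarith

/-- A primitive of the normalised power `(t - s) ^ (θ - 1)`. -/
theorem exists_power_majorant {t θ : ℝ} (ht : 0 < t) (hθ : 0 < θ) :
    ∃ g g' : ℝ → ℝ, ContinuousOn g (Set.Icc 0 t) ∧ (∀ s ∈ Set.Ioo 0 t, HasDerivAt g (g' s) s) ∧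
      g t - g 0 ≤ 1 ∧ (∀ s ∈ Set.Ioo 0 t, 0 ≤ g' s) ∧
      ∀ s ∈ Set.Ioo 0 t, (t - s) ^ (θ - 1) = t ^ θ / θ * g' s := by
  refine ⟨fun s => -(t - s) ^ θ / t ^ θ, fun s => θ * (t - s) ^ (θ - 1) / t ^ θ, ?_, ?_, ?_, ?_, ?_⟩
  · refine ContinuousOn.div_const (ContinuousOn.neg ?_) _
    exact (continuousOn_const.sub continuousOn_id).rpow_const fun _ _ => Or.inr hθ.le
  · intro s hs
    have h1 : HasDerivAt (fun s => t - s) (-1) s := (hasDerivAt_id s).const_sub t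
    have h2 := (h1.rpow_const (p := θ) (Or.inl (sub_pos.2 hs.2).ne')).neg.div_const (t ^ θ)
    refine h2.congr_deriv ?_
    ring
  · have := Real.rpow_pos_of_pos ht θ
    simp only [sub_self, Real.zero_rpow hθ.ne', sub_zero]
    rw [neg_div, neg_div, zero_div, div_self this.ne']
    norm_num
  · intro s hs
    have := Real.rpow_nonneg (sub_pos.2 hs.2).le (θ - 1)
    have := Real.rpow_pos_of_pos ht θ
    positivity
  · intro s hs
    have := Real.rpow_pos_of_pos ht θ
    field_simp

section Pair

variable {S J : Type*} [Fintype J] {c : J → S → ℝ} {τ : J → S → S} {V : Set S} {v : S → ℝ}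
  {κ R : ℝ} {Φ : (S → ℝ) → ℝ}

/-- Splits a function at the later time into its deviation from a function `f₀` of the initial
state, to be treated as noise, and `f₀` itself. -/
theorem JumpBounds.evol_pow_le (h : JumpBounds c τ V v κ R) {k : ℕ} (hk : Even k)
    (hΦ : PosFun V (fun s => v s ^ k) Φ) {f f₀ : S → ℝ} (hf : Dom v f) (hf₀ : Dom v f₀) {t : ℝ}
    (ht : 0 ≤ t) :
    evol (jumpGen c τ) Φ t (fun s => f s ^ k)
      ≤ 2 ^ k * (evol (jumpGen (pairRate c) (pairJump τ)) (diagFun Φ) t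
          (fun p => (f p.2 - f₀ p.1) ^ k) + Φ fun s => f₀ s ^ k) := by
  have hP := (h.pair.pow k).posFun_evol hΦ.diag ht
  have h1 : Dom (fun p : S × S => (v p.1 + v p.2) ^ k) fun p => (f p.2 - f₀ p.1) ^ k :=
    ((hf.snd h.weight_nonneg).sub (hf₀.fst h.weight_nonneg)).pow k
  have h2 : Dom (fun p : S × S => (v p.1 + v p.2) ^ k) fun p => f₀ p.1 ^ k :=
    (hf₀.fst h.weight_nonneg).pow k
  have h3 : Dom (fun p : S × S => (v p.1 + v p.2) ^ k) fun p => f p.2 ^ k :=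
    (hf.snd h.weight_nonneg).pow k
  rw [← evol_pair_snd, ← evol_pair_fst (c := c) (τ := τ) t (fun s => f₀ s ^ k) hΦ.zero,
    ← hP.add _ _ h1 h2, ← hP.smul _ _ (h1.add h2)]
  refine hP.mono h3 ((h1.add h2).smul _) fun p _ => ?_
  have := add_pow_le_of_even hk (f p.2 - f₀ p.1) (f₀ p.1)
  rwa [sub_add_cancel] at this

end Pair

/-! ### Moments of the stochastic convolution -/

section Convolution

variable {N : ℕ} [NeZero N]

/-- Linear combinations of the rows of the kernel `Q`. -/
noncomputable def kernelComb (a θ : ZMod N → ℝ) (r : ℝ) (y : ZMod N) : ℝ :=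
  ∑ x, θ x * kernelQ a r x y

/-- The Gärtner transform of a state. -/
noncomputable def gaertnerAt (t : ℝ) (y : ZMod N) (s : State N) : ℝ :=
  expHeight y s * Real.exp (nu N * t)

/-- The constant of the moment bound for stochastic convolutions. -/
noncomputable def convolutionConst (A : ℝ) (K : ℕ) : ℝ :=
  (3 * (((K : ℝ) + 2) ^ 2 * 2 ^ K) + 1) * (8 * (1 + 2 * A))

theorem dom_gaertnerAt (hN : 2 ≤ N) (t : ℝ) (y : ZMod N) :
    Dom heightWeight (gaertnerAt t y) := by
  have := (dom_expHeight hN y).smul (Real.exp (nu N * t))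
  convert this using 1
  funext s
  simp [gaertnerAt, mul_comm]

theorem dom_sum_gaertnerAt (hN : 2 ≤ N) (t : ℝ) (b : ZMod N → ℝ) :
    Dom heightWeight fun s => ∑ y, b y * gaertnerAt t y s :=
  Dom.comb (fun y => dom_gaertnerAt hN t y) b

theorem kernelComb_zero (a θ : ZMod N → ℝ) (y : ZMod N) : kernelComb a θ 0 y = θ y := by
  simp [kernelComb, kernelQ_zero]

theorem hasDerivAt_kernelComb (a θ : ZMod N → ℝ) (r : ℝ) (y : ZMod N) :
    HasDerivAt (fun r => kernelComb a θ r y) (∑ z, kernelComb a θ r z * hill a z y) r := by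
  have := HasDerivAt.fun_sum fun x (_ : x ∈ Finset.univ) =>
    (hasDerivAt_kernelQ a r x y).const_mul (θ x)
  refine this.congr_deriv ?_
  simp only [kernelComb, Finset.sum_mul, Finset.mul_sum]
  rw [Finset.sum_comm]
  exact Finset.sum_congr rfl fun z _ => Finset.sum_congr rfl fun x _ => by ring

/-- Duhamel's principle in martingale form. The two conditions on `ρ` control the quadratic
variation and the jumps of order `K + 2`; the a priori moment bound `B` may depend on time, as the
exponential damping used later requires. -/
theorem convolution_moment_le (hN : 2 ≤ N) {A : ℝ} {a : ZMod N → ℝ} (ha : ∀ x, 0 ≤ a x)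
    (haA : ∀ x, a x ≤ A) {K : ℕ} (hK : Even K) {Φ : (State N → ℝ) → ℝ}
    (hΦ : PosFun (validStates N) (fun s => heightWeight s ^ (K + 2)) Φ) (θ : ZMod N → ℝ)
    (t₀ : ℝ) {t ρ : ℝ} (ht : 0 < t) (hρ : 0 < ρ) {B : ℝ → ℝ}
    (hB : ∀ s ∈ Set.Ioo 0 t, 0 < B s)
    (hZ : ∀ s ∈ Set.Ioo 0 t, ∀ y, evol (jumpGen (rate a) jump) Φ s
      (fun x => gaertnerAt (t₀ + s) y x ^ (K + 2)) ≤ B s ^ (K + 2))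
    {M Bmax c₂ p : ℝ} (hp : 0 < p) (hM : ∀ s ∈ Set.Ioo 0 t, ∀ y, |kernelComb a θ (t - s) y| ≤ M)
    (hBm : ∀ s ∈ Set.Ioo 0 t, B s ≤ Bmax)
    (h2 : ∀ s ∈ Set.Ioo 0 t, 1 / N * ∑ y, kernelComb a θ (t - s) y ^ 2 * B s ^ 2
      ≤ c₂ * (t - s) ^ (p - 1))
    (hρ2 : c₂ * (t ^ p / p) ≤ ρ ^ 2)
    (hρk : ((N : ℝ) ^ (-(1 / 2) : ℝ) * M * Bmax) ^ K * (c₂ * (t ^ p / p)) ≤ ρ ^ (K + 2)) :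
    evol (jumpGen (pairRate (rate a)) (pairJump jump)) (diagFun Φ) t
        (fun p => (∑ y, θ y * gaertnerAt (t₀ + t) y p.2
          - ∑ y, kernelComb a θ t y * gaertnerAt t₀ y p.1) ^ (K + 2))
      ≤ (convolutionConst A K * ρ) ^ (K + 2) := by
  have hA : 0 ≤ A := (ha 0).trans (haA 0)
  have hJ := jumpBounds hN ha haA
  have hKe : Even (K + 2) := hK.add even_two
  obtain ⟨g, g', hgc, hg, hg1, hg0, hgp⟩ := exists_power_majorant ht hp
  set ε : ℝ := (N : ℝ) ^ (-(1 / 2) : ℝ)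
  have hε : 0 < ε := rpow_neg_half_pos hN
  have hε2 : ε ^ 2 = 1 / N := rpow_neg_half_sq hN
  set q : ℝ → ZMod N → ℝ := fun s y => kernelComb a θ (t - s) y
  -- The kernel runs backwards in time: at `s = t` the martingale is the quantity of interest, at `s
  -- = 0` it is the kernel applied to the starting profile.
  set b : ZMod N → ℝ → ℝ := fun y s => q s y * Real.exp (nu N * (t₀ + s))
  set b' : ZMod N → ℝ → ℝ := fun y s =>
    -(∑ z, q s z * hill a z y) * Real.exp (nu N * (t₀ + s))
      + q s y * (Real.exp (nu N * (t₀ + s)) * nu N)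
  have hb : ∀ y s, HasDerivAt (b y) (b' y s) s := by
    intro y s
    have h1 : HasDerivAt (fun s => t - s) (-1) s := (hasDerivAt_id s).const_sub t
    have h2 : HasDerivAt (fun s => q s y) ((∑ z, q s z * hill a z y) * -1) s :=
      (hasDerivAt_kernelComb a θ (t - s) y).comp s h1
    have h3 : HasDerivAt (fun s => Real.exp (nu N * (t₀ + s)))
        (Real.exp (nu N * (t₀ + s)) * (nu N * 1)) s :=
      (((hasDerivAt_id s).const_add t₀).const_mul (nu N)).exp
    refine (h2.mul h3).congr_deriv ?_
    simp only [b']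
    ring
  set m : ℝ → State N → ℝ := fun s x => ∑ y, b y s * expHeight y x
  have hkey := hJ.martingale_moment_le (I' := ZMod N) hK hΦ (fun y => dom_expHeight hN y) hb
    (m := m) (fun _ _ => rfl) ?_ ht.le (ρ := 8 * (1 + 2 * A) * ρ) (by positivity) hgc hg hg1 hg0
    -- The transform is normalised by its moment bound, so that its moments of order `K + 2` are at
    -- most one.
    (ζ := fun y s x => (B s)⁻¹ * gaertnerAt (t₀ + s) y x)
    (fun y s => (dom_gaertnerAt hN (t₀ + s) y).smul _)
    (e := fun y s => 2 * A * (8 * ε) ^ 2 * (q s y ^ 2 * B s ^ 2))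
    (e' := fun y s => 2 * A * (8 * ε) ^ (K + 2) * (q s y ^ (K + 2) * B s ^ (K + 2)))
    (fun y s => by positivity)
    (fun y s => mul_nonneg (by positivity) (mul_nonneg (hKe.pow_nonneg _) (hKe.pow_nonneg _)))
    ?_ ?_ ?_ ?_ ?_
  · have e1 : (fun p : State N × State N => (∑ y, θ y * gaertnerAt (t₀ + t) y p.2
          - ∑ y, kernelComb a θ t y * gaertnerAt t₀ y p.1) ^ (K + 2))
        = fun p => (m t p.2 - m 0 p.1) ^ (K + 2) := by
      funext p
      simp only [m, b, q, sub_self, kernelComb_zero, sub_zero, add_zero, gaertnerAt]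
      congr 2
      · exact Finset.sum_congr rfl fun y _ => by ring
      · exact Finset.sum_congr rfl fun y _ => by ring
    rw [e1]
    refine hkey.trans_eq ?_
    rw [convolutionConst]
    ring
  -- The drift vanishes: the time derivative of the reversed kernel cancels the Hill operator
  -- produced by the generator, and the factor `e^{νt}` absorbs the remaining `-ν`.
  · intro s x hx
    have e : m s = ∑ y, b y s • expHeight y := by
      funext x; simp [m]
    rw [e, map_sum, Finset.sum_apply]
    simp only [map_smul, Pi.smul_apply, smul_eq_mul, jumpGen_expHeight hN a hx, b', b, mul_sub,
      add_mul, Finset.sum_add_distrib, Finset.sum_sub_distrib]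
    have e2 : ∑ y, -(∑ z, q s z * hill a z y) * Real.exp (nu N * (t₀ + s)) * expHeight y x
        = -∑ y, q s y * Real.exp (nu N * (t₀ + s)) * ∑ z, hill a y z * expHeight z x := by
      simp only [neg_mul, Finset.sum_neg_distrib, Finset.sum_mul, Finset.mul_sum]
      rw [Finset.sum_comm]
      congr 1
      exact Finset.sum_congr rfl fun z _ => Finset.sum_congr rfl fun y _ => by ring
    rw [e2]
    have e3 : ∑ y, q s y * (Real.exp (nu N * (t₀ + s)) * nu N) * expHeight y x
        = ∑ y, q s y * Real.exp (nu N * (t₀ + s)) * (nu N * expHeight y x) :=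
      Finset.sum_congr rfl fun y _ => by ring
    rw [e3]
    ring
  · intro s hs x _
    have := sum_rate_mul_jump_pow_le hN ha haA (fun y => b y s) x even_two
    change _ ≤ ∑ y, 2 * A * (8 * ε) ^ 2 * _ at this
    refine this.trans_eq (Finset.sum_congr rfl fun y _ => ?_)
    have := (hB s hs).ne'
    simp only [b, gaertnerAt]
    field_simp
  · intro s hs x _
    have := sum_rate_mul_jump_pow_le hN ha haA (fun y => b y s) x hKe
    change _ ≤ ∑ y, 2 * A * (8 * ε) ^ (K + 2) * _ at this
    refine this.trans_eq (Finset.sum_congr rfl fun y _ => ?_)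
    have := (hB s hs).ne'
    simp only [b, gaertnerAt, mul_pow, inv_pow]
    field_simp
  · intro s hs y
    have hP := (hJ.pow (K + 2)).posFun_evol hΦ hs.1.le
    have e : (fun x => ((B s)⁻¹ * gaertnerAt (t₀ + s) y x) ^ (K + 2))
        = ((B s ^ (K + 2))⁻¹) • fun x => gaertnerAt (t₀ + s) y x ^ (K + 2) := by
      funext x
      simp [mul_pow]
    rw [e, hP.smul _ _ ((dom_gaertnerAt hN (t₀ + s) y).pow _)]
    have := pow_pos (hB s hs) (K + 2)
    rw [inv_mul_le_iff₀ this, mul_one]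
    exact hZ s hs y
  · intro s hs
    have h3 := h2 s hs
    rw [hgp s hs, ← mul_assoc] at h3
    have h4 := h3.trans (mul_le_mul_of_nonneg_right hρ2 (hg0 s hs))
    rw [← Finset.mul_sum, mul_pow 8 ε, hε2]
    calc _ = 128 * A * (1 / N * ∑ y, q s y ^ 2 * B s ^ 2) := by ring
      _ ≤ 128 * A * (ρ ^ 2 * g' s) := mul_le_mul_of_nonneg_left h4 (by positivity)
      _ ≤ (8 * (1 + 2 * A)) ^ 2 * (ρ ^ 2 * g' s) := by
        have := hg0 s hs
        refine mul_le_mul_of_nonneg_right ?_ (by positivity)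
        nlinarith [sq_nonneg A]
      _ = _ := by ring
  · intro s hs
    have hBs := hB s hs
    have hg0s := hg0 s hs
    have h3 := h2 s hs
    rw [hgp s hs, ← mul_assoc] at h3
    have hM0 : 0 ≤ M := (abs_nonneg _).trans (hM s hs 0)
    -- Two of the `K + 2` factors reproduce the quadratic sum; the other `K` are bounded by the
    -- largest possible jump `ε * M * Bmax`.
    have h4 : ε ^ (K + 2) * ∑ y, q s y ^ (K + 2) * B s ^ (K + 2) ≤ ρ ^ (K + 2) * g' s := by
      calc ε ^ (K + 2) * ∑ y, q s y ^ (K + 2) * B s ^ (K + 2)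
          = ∑ y, (ε * |q s y| * B s) ^ K * (1 / N * (q s y ^ 2 * B s ^ 2)) := by
            rw [Finset.mul_sum]
            refine Finset.sum_congr rfl fun y _ => ?_
            rw [← hε2, mul_pow, mul_pow, hK.pow_abs]
            ring
        _ ≤ ∑ y, (ε * M * Bmax) ^ K * (1 / N * (q s y ^ 2 * B s ^ 2)) := by
            refine Finset.sum_le_sum fun y _ => mul_le_mul_of_nonneg_right ?_ (by positivity)
            have := hM s hs y
            have := hBm s hs
            gcongr
        _ = (ε * M * Bmax) ^ K * (1 / N * ∑ y, q s y ^ 2 * B s ^ 2) := by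
            rw [Finset.mul_sum, Finset.mul_sum]
        _ ≤ (ε * M * Bmax) ^ K * (c₂ * (t ^ p / p) * g' s) := by
            have := hBm s hs
            have : 0 ≤ Bmax := hBs.le.trans this
            gcongr
        _ ≤ _ := by
            rw [← mul_assoc]
            exact mul_le_mul_of_nonneg_right hρk hg0s
    rw [← Finset.mul_sum, mul_pow 8 ε]
    have h5 : 2 * A ≤ (1 + 2 * A) ^ (K + 2) := by
      have := one_add_mul_le_pow (a := 2 * A) (by linarith) (K + 2)
      push_cast at this
      nlinarith [mul_nonneg (Nat.cast_nonneg (α := ℝ) K) hA]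
    calc _ = 2 * A * 8 ^ (K + 2) * (ε ^ (K + 2) * ∑ y, q s y ^ (K + 2) * B s ^ (K + 2)) := by ring
      _ ≤ (1 + 2 * A) ^ (K + 2) * 8 ^ (K + 2) * (ρ ^ (K + 2) * g' s) :=
        mul_le_mul (mul_le_mul_of_nonneg_right h5 (by positivity)) h4
          (mul_nonneg (by positivity) (Finset.sum_nonneg fun y _ =>
            mul_nonneg (hKe.pow_nonneg _) (hKe.pow_nonneg _))) (by positivity)
      _ = _ := by rw [mul_pow, mul_pow]; ring

end Convolution


theorem gaertnerAt_pos {N : ℕ} (hN : 2 ≤ N) (t : ℝ) (y : ZMod N) (s : State N) :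
    0 < gaertnerAt t y s :=
  mul_pos (expHeight_pos hN y s) (Real.exp_pos _)

/-! ### Bounds on the kernel in a good environment. -/

section GoodEnvironments

variable {N : ℕ} [NeZero N] {α w v Λ T : ℝ} {a : ZMod N → ℝ}

/-- At time zero, admissible because `T ≥ 0`, the kernel is the identity, and the sup bound on its
diagonal reads `1 ≤ Λ`. -/
theorem GoodEnv.one_le (h : GoodEnv α w v Λ T a) (hT : 0 ≤ T) : 1 ≤ Λ := by
  have := h.sup_le 0 le_rfl (by positivity) 0 0
  simpa [kernelQ_zero] using this

theorem GoodEnv.kernelQ_le (h : GoodEnv α w v Λ T a) (hT : 0 ≤ T) {r : ℝ} (hr : 0 ≤ r)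
    (hrT : r ≤ (N : ℝ) ^ 2 * T) (x y : ZMod N) : kernelQ a r x y ≤ Λ := by
  refine (h.sup_le r hr hrT x y).trans ?_
  have : 1 ≤ √(r + 1) := Real.one_le_sqrt.2 (by linarith)
  exact div_le_self (by linarith [h.one_le hT]) this

theorem GoodEnv.abs_kernelQ_le (h : GoodEnv α w v Λ T a) (ha : ∀ x, 0 ≤ a x) (hT : 0 ≤ T) {r : ℝ}
    (hr : 0 ≤ r) (hrT : r ≤ (N : ℝ) ^ 2 * T) (x y : ZMod N) : |kernelQ a r x y| ≤ Λ := by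
  rw [abs_of_nonneg (kernelQ_nonneg ha hr x y)]
  exact h.kernelQ_le hT hr hrT x y

theorem GoodEnv.sum_kernelQ_sq_le (h : GoodEnv α w v Λ T a) (ha : ∀ x, 0 ≤ a x) (hT : 0 ≤ T)
    {r : ℝ} (hr : 0 ≤ r) (hrT : r ≤ (N : ℝ) ^ 2 * T) (x : ZMod N) :
    ∑ y, kernelQ a r x y ^ 2 ≤ Λ ^ 2 / √(r + 1) := by
  have hΛ : 0 ≤ Λ := by linarith [h.one_le hT]
  calc ∑ y, kernelQ a r x y ^ 2 ≤ ∑ y, Λ / √(r + 1) * kernelQ a r x y := by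
        refine Finset.sum_le_sum fun y _ => ?_
        rw [sq]
        exact mul_le_mul_of_nonneg_right (h.sup_le r hr hrT x y) (kernelQ_nonneg ha hr x y)
    _ = Λ / √(r + 1) * ∑ y, kernelQ a r x y := by rw [Finset.mul_sum]
    _ ≤ Λ / √(r + 1) * Λ := mul_le_mul_of_nonneg_left (h.sum_le r hr hrT x) (by positivity)
    _ = _ := by ring

theorem kernelComb_single (a : ZMod N → ℝ) (x : ZMod N) (r : ℝ) (y : ZMod N) :
    kernelComb a (Pi.single x 1) r y = kernelQ a r x y := by
  simp [kernelComb, Pi.single_apply]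

theorem inv_sqrt_add_one_le {r : ℝ} (hr : 0 < r) : 1 / √(r + 1) ≤ r ^ (-(1 / 2) : ℝ) := by
  rw [Real.rpow_neg hr.le, ← Real.sqrt_eq_rpow, ← one_div]
  exact one_div_le_one_div_of_le (Real.sqrt_pos.2 hr) (Real.sqrt_le_sqrt (by linarith))

/-- From `e^{-x} ≤ x^{-1/4}`. A quarter power of `r` is traded for a prefactor that is small when
the damping `μ` is strong, and `r^{-3/4}` is still integrable. -/
theorem exp_neg_mul_div_sqrt_le {r μ : ℝ} (hr : 0 < r) (hμ : 0 < μ) :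
    Real.exp (-(μ * r)) * (1 / √(r + 1)) ≤ μ ^ (-(1 / 4) : ℝ) * r ^ ((1 / 4 : ℝ) - 1) := by
  have h1 : Real.exp (-(μ * r)) ≤ (μ * r) ^ (-(1 / 4) : ℝ) := by
    have hx : 0 < μ * r := mul_pos hμ hr
    rw [Real.exp_neg, Real.rpow_neg hx.le]
    refine inv_anti₀ (Real.rpow_pos_of_pos hx _) ?_
    rcases le_total (μ * r) 1 with h | h
    · exact (Real.rpow_le_one hx.le h (by norm_num)).trans (Real.one_le_exp hx.le)
    · calc (μ * r) ^ (1 / 4 : ℝ) ≤ (μ * r) ^ (1 : ℝ) :=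
            Real.rpow_le_rpow_of_exponent_le h (by norm_num)
        _ = μ * r := Real.rpow_one _
        _ ≤ _ := by linarith [Real.add_one_le_exp (μ * r)]
  calc _ ≤ (μ * r) ^ (-(1 / 4) : ℝ) * r ^ (-(1 / 2) : ℝ) :=
        mul_le_mul h1 (inv_sqrt_add_one_le hr) (by positivity) (by positivity)
    _ = μ ^ (-(1 / 4) : ℝ) * (r ^ (-(1 / 4) : ℝ) * r ^ (-(1 / 2) : ℝ)) := by
        rw [Real.mul_rpow hμ.le hr.le, mul_assoc]
    _ = _ := by
        rw [← Real.rpow_add hr]; norm_num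

theorem evol_gaertnerAt_pow (hN : 2 ≤ N) {A : ℝ} (ha : ∀ x, 0 ≤ a x) (haA : ∀ x, a x ≤ A) {k : ℕ}
    {Φ : (State N → ℝ) → ℝ} (hΦ : PosFun (validStates N) (fun s => heightWeight s ^ k) Φ) {s : ℝ}
    (hs : 0 ≤ s) (t : ℝ) (y : ZMod N) :
    evol (jumpGen (rate a) jump) Φ s (fun x => gaertnerAt t y x ^ k)
      = Real.exp (nu N * t) ^ k * evol (jumpGen (rate a) jump) Φ s fun x => expHeight y x ^ k := by
  have hP := ((jumpBounds hN ha haA).pow k).posFun_evol hΦ hs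
  rw [← hP.smul _ _ ((dom_expHeight hN y).pow k)]
  congr 1
  funext x
  simp [gaertnerAt, mul_pow, mul_comm]

theorem exists_nat_root {F : ℝ} (hF : 0 < F) (k : ℕ) (hk : k ≠ 0) : ∃ f > 0, f ^ k = F := by
  refine ⟨F ^ (1 / (k : ℝ)), Real.rpow_pos_of_pos hF _, ?_⟩
  rw [← Real.rpow_natCast, ← Real.rpow_mul hF.le, one_div, inv_mul_cancel₀ (by positivity),
    Real.rpow_one]

omit [NeZero N] in
theorem convolutionConst_ge {A : ℝ} (hA : 0 ≤ A) (K : ℕ) : 1 ≤ convolutionConst A K := by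
  unfold convolutionConst
  have : (0 : ℝ) ≤ 3 * (((K : ℝ) + 2) ^ 2 * 2 ^ K) := by positivity
  nlinarith

end GoodEnvironments

/-- The uniform moment bound for the Gärtner transform in a good environment. -/
theorem exists_moment_bound {A : ℝ} (hA : 0 ≤ A) (K₀ Λ T : ℝ) {K : ℕ} (hK : Even K) :
    ∃ c : ℝ, 0 < c ∧ ∀ (N : ℕ) [NeZero N], 2 ≤ N → ∀ a : ZMod N → ℝ, (∀ x, 0 ≤ a x) →
      (∀ x, a x ≤ A) → ∀ α w v : ℝ, GoodEnv α w v Λ T a → ∀ s₀ ∈ validStates N,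
      (∀ y, gaertnerAt 0 y s₀ ≤ K₀) → ∀ s, 0 ≤ s → s ≤ (N : ℝ) ^ 2 * T → ∀ x,
        evol (jumpGen (rate a) jump) (fun f => f s₀) s (fun z => gaertnerAt s x z ^ (K + 2))
          ≤ c ^ (K + 2) := by
  set C := convolutionConst A K
  have hC : 1 ≤ C := convolutionConst_ge hA K
  -- With this choice `2 C ε = 1/2`: the noise, including the factor `2 ^ (K + 2)` from splitting
  -- the power, takes at most half of the maximum.
  set ε : ℝ := 1 / (4 * C)
  have hε : 0 < ε := by positivity
  have hε1 : ε ≤ 1 := by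
    rw [div_le_one (by positivity)]; linarith
  set Λ' : ℝ := |Λ| + 1
  have hΛ' : 1 ≤ Λ' := by simp [Λ']
  -- `δ` gives `4 δ Λ^{K+2} ≤ ε^{K+2}`, as both conditions on `ρ = ε f` require. The damping `l`
  -- below is then so large that `T / (2 l) ≤ δ⁴`; the fourth power undoes the exponent `1/4`.
  set δ : ℝ := ε ^ (K + 2) / (4 * Λ' ^ (K + 2))
  have hδ : 0 < δ := by positivity
  set l : ℝ := (|T| + 1) / (2 * δ ^ 4)
  have hl : 0 < l := by positivity
  have hTl : T / (2 * l) ≤ δ ^ 4 := by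
    rw [div_le_iff₀ (by positivity)]
    have : δ ^ 4 * (2 * l) = |T| + 1 := by simp only [l]; field_simp
    rw [this]
    linarith [le_abs_self T]
  -- The exponential undoes the damping over the whole horizon; the `4` collects a `2` from
  -- absorbing the noise and a `2` from splitting the power.
  refine ⟨Real.exp (l * |T|) * (4 * (|Λ * K₀| + 1)), by positivity, ?_⟩
  intro N _ hN a ha haA α w v hG s₀ hs₀ hK₀ s hs hsT x
  have hN0 : (0 : ℝ) < N := by positivity
  have hT : 0 ≤ T := by
    by_contra hT
    have : (N : ℝ) ^ 2 * T < 0 := mul_neg_of_pos_of_neg (by positivity) (not_le.1 hT)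
    linarith
  rw [abs_of_nonneg hT]
  have hΛ := hG.one_le hT
  have hΛ0 : 0 ≤ Λ := by linarith
  have hK₀0 : 0 ≤ K₀ := (gaertnerAt_pos hN 0 0 s₀).le.trans (hK₀ 0)
  rw [abs_of_nonneg (mul_nonneg hΛ0 hK₀0)]
  have hJ := jumpBounds hN ha haA
  have hKe : Even (K + 2) := hK.add even_two
  have hΦ : PosFun (validStates N) (fun s => heightWeight s ^ (K + 2)) fun f => f s₀ :=
    posFun_eval hs₀
  set L := jumpGen (rate a) jump
  set Φ : (State N → ℝ) → ℝ := fun f => f s₀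
  set F : ZMod N → ℝ → ℝ := fun y s => evol L Φ s (fun z => gaertnerAt s y z ^ (K + 2))
  set n2 : ℝ := (N : ℝ) ^ 2
  have hn2 : 0 < n2 := by positivity
  set E : ℝ → ℝ := fun s => Real.exp (-(l * s / n2)) ^ (K + 2)
  have hE : ∀ s, 0 < E s := fun s => pow_pos (Real.exp_pos _) _
  have hFc : ∀ y, ContinuousOn (fun s => F y s * E s) (Set.Icc 0 (n2 * T)) := by
    intro y
    have h1 : ContinuousOn (fun s => Real.exp (nu N * s) ^ (K + 2)
        * evol L Φ s (fun x => expHeight y x ^ (K + 2))) (Set.Icc 0 (n2 * T)) := by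
      refine ContinuousOn.mul (by fun_prop) fun r _ => ?_
      exact ((hJ.pow (K + 2)).hasDerivAt_evol hΦ
        ((dom_expHeight hN y).pow (K + 2)) r).continuousAt.continuousWithinAt
    refine ContinuousOn.mul (h1.congr fun r hr => ?_) ?_
    · exact evol_gaertnerAt_pow hN ha haA hΦ hr.1 r y
    · simp only [E]; fun_prop
  have hne : (Set.Icc 0 (n2 * T)).Nonempty := Set.nonempty_Icc.2 (by positivity)
  -- A maximum of the damped moments over space and time. Comparing every moment with this one
  -- replaces a Gronwall argument for a singular kernel.
  obtain ⟨x₁, t, ht, hle⟩ : ∃ x₁, ∃ t ∈ Set.Icc 0 (n2 * T), ∀ y, ∀ s ∈ Set.Icc 0 (n2 * T),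
      F y s * E s ≤ F x₁ t * E t := by
    choose sm hsm hmax using fun y => isCompact_Icc.exists_isMaxOn hne (hFc y)
    obtain ⟨x₁, hx₁⟩ := Finite.exists_max fun y => F y (sm y) * E (sm y)
    exact ⟨x₁, sm x₁, hsm x₁, fun y s hs => (hmax y hs).trans (hx₁ y)⟩
  suffices hFt : F x₁ t ≤ 2 * (2 ^ (K + 2) * (Λ * K₀) ^ (K + 2)) by
    have h1 := hle x s ⟨hs, hsT⟩
    have h2 : E t ≤ 1 := by
      refine pow_le_one₀ (Real.exp_nonneg _) (Real.exp_le_one_iff.2 ?_)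
      have := ht.1
      have : 0 ≤ l * t / n2 := by positivity
      linarith
    have h3 : 1 ≤ Real.exp (l * T) ^ (K + 2) * E s := by
      simp only [E]
      rw [← mul_pow, ← Real.exp_add]
      refine one_le_pow₀ (Real.one_le_exp ?_)
      have : l * s / n2 ≤ l * T := by
        rw [div_le_iff₀ hn2]
        nlinarith
      linarith
    have hF0 : 0 ≤ F x s := ((hJ.pow (K + 2)).posFun_evol hΦ hs).nonneg _
      ((dom_gaertnerAt hN s x).pow _) fun z _ => hKe.pow_nonneg _
    have hF1 : 0 ≤ F x₁ t := ((hJ.pow (K + 2)).posFun_evol hΦ ht.1).nonneg _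
      ((dom_gaertnerAt hN t x₁).pow _) fun z _ => hKe.pow_nonneg _
    calc F x s = F x s * 1 := (mul_one _).symm
      _ ≤ F x s * (Real.exp (l * T) ^ (K + 2) * E s) := mul_le_mul_of_nonneg_left h3 hF0
      _ = Real.exp (l * T) ^ (K + 2) * (F x s * E s) := by ring
      _ ≤ Real.exp (l * T) ^ (K + 2) * (F x₁ t * 1) := by
        refine mul_le_mul_of_nonneg_left (h1.trans ?_) (by positivity)
        exact mul_le_mul_of_nonneg_left h2 hF1
      _ ≤ Real.exp (l * T) ^ (K + 2) * (2 * (2 ^ (K + 2) * (Λ * K₀) ^ (K + 2))) := by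
        rw [mul_one]; gcongr
      _ ≤ Real.exp (l * T) ^ (K + 2) * (2 ^ (K + 2) * (2 ^ (K + 2) * (Λ * K₀ + 1) ^ (K + 2))) := by
        have h4 : (2 : ℝ) ≤ 2 ^ (K + 2) := by
          calc (2 : ℝ) = 2 ^ 1 := by norm_num
            _ ≤ 2 ^ (K + 2) := pow_le_pow_right₀ (by norm_num) (by omega)
        have h5 : (Λ * K₀) ^ (K + 2) ≤ (Λ * K₀ + 1) ^ (K + 2) := by
          gcongr; linarith
        gcongr
      _ = _ := by
        rw [← mul_pow, ← mul_pow, ← mul_pow]; congr 1; ring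
  have hΛK : K₀ ≤ Λ * K₀ := by nlinarith
  rcases eq_or_lt_of_le ht.1 with ht0 | ht0
  · have : F x₁ t = gaertnerAt 0 x₁ s₀ ^ (K + 2) := by
      simp only [F, ← ht0, evol_zero, Φ]
    rw [this]
    have h1 : gaertnerAt 0 x₁ s₀ ^ (K + 2) ≤ (Λ * K₀) ^ (K + 2) :=
      pow_le_pow_left₀ (gaertnerAt_pos hN 0 x₁ s₀).le ((hK₀ x₁).trans hΛK) _
    have h2 : (1 : ℝ) ≤ 2 ^ (K + 2) := one_le_pow₀ (by norm_num)
    have h3 : 0 ≤ (Λ * K₀) ^ (K + 2) := by positivity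
    nlinarith
  · have hFpos : 0 < F x₁ t := by
      have h0 := hle x₁ 0 ⟨le_rfl, by positivity⟩
      have h1 : 0 < F x₁ 0 := by
        simp only [F, evol_zero, Φ]
        exact pow_pos (gaertnerAt_pos hN 0 x₁ s₀) _
      exact pos_of_mul_pos_left (lt_of_lt_of_le (mul_pos h1 (hE 0)) h0) (hE t).le
    obtain ⟨f, hf, hfk⟩ := exists_nat_root hFpos (K + 2) (by omega)
    have htT : ∀ s ∈ Set.Ioo 0 t, 0 < t - s ∧ t - s ≤ n2 * T := fun s hs =>
      ⟨sub_pos.2 hs.2, (sub_le_self _ hs.1.le).trans ht.2⟩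
    -- The quadratic variation contains the square of the damping factor, hence the `2`.
    set μ : ℝ := 2 * l / n2
    have hμ : 0 < μ := by positivity
    set c₂ : ℝ := Λ ^ 2 * f ^ 2 / N * μ ^ (-(1 / 4) : ℝ)
    have hc₂ : c₂ * (t ^ (1 / 4 : ℝ) / (1 / 4)) ≤ 4 * Λ ^ 2 * δ * f ^ 2 := by
      have h1 : μ ^ (-(1 / 4) : ℝ) * t ^ (1 / 4 : ℝ) ≤ N * δ := by
        rw [Real.rpow_neg hμ.le, inv_mul_eq_div, ← Real.div_rpow ht.1 hμ.le]
        have h2 : t / μ ≤ (N * δ) ^ (4 : ℝ) := by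
          rw [show ((4 : ℝ)) = ((4 : ℕ) : ℝ) by norm_num, Real.rpow_natCast, mul_pow]
          calc t / μ ≤ n2 * T / μ := by gcongr; exact ht.2
            _ = (N : ℝ) ^ 4 * (T / (2 * l)) := by simp only [μ, n2]; field_simp
            _ ≤ _ := by gcongr
        calc (t / μ) ^ (1 / 4 : ℝ) ≤ ((N * δ) ^ (4 : ℝ)) ^ (1 / 4 : ℝ) :=
              Real.rpow_le_rpow (by positivity) h2 (by norm_num)
          _ = N * δ := by
              rw [← Real.rpow_mul (by positivity)]; norm_num
      calc c₂ * (t ^ (1 / 4 : ℝ) / (1 / 4))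
          = 4 * Λ ^ 2 * f ^ 2 / N * (μ ^ (-(1 / 4) : ℝ) * t ^ (1 / 4 : ℝ)) := by
            simp only [c₂]; ring
        _ ≤ 4 * Λ ^ 2 * f ^ 2 / N * (N * δ) := by gcongr
        _ = _ := by field_simp
    have hδ2 : Λ ^ (K + 2) * (4 * δ) ≤ ε ^ (K + 2) := by
      have h1 : Λ ^ (K + 2) ≤ Λ' ^ (K + 2) := by
        gcongr
        simp only [Λ']
        linarith [le_abs_self Λ]
      calc Λ ^ (K + 2) * (4 * δ) ≤ Λ' ^ (K + 2) * (4 * δ) := by gcongr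
        _ = ε ^ (K + 2) := by simp only [δ]; field_simp
    have hkey := convolution_moment_le hN ha haA hK hΦ (Pi.single x₁ 1) 0 ht0
      (ρ := ε * f) (by positivity) (B := fun s => f * Real.exp (-(l * (t - s) / n2)))
      (fun s _ => by positivity) ?_ (M := Λ) (Bmax := f) (c₂ := c₂) (p := 1 / 4) (by norm_num)
      ?_ ?_ ?_ ?_ ?_
    · have e1 : ∀ p : State N, ∑ y, (Pi.single x₁ 1 : ZMod N → ℝ) y * gaertnerAt (0 + t) y p
          = gaertnerAt t x₁ p := fun p => by
        simp [Pi.single_apply]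
      simp only [e1, kernelComb_single] at hkey
      have h1 := hJ.evol_pow_le hKe hΦ (dom_gaertnerAt hN t x₁)
        (dom_sum_gaertnerAt hN 0 fun y => kernelQ a t x₁ y) ht.1
      have h2 : F x₁ t ≤ 2 ^ (K + 2) * ((C * (ε * f)) ^ (K + 2) + (Λ * K₀) ^ (K + 2)) := by
        refine h1.trans (mul_le_mul_of_nonneg_left (add_le_add hkey ?_) (by positivity))
        refine pow_le_pow_left₀ (Finset.sum_nonneg fun y _ => mul_nonneg
          (kernelQ_nonneg ha ht.1 x₁ y) (gaertnerAt_pos hN 0 y s₀).le) ?_ _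
        calc ∑ y, kernelQ a t x₁ y * gaertnerAt 0 y s₀ ≤ ∑ y, kernelQ a t x₁ y * K₀ :=
              Finset.sum_le_sum fun y _ =>
                mul_le_mul_of_nonneg_left (hK₀ y) (kernelQ_nonneg ha ht.1 x₁ y)
          _ ≤ Λ * K₀ := by
              rw [← Finset.sum_mul]
              exact mul_le_mul_of_nonneg_right (hG.sum_le t ht.1 ht.2 x₁) hK₀0
      have h3 : 2 ^ (K + 2) * (C * (ε * f)) ^ (K + 2) ≤ F x₁ t / 2 := by
        rw [← hfk, ← mul_pow, show 2 * (C * (ε * f)) = 1 / 2 * f by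
          simp only [ε]; field_simp; norm_num, mul_pow]
        have : (1 / 2 : ℝ) ^ (K + 2) ≤ 1 / 2 := by
          calc (1 / 2 : ℝ) ^ (K + 2) ≤ (1 / 2) ^ 1 :=
                pow_le_pow_of_le_one (by norm_num) (by norm_num) (by omega)
            _ = 1 / 2 := by norm_num
        have hfp : 0 < f ^ (K + 2) := by positivity
        nlinarith
      rw [mul_add] at h2
      linarith
    -- Maximality at `(x₁, t)` is the a priori bound: earlier moments are at most those at the
    -- maximum times the damping accumulated between the two times.
    · intro s hs y
      rw [zero_add, mul_pow, hfk]
      have h1 := hle y s ⟨hs.1.le, hs.2.le.trans ht.2⟩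
      have h2 : E t = Real.exp (-(l * (t - s) / n2)) ^ (K + 2) * E s := by
        simp only [E]
        rw [← mul_pow, ← Real.exp_add]
        congr 2
        ring
      rw [h2, ← mul_assoc] at h1
      exact le_of_mul_le_mul_right h1 (hE s)
    · intro s hs y
      rw [kernelComb_single]
      exact hG.abs_kernelQ_le ha hT (htT s hs).1.le (htT s hs).2 x₁ y
    · intro s hs
      refine mul_le_of_le_one_right hf.le (Real.exp_le_one_iff.2 ?_)
      have := (htT s hs).1
      have : 0 ≤ l * (t - s) / n2 := by positivity
      linarith
    · intro s hs
      obtain ⟨hr, hrT⟩ := htT s hs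
      simp only [kernelComb_single]
      rw [← Finset.sum_mul]
      have h1 := hG.sum_kernelQ_sq_le ha hT hr.le hrT x₁
      have h2 := exp_neg_mul_div_sqrt_le hr hμ
      have h3 : Real.exp (-(l * (t - s) / n2)) ^ 2 = Real.exp (-(μ * (t - s))) := by
        rw [← Real.exp_nat_mul]
        congr 1
        simp only [μ]
        push_cast
        ring
      rw [mul_pow, h3]
      calc 1 / N * ((∑ y, kernelQ a (t - s) x₁ y ^ 2) * (f ^ 2 * Real.exp (-(μ * (t - s)))))
          ≤ 1 / N * ((Λ ^ 2 / √(t - s + 1)) * (f ^ 2 * Real.exp (-(μ * (t - s))))) := by gcongr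
        _ = Λ ^ 2 * f ^ 2 / N * (Real.exp (-(μ * (t - s))) * (1 / √(t - s + 1))) := by ring
        _ ≤ Λ ^ 2 * f ^ 2 / N * (μ ^ (-(1 / 4) : ℝ) * (t - s) ^ ((1 / 4 : ℝ) - 1)) := by gcongr
        _ = _ := by simp only [c₂]; ring
    · refine hc₂.trans ?_
      rw [mul_pow]
      refine mul_le_mul_of_nonneg_right ?_ (by positivity)
      calc 4 * Λ ^ 2 * δ = Λ ^ 2 * (4 * δ) := by ring
        _ ≤ Λ ^ (K + 2) * (4 * δ) := by
            have := pow_le_pow_right₀ hΛ (show 2 ≤ K + 2 by omega)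
            gcongr
        _ ≤ ε ^ (K + 2) := hδ2
        _ ≤ ε ^ 2 := pow_le_pow_of_le_one hε.le hε1 (by omega)
    · have h1 : (N : ℝ) ^ (-(1 / 2) : ℝ) ≤ 1 := (rpow_neg_half_le hN).trans (by norm_num)
      have h0 := rpow_neg_half_pos hN
      calc ((N : ℝ) ^ (-(1 / 2) : ℝ) * Λ * f) ^ K * (c₂ * (t ^ (1 / 4 : ℝ) / (1 / 4)))
          ≤ (1 * Λ * f) ^ K * (4 * Λ ^ 2 * δ * f ^ 2) := by gcongr
        _ = Λ ^ (K + 2) * (4 * δ) * f ^ (K + 2) := by ring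
        _ ≤ ε ^ (K + 2) * f ^ (K + 2) := by gcongr
        _ = _ := by rw [mul_pow]


/-! ### Minkowski's inequality for positive functionals. -/

section Minkowski

variable {S J I : Type*} [Fintype J] [Fintype I] {c : J → S → ℝ} {τ : J → S → S} {V : Set S}
  {v : S → ℝ} {κ R : ℝ} {Φ : (S → ℝ) → ℝ}

theorem JumpBounds.evol_pair_pow_le (h : JumpBounds c τ V v κ R) {k : ℕ} (hk : Even k)
    (hΦ : PosFun V (fun s => v s ^ k) Φ) {f f₀ f₁ : S → ℝ} (hf : Dom v f) (hf₀ : Dom v f₀)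
    (hf₁ : Dom v f₁) {t : ℝ} (ht : 0 ≤ t) :
    evol (jumpGen (pairRate c) (pairJump τ)) (diagFun Φ) t (fun p => (f p.2 - f₁ p.1) ^ k)
      ≤ 2 ^ k * (evol (jumpGen (pairRate c) (pairJump τ)) (diagFun Φ) t
          (fun p => (f p.2 - f₀ p.1) ^ k) + Φ fun s => (f₀ s - f₁ s) ^ k) := by
  have hP := (h.pair.pow k).posFun_evol hΦ.diag ht
  have h1 : Dom (fun p : S × S => (v p.1 + v p.2) ^ k) fun p => (f p.2 - f₀ p.1) ^ k :=
    ((hf.snd h.weight_nonneg).sub (hf₀.fst h.weight_nonneg)).pow k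
  have h2 : Dom (fun p : S × S => (v p.1 + v p.2) ^ k) fun p => (f₀ p.1 - f₁ p.1) ^ k :=
    ((hf₀.sub hf₁).fst h.weight_nonneg).pow k
  have h3 : Dom (fun p : S × S => (v p.1 + v p.2) ^ k) fun p => (f p.2 - f₁ p.1) ^ k :=
    ((hf.snd h.weight_nonneg).sub (hf₁.fst h.weight_nonneg)).pow k
  rw [← evol_pair_fst (c := c) (τ := τ) t (fun s => (f₀ s - f₁ s) ^ k) hΦ.zero,
    ← hP.add _ _ h1 h2, ← hP.smul _ _ (h1.add h2)]
  refine hP.mono h3 ((h1.add h2).smul _) fun p _ => ?_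
  have := add_pow_le_of_even hk (f p.2 - f₀ p.1) (f₀ p.1 - f₁ p.1)
  rwa [sub_add_sub_cancel] at this

/-- Jensen's inequality for the even power, with probability weights proportional to `|w i| * b i`
and variables `|Y i| / b i`. If all these weights vanish, so does the sum. -/
theorem PosFun.sum_pow_le {k : ℕ} (hk : Even k) (hk0 : k ≠ 0)
    (hΦ : PosFun V (fun s => v s ^ k) Φ) {Y : I → S → ℝ} (hY : ∀ i, Dom v (Y i)) (w : I → ℝ)
    {b : I → ℝ} (hb : ∀ i, 0 < b i) (h : ∀ i, Φ (fun s => Y i s ^ k) ≤ b i ^ k) :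
    Φ (fun s => (∑ i, w i * Y i s) ^ k) ≤ (∑ i, |w i| * b i) ^ k := by
  set B : ℝ := ∑ i, |w i| * b i
  have hwb : ∀ i, 0 ≤ |w i| * b i := fun i => mul_nonneg (abs_nonneg _) (hb i).le
  rcases eq_or_lt_of_le (Finset.sum_nonneg fun i (_ : i ∈ Finset.univ) => hwb i) with h0 | hB
  · have hw : ∀ i, w i = 0 := fun i => by
      have := (Finset.sum_eq_zero_iff_of_nonneg fun i _ => hwb i).1 h0.symm i (Finset.mem_univ i)
      rcases mul_eq_zero.1 this with h | h
      · exact abs_eq_zero.1 h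
      · exact absurd h (hb i).ne'
    simp only [hw, zero_mul, Finset.sum_const_zero, zero_pow hk0]
    exact (le_of_eq hΦ.zero).trans (hk.pow_nonneg _)
  · have hd : ∀ i, Dom (fun s => v s ^ k) fun s => Y i s ^ k := fun i => (hY i).pow k
    have hpt : ∀ s, (∑ i, w i * Y i s) ^ k
        ≤ (∑ i, (B ^ k * (|w i| * b i / B) * (b i ^ k)⁻¹) • fun s => Y i s ^ k) s := by
      intro s
      rw [← hk.pow_abs]
      have h1 : |∑ i, w i * Y i s| ≤ B * ∑ i, |w i| * b i / B * (|Y i s| / b i) := by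
        refine (Finset.abs_sum_le_sum_abs _ _).trans_eq ?_
        rw [Finset.mul_sum]
        refine Finset.sum_congr rfl fun i _ => ?_
        have h1 := (hb i).ne'
        have h2 : B ≠ 0 := hB.ne'
        rw [abs_mul]
        field_simp
      have h2 := Real.pow_arith_mean_le_arith_mean_pow Finset.univ (fun i => |w i| * b i / B)
        (fun i => |Y i s| / b i) (fun i _ => div_nonneg (hwb i) hB.le)
        (by rw [← Finset.sum_div]; exact div_self hB.ne')
        (fun i _ => div_nonneg (abs_nonneg _) (hb i).le) k
      calc |∑ i, w i * Y i s| ^ k ≤ (B * ∑ i, |w i| * b i / B * (|Y i s| / b i)) ^ k :=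
            pow_le_pow_left₀ (abs_nonneg _) h1 k
        _ ≤ B ^ k * ∑ i, |w i| * b i / B * (|Y i s| / b i) ^ k := by
            rw [mul_pow]
            exact mul_le_mul_of_nonneg_left h2 (pow_nonneg hB.le k)
        _ = _ := by
            rw [Finset.mul_sum, Finset.sum_apply]
            refine Finset.sum_congr rfl fun i _ => ?_
            rw [div_pow, hk.pow_abs, Pi.smul_apply, smul_eq_mul]
            ring
    refine (hΦ.mono ((Dom.comb hY w).pow k) (Dom.sum _ fun i _ => (hd i).smul _)
      fun s _ => hpt s).trans ?_
    rw [hΦ.sum _ fun i _ => (hd i).smul _]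
    calc _ ≤ ∑ i, B ^ k * (|w i| * b i / B) * (b i ^ k)⁻¹ * b i ^ k := by
          refine Finset.sum_le_sum fun i _ => ?_
          rw [hΦ.smul _ _ (hd i)]
          have := hwb i
          have := hb i
          have := h i
          gcongr
      _ = ∑ i, B ^ k * (|w i| * b i / B) :=
          Finset.sum_congr rfl fun i _ => inv_mul_cancel_right₀ (pow_pos (hb i) k).ne' _
      _ = B ^ k := by
          rw [← Finset.mul_sum, ← Finset.sum_div]
          change B ^ k * (B / B) = _
          rw [div_self hB.ne', mul_one]

end Minkowski

/-! ### Noise with uniform moments, and regularity of the kernels. -/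

section Bounds

variable {N : ℕ} [NeZero N] {α u w v Λ T : ℝ} {a : ZMod N → ℝ}

/-- Here `D` is the target size of the noise. The condition `N^{-1/2} ≤ D` puts individual jumps
below that size, so the bound on the quadratic variation alone determines the result. -/
theorem convolution_moment_le_of_const (hN : 2 ≤ N) {A : ℝ} (ha : ∀ x, 0 ≤ a x)
    (haA : ∀ x, a x ≤ A) {K : ℕ} (hK : Even K) {Φ : (State N → ℝ) → ℝ}
    (hΦ : PosFun (validStates N) (fun s => heightWeight s ^ (K + 2)) Φ) (θ : ZMod N → ℝ)
    (t₀ : ℝ) {t b : ℝ} (ht : 0 < t) (hb : 0 < b)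
    (hZ : ∀ s ∈ Set.Ioo 0 t, ∀ y, evol (jumpGen (rate a) jump) Φ s
      (fun x => gaertnerAt (t₀ + s) y x ^ (K + 2)) ≤ b ^ (K + 2))
    {M c₂ p C D : ℝ} (hp : 0 < p) (hM0 : 0 ≤ M)
    (hM : ∀ s ∈ Set.Ioo 0 t, ∀ y, |kernelComb a θ (t - s) y| ≤ M)
    (h2 : ∀ s ∈ Set.Ioo 0 t, 1 / N * ∑ y, kernelComb a θ (t - s) y ^ 2
      ≤ c₂ * (t - s) ^ (p - 1))
    (hC : 0 ≤ C) (hD : c₂ * (t ^ p / p) ≤ C * D ^ 2) (hND : (N : ℝ) ^ (-(1 / 2) : ℝ) ≤ D) :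
    evol (jumpGen (pairRate (rate a)) (pairJump jump)) (diagFun Φ) t
        (fun p => (∑ y, θ y * gaertnerAt (t₀ + t) y p.2
          - ∑ y, kernelComb a θ t y * gaertnerAt t₀ y p.1) ^ (K + 2))
      ≤ (convolutionConst A K * ((1 + M * b + C * b ^ 2) * D)) ^ (K + 2) := by
  have hε := rpow_neg_half_pos hN
  have hD0 : 0 < D := hε.trans_le hND
  have hG1 : 1 ≤ 1 + M * b + C * b ^ 2 := by
    have : 0 ≤ M * b := by positivity
    have : 0 ≤ C * b ^ 2 := by positivity
    linarith
  have hG : C * b ^ 2 ≤ (1 + M * b + C * b ^ 2) ^ 2 := by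
    have : 0 ≤ M * b := by positivity
    have : 0 ≤ C * b ^ 2 := by positivity
    nlinarith
  have hGM : M * b ≤ 1 + M * b + C * b ^ 2 := by
    have : 0 ≤ C * b ^ 2 := by positivity
    linarith
  have h3 : c₂ * b ^ 2 * (t ^ p / p) ≤ (1 + M * b + C * b ^ 2) ^ 2 * D ^ 2 := by
    calc c₂ * b ^ 2 * (t ^ p / p) = c₂ * (t ^ p / p) * b ^ 2 := by ring
      _ ≤ C * D ^ 2 * b ^ 2 := by gcongr
      _ = C * b ^ 2 * D ^ 2 := by ring
      _ ≤ _ := by gcongr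
  refine convolution_moment_le hN ha haA hK hΦ θ t₀ ht (by positivity) (B := fun _ => b)
    (fun _ _ => hb) hZ (M := M) (Bmax := b) (c₂ := c₂ * b ^ 2) (p := p) hp hM (fun _ _ => le_rfl)
    ?_ ?_ ?_
  · intro s hs
    rw [← Finset.sum_mul]
    calc _ = (1 / N * ∑ y, kernelComb a θ (t - s) y ^ 2) * b ^ 2 := by ring
      _ ≤ c₂ * (t - s) ^ (p - 1) * b ^ 2 :=
          mul_le_mul_of_nonneg_right (h2 s hs) (by positivity)
      _ = _ := by ring
  · rwa [mul_pow]
  · calc _ ≤ ((N : ℝ) ^ (-(1 / 2) : ℝ) * M * b) ^ K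
          * ((1 + M * b + C * b ^ 2) ^ 2 * D ^ 2) := by gcongr
      _ ≤ (D * (1 + M * b + C * b ^ 2)) ^ K * ((1 + M * b + C * b ^ 2) ^ 2 * D ^ 2) := by
          rw [mul_assoc]
          gcongr
      _ = _ := by ring

/-- For `w = 1` one interpolates: with `s = √(r + 1)` and `d` the distance, the gradient bound gives
the factor `d / s`, the sup bound gives `1`, and the smaller of the two is at most `(d / s)^u`. -/
theorem GoodEnv.abs_kernelQ_sub_le (hG : GoodEnv α w v Λ T a) (ha : ∀ x, 0 ≤ a x) (hT : 0 ≤ T)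
    (hu : 0 < u) (hu1 : u < 1) (hw : w = u ∨ w = 1) {r : ℝ} (hr : 0 ≤ r)
    (hrT : r ≤ (N : ℝ) ^ 2 * T) (x x' y : ZMod N) :
    |kernelQ a r x y - kernelQ a r x' y|
      ≤ (torusDist x x' : ℝ) ^ u / (r + 1) ^ ((u + 1) / 2) * Λ := by
  have hΛ := hG.one_le hT
  rcases hw with rfl | rfl
  · exact hG.grad_sup_le r hr hrT x x' y
  · rcases eq_or_ne x x' with rfl | hxx
    · rw [sub_self, abs_zero]; positivity
    have hd : (1 : ℝ) ≤ torusDist x x' := by exact_mod_cast torusDist_pos hxx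
    set d : ℝ := (torusDist x x' : ℝ)
    set s : ℝ := √(r + 1)
    have hs : 0 < s := Real.sqrt_pos.2 (by linarith)
    have hs2 : r + 1 = s ^ (2 : ℝ) := by
      rw [Real.rpow_two, Real.sq_sqrt (by linarith)]
    have e : d ^ u / (r + 1) ^ ((u + 1) / 2) = (d / s) ^ u * (1 / s) := by
      rw [hs2, ← Real.rpow_mul hs.le, show 2 * ((u + 1) / 2) = u + 1 by ring, Real.rpow_add hs,
        Real.rpow_one, Real.div_rpow (by positivity) hs.le]
      field_simp
    rw [e]
    rcases le_total (d / s) 1 with h | h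
    · have h1 := hG.grad_sup_le r hr hrT x x' y
      have h2 : d ^ (1 : ℝ) / (r + 1) ^ (((1 : ℝ) + 1) / 2) = d / s * (1 / s) := by
        rw [hs2, ← Real.rpow_mul hs.le]
        norm_num
        field_simp
      rw [h2] at h1
      refine h1.trans ?_
      have h3 : d / s ≤ (d / s) ^ u := by
        conv_lhs => rw [← Real.rpow_one (d / s)]
        exact Real.rpow_le_rpow_of_exponent_ge (by positivity) h hu1.le
      gcongr
    · have h1 : 1 ≤ (d / s) ^ u := Real.one_le_rpow h hu.le
      have hq1 := hG.sup_le r hr hrT x y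
      have hq2 := hG.sup_le r hr hrT x' y
      have hq3 := kernelQ_nonneg ha hr x y
      have hq4 := kernelQ_nonneg ha hr x' y
      calc _ ≤ Λ / s := abs_sub_le_iff.2 ⟨by linarith, by linarith⟩
        _ = 1 * (1 / s) * Λ := by ring
        _ ≤ _ := by gcongr

/-- Supremum of the difference times its `ℓ¹` norm. The exponent is arranged as `p - 1` with `p = (1
- u) / 2`, the form that `convolution_moment_le` integrates in time. -/
theorem GoodEnv.sum_kernelQ_sub_sq_le (hG : GoodEnv α w v Λ T a) (ha : ∀ x, 0 ≤ a x)
    (hT : 0 ≤ T) (hu : 0 < u) (hu1 : u < 1) (hw : w = u ∨ w = 1) {r : ℝ} (hr : 0 < r)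
    (hrT : r ≤ (N : ℝ) ^ 2 * T) (x x' : ZMod N) :
    ∑ y, (kernelQ a r x y - kernelQ a r x' y) ^ 2
      ≤ 2 * Λ ^ 2 * (torusDist x x' : ℝ) ^ u * r ^ ((1 - u) / 2 - 1) := by
  have hΛ := hG.one_le hT
  set d : ℝ := (torusDist x x' : ℝ)
  have h1 : ∑ y, |kernelQ a r x y - kernelQ a r x' y| ≤ 2 * Λ := by
    calc _ ≤ ∑ y, (kernelQ a r x y + kernelQ a r x' y) := by
          refine Finset.sum_le_sum fun y _ => abs_sub_le_iff.2 ⟨?_, ?_⟩ <;>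
          linarith [kernelQ_nonneg ha hr.le x y, kernelQ_nonneg ha hr.le x' y]
      _ ≤ _ := by
          rw [Finset.sum_add_distrib]
          linarith [hG.sum_le r hr.le hrT x, hG.sum_le r hr.le hrT x']
  calc _ ≤ ∑ y, d ^ u / (r + 1) ^ ((u + 1) / 2) * Λ * |kernelQ a r x y - kernelQ a r x' y| := by
        refine Finset.sum_le_sum fun y _ => ?_
        rw [← sq_abs, sq]
        exact mul_le_mul_of_nonneg_right
          (hG.abs_kernelQ_sub_le ha hT hu hu1 hw hr.le hrT x x' y) (abs_nonneg _)
    _ ≤ d ^ u / (r + 1) ^ ((u + 1) / 2) * Λ * (2 * Λ) := by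
        rw [← Finset.mul_sum]; gcongr
    _ ≤ d ^ u / r ^ ((u + 1) / 2) * Λ * (2 * Λ) := by
        gcongr
        linarith
    _ = _ := by
        rw [show (1 - u) / 2 - 1 = -((u + 1) / 2) by ring, Real.rpow_neg hr.le]
        ring

/-- By translation invariance both averages use the same probability kernel, one applied to a
shifted profile; the shift moves every site by the same distance. -/
theorem abs_sum_heatKernel_sub_le {β K₀ : ℝ} {f : ZMod N → ℝ}
    (hf : ∀ x x', |f x - f x'| ≤ K₀ * ((torusDist x x' : ℝ) / N) ^ β) {t : ℝ} (ht : 0 ≤ t)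
    (x x' : ZMod N) :
    |∑ y, (heatKernel N t x y - heatKernel N t x' y) * f y|
      ≤ K₀ * ((torusDist x x' : ℝ) / N) ^ β := by
  have e : ∑ y, heatKernel N t x' y * f y = ∑ y, heatKernel N t x y * f (y + (x' - x)) := by
    rw [← Equiv.sum_comp (Equiv.addRight (x' - x)) fun y => heatKernel N t x' y * f y]
    refine Finset.sum_congr rfl fun y _ => ?_
    have := heatKernel_add t x y (x' - x)
    rw [add_sub_cancel] at this
    rw [Equiv.coe_addRight, this]
  simp only [sub_mul, Finset.sum_sub_distrib]
  rw [e, ← Finset.sum_sub_distrib]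
  calc _ ≤ ∑ y, heatKernel N t x y * (K₀ * ((torusDist x x' : ℝ) / N) ^ β) := by
        refine (Finset.abs_sum_le_sum_abs _ _).trans (Finset.sum_le_sum fun y _ => ?_)
        rw [← mul_sub, abs_mul, abs_of_nonneg (heatKernel_nonneg ht x y)]
        refine mul_le_mul_of_nonneg_left ?_ (heatKernel_nonneg ht x y)
        have := hf y (y + (x' - x))
        have h2 : torusDist y (y + (x' - x)) = torusDist x x' := by
          rw [torusDist_eq, torusDist_eq, add_sub_cancel_left]
        rwa [h2] at this
    _ = _ := by rw [← Finset.sum_mul, sum_heatKernel, one_mul]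

/-- At distances below the diffusive scale the gradient bound applies, and `N^{-v} ≤ (d/N)^v` as `d
≥ 1`. Beyond it `t ≤ d²`, so the bound on the mass of each difference kernel is already small
enough. -/
theorem GoodEnv.sum_kernelDiff_sub_le (hG : GoodEnv α w v Λ T a) (hT : 0 ≤ T) (hv : 0 < v)
    {γ : ℝ} (hw : 0 < w) (hγv : γ ≤ v) (hγw : γ ≤ w) {t : ℝ} (ht : 0 ≤ t)
    (htT : t ≤ (N : ℝ) ^ 2 * T) {x x' : ZMod N} (hxx : x ≠ x') :
    ∑ y, |kernelDiff a t x y - kernelDiff a t x' y|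
      ≤ 2 * Λ * ((torusDist x x' : ℝ) / N) ^ γ := by
  have hΛ := hG.one_le hT
  have hd : (1 : ℝ) ≤ torusDist x x' := by exact_mod_cast torusDist_pos hxx
  have hdN : (torusDist x x' : ℝ) ≤ N := by exact_mod_cast torusDist_le x x'
  set d : ℝ := (torusDist x x' : ℝ)
  have hN0 : (0 : ℝ) < N := by linarith
  have hq0 : 0 < d / N := by positivity
  have hq1 : d / N ≤ 1 := (div_le_one hN0).2 hdN
  have h1 : (d / N) ^ v ≤ (d / N) ^ γ := Real.rpow_le_rpow_of_exponent_ge hq0 hq1 hγv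
  have h2 : (d / N) ^ w ≤ (d / N) ^ γ := Real.rpow_le_rpow_of_exponent_ge hq0 hq1 hγw
  rcases le_total d (√(1 + t)) with h | h
  · refine (hG.diff_grad_sum_le t ht htT x x').trans ?_
    have h3 : d ^ w / (1 + t) ^ (w / 2) ≤ 1 := by
      rw [div_le_one (Real.rpow_pos_of_pos (by linarith) _)]
      calc d ^ w ≤ √(1 + t) ^ w := Real.rpow_le_rpow (by linarith) h hw.le
        _ = (1 + t) ^ (w / 2) := by
          rw [Real.sqrt_eq_rpow, ← Real.rpow_mul (by linarith)]
          congr 1; ring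
    have h4 : (N : ℝ) ^ (-v) ≤ (d / N) ^ v := by
      rw [Real.rpow_neg hN0.le, ← Real.inv_rpow hN0.le]
      refine Real.rpow_le_rpow (by positivity) ?_ hv.le
      rw [inv_eq_one_div]
      gcongr
    calc _ ≤ (1 * (d / N) ^ v + (d / N) ^ w) * Λ := by gcongr
      _ ≤ (1 * (d / N) ^ γ + (d / N) ^ γ) * Λ := by gcongr
      _ = _ := by ring
  · have h3 : (t / (N : ℝ) ^ 2) ^ (v / 2) ≤ (d / N) ^ v := by
      have h5 : t ≤ d ^ 2 := by
        have := (Real.sqrt_le_left (by linarith)).1 h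
        linarith
      calc (t / (N : ℝ) ^ 2) ^ (v / 2) ≤ ((d / N) ^ (2 : ℝ)) ^ (v / 2) := by
            refine Real.rpow_le_rpow (by positivity) ?_ (by positivity)
            rw [Real.rpow_two, div_pow]
            gcongr
        _ = (d / N) ^ v := by
            rw [← Real.rpow_mul hq0.le]; congr 1; ring
    calc _ ≤ ∑ y, (|kernelDiff a t x y| + |kernelDiff a t x' y|) :=
          Finset.sum_le_sum fun y _ => abs_sub _ _
      _ ≤ (t / (N : ℝ) ^ 2) ^ (v / 2) * Λ + (t / (N : ℝ) ^ 2) ^ (v / 2) * Λ := by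
          rw [Finset.sum_add_distrib]
          exact add_le_add (hG.diff_sum_le t ht htT x) (hG.diff_sum_le t ht htT x')
      _ ≤ (d / N) ^ γ * Λ + (d / N) ^ γ * Λ := by
          have := h3.trans h1
          gcongr
      _ = _ := by ring

end Bounds


/-! ### Increments in space. -/

section SpaceIncrements

variable {N : ℕ} [NeZero N] {α u w v Λ T : ℝ} {a : ZMod N → ℝ}

/-- The bound on the spatial increments of the solution started from a near stationary profile,
without the noise. -/
theorem GoodEnv.abs_sum_kernelQ_sub_mul_le (hG : GoodEnv α w v Λ T a) (hT : 0 ≤ T) (hv : 0 < v)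
    {γ β K₀ : ℝ} (hw : 0 < w) (hγv : γ ≤ v) (hγw : γ ≤ w) (hγβ : γ ≤ β) {f : ZMod N → ℝ}
    (hf0 : ∀ x, 0 ≤ f x) (hf : ∀ x, f x ≤ K₀)
    (hf' : ∀ x x', |f x - f x'| ≤ K₀ * ((torusDist x x' : ℝ) / N) ^ β) {t : ℝ} (ht : 0 ≤ t)
    (htT : t ≤ (N : ℝ) ^ 2 * T) {x x' : ZMod N} (hxx : x ≠ x') :
    |∑ y, (kernelQ a t x y - kernelQ a t x' y) * f y|
      ≤ (K₀ + 2 * Λ * K₀) * ((torusDist x x' : ℝ) / N) ^ γ := by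
  have hΛ := hG.one_le hT
  have hK₀ : 0 ≤ K₀ := (hf0 0).trans (hf 0)
  have hd : (1 : ℝ) ≤ torusDist x x' := by exact_mod_cast torusDist_pos hxx
  have hdN : (torusDist x x' : ℝ) ≤ N := by exact_mod_cast torusDist_le x x'
  have h1 := abs_sum_heatKernel_sub_le hf' ht x x'
  have h2 := hG.sum_kernelDiff_sub_le hT hv hw hγv hγw ht htT hxx
  set d : ℝ := (torusDist x x' : ℝ)
  have hN0 : (0 : ℝ) < N := by linarith
  have hq0 : 0 < d / N := by positivity
  have hq1 : d / N ≤ 1 := (div_le_one hN0).2 hdN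
  have h3 : (d / N) ^ β ≤ (d / N) ^ γ := Real.rpow_le_rpow_of_exponent_ge hq0 hq1 hγβ
  have e : ∑ y, (kernelQ a t x y - kernelQ a t x' y) * f y
      = ∑ y, (heatKernel N t x y - heatKernel N t x' y) * f y
        + ∑ y, (kernelDiff a t x y - kernelDiff a t x' y) * f y := by
    rw [← Finset.sum_add_distrib]
    refine Finset.sum_congr rfl fun y _ => ?_
    simp only [kernelDiff]
    ring
  have h4 : |∑ y, (kernelDiff a t x y - kernelDiff a t x' y) * f y|
      ≤ 2 * Λ * (d / N) ^ γ * K₀ := by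
    calc _ ≤ ∑ y, |kernelDiff a t x y - kernelDiff a t x' y| * K₀ := by
          refine (Finset.abs_sum_le_sum_abs _ _).trans (Finset.sum_le_sum fun y _ => ?_)
          rw [abs_mul, abs_of_nonneg (hf0 y)]
          exact mul_le_mul_of_nonneg_left (hf y) (abs_nonneg _)
      _ ≤ _ := by
          rw [← Finset.sum_mul]
          exact mul_le_mul_of_nonneg_right h2 hK₀
  rw [e]
  calc _ ≤ K₀ * (d / N) ^ γ + 2 * Λ * (d / N) ^ γ * K₀ :=
        (abs_add_le _ _).trans (add_le_add (h1.trans (mul_le_mul_of_nonneg_left h3 hK₀)) h4)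
    _ = _ := by ring

theorem kernelComb_single_sub (a : ZMod N → ℝ) (x x' : ZMod N) (r : ℝ) (y : ZMod N) :
    kernelComb a (Pi.single x 1 - Pi.single x' 1) r y = kernelQ a r x y - kernelQ a r x' y := by
  simp [kernelComb, Pi.single_apply, sub_mul, Finset.sum_sub_distrib]

end SpaceIncrements

/-- The moment bound for the spatial increments of the Gärtner transform in a good environment. -/
theorem exists_space_bound {A : ℝ} (hA : 0 ≤ A) (K₀ Λ T : ℝ) {K : ℕ} (hK : Even K) {u β v : ℝ}
    (hu : 0 < u) (hu1 : u < 1) (hv : 0 < v) :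
    ∃ c : ℝ, 0 < c ∧ ∀ (N : ℕ) [NeZero N], 2 ≤ N → ∀ a : ZMod N → ℝ, (∀ x, 0 ≤ a x) →
      (∀ x, a x ≤ A) → ∀ α w : ℝ, (w = u ∨ w = 1) → GoodEnv α w v Λ T a → ∀ s₀ ∈ validStates N,
      (∀ y, gaertnerAt 0 y s₀ ≤ K₀) →
      (∀ y y', |gaertnerAt 0 y s₀ - gaertnerAt 0 y' s₀|
        ≤ K₀ * ((torusDist y y' : ℝ) / N) ^ β) →
      ∀ t, 0 ≤ t → t ≤ (N : ℝ) ^ 2 * T → ∀ x x',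
        evol (jumpGen (rate a) jump) (fun f => f s₀) t
            (fun z => (gaertnerAt t x z - gaertnerAt t x' z) ^ (K + 2))
          ≤ (c * ((torusDist x x' : ℝ) / N) ^ min (u / 2) (min β v)) ^ (K + 2) := by
  obtain ⟨b, hb, hmom⟩ := exists_moment_bound hA K₀ Λ T hK
  set C := convolutionConst A K
  have hC : 1 ≤ C := convolutionConst_ge hA K
  -- Positive because `u < 1`; this is where the strict inequality makes the noise singularity
  -- integrable.
  set p : ℝ := (1 - u) / 2
  have hp : 0 < p := by simp only [p]; linarith
  set C' : ℝ := 2 * Λ ^ 2 * |T| ^ p / p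
  have hC' : 0 ≤ C' := by positivity
  refine ⟨2 * (C * (1 + 2 * |Λ| * b + C' * b ^ 2) + (|K₀| + 2 * |Λ| * |K₀|)), by positivity, ?_⟩
  intro N _ hN a ha haA α w hw hG s₀ hs₀ hK₀ hNS t ht htT x x'
  have hN0 : (0 : ℝ) < N := by positivity
  have hT : 0 ≤ T := by
    by_contra hT
    have : (N : ℝ) ^ 2 * T < 0 := mul_neg_of_pos_of_neg (by positivity) (not_le.1 hT)
    linarith
  have hΛ := hG.one_le hT
  have hΛ0 : 0 ≤ Λ := by linarith
  have hK₀0 : 0 ≤ K₀ := (gaertnerAt_pos hN 0 0 s₀).le.trans (hK₀ 0)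
  have hw0 : 0 < w := by rcases hw with rfl | rfl <;> linarith
  have huw : u ≤ w := by rcases hw with rfl | rfl <;> linarith
  rw [abs_of_nonneg hΛ0, abs_of_nonneg hK₀0]
  have hKe : Even (K + 2) := hK.add even_two
  have hΦ : PosFun (validStates N) (fun s => heightWeight s ^ (K + 2)) fun f => f s₀ :=
    posFun_eval hs₀
  have hP := ((jumpBounds hN ha haA).pow (K + 2)).posFun_evol hΦ ht
  set γ := min (u / 2) (min β v)
  have hγu : γ ≤ u / 2 := min_le_left _ _
  have hγβ : γ ≤ β := (min_le_right _ _).trans (min_le_left _ _)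
  have hγv : γ ≤ v := (min_le_right _ _).trans (min_le_right _ _)
  rcases eq_or_ne x x' with rfl | hxx
  · have : (fun z : State N => (gaertnerAt t x z - gaertnerAt t x z) ^ (K + 2)) = 0 := by
      funext z; simp
    rw [this, hP.zero]
    exact hKe.pow_nonneg _
  have hd : (1 : ℝ) ≤ torusDist x x' := by exact_mod_cast torusDist_pos hxx
  have hdN : (torusDist x x' : ℝ) ≤ N := by exact_mod_cast torusDist_le x x'
  have hsq : ∀ r, 0 < r → r ≤ (N : ℝ) ^ 2 * T → _ := fun r hr hrT =>
    hG.sum_kernelQ_sub_sq_le ha hT hu hu1 hw hr hrT x x'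
  have hdet := hG.abs_sum_kernelQ_sub_mul_le hT hv hw0 hγv (hγu.trans (by linarith)) hγβ
    (fun y => (gaertnerAt_pos hN 0 y s₀).le) hK₀ hNS ht htT hxx
  set d : ℝ := (torusDist x x' : ℝ)
  have hq0 : 0 < d / N := by positivity
  have hq1 : d / N ≤ 1 := (div_le_one hN0).2 hdN
  set G : ℝ := 1 + 2 * Λ * b + C' * b ^ 2
  have hG0 : 0 ≤ G := by positivity
  set q : ℝ := (d / N) ^ γ
  have hq : 0 < q := Real.rpow_pos_of_pos hq0 _
  -- The natural size of the noise in the spatial increment; it is lowered to the common exponent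
  -- `γ` at the end.
  set D : ℝ := (d / N) ^ (u / 2)
  have hDq : D ≤ q := Real.rpow_le_rpow_of_exponent_ge hq0 hq1 hγu
  suffices h : evol (jumpGen (rate a) jump) (fun f => f s₀) t
      (fun z => (gaertnerAt t x z - gaertnerAt t x' z) ^ (K + 2))
        ≤ 2 ^ (K + 2) * ((C * (G * D)) ^ (K + 2) + ((K₀ + 2 * Λ * K₀) * q) ^ (K + 2)) by
    have hD0 : 0 < D := Real.rpow_pos_of_pos hq0 _
    calc _ ≤ _ := h
      _ ≤ 2 ^ (K + 2) * ((C * (G * q)) ^ (K + 2) + ((K₀ + 2 * Λ * K₀) * q) ^ (K + 2)) := by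
          gcongr
      _ ≤ 2 ^ (K + 2) * (C * (G * q) + (K₀ + 2 * Λ * K₀) * q) ^ (K + 2) :=
          mul_le_mul_of_nonneg_left (pow_add_pow_le (by positivity) (by positivity) (by omega))
            (by positivity)
      _ = _ := by rw [← mul_pow]; congr 1; ring
  rcases eq_or_lt_of_le ht with rfl | ht0
  · simp only [evol_zero]
    have h1 : (gaertnerAt 0 x s₀ - gaertnerAt 0 x' s₀) ^ (K + 2)
        ≤ ((K₀ + 2 * Λ * K₀) * q) ^ (K + 2) := by
      rw [← hKe.pow_abs]
      refine pow_le_pow_left₀ (abs_nonneg _) ?_ _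
      simp only [kernelQ_zero, sub_mul, ite_mul, one_mul, zero_mul, Finset.sum_sub_distrib,
        Finset.sum_ite_eq, Finset.mem_univ, if_true] at hdet
      exact hdet
    have h2 : 0 ≤ (C * (G * D)) ^ (K + 2) := hKe.pow_nonneg _
    have h3 : (1 : ℝ) ≤ 2 ^ (K + 2) := one_le_pow₀ (by norm_num)
    have h4 : 0 ≤ ((K₀ + 2 * Λ * K₀) * q) ^ (K + 2) := hKe.pow_nonneg _
    nlinarith
  have htT' : ∀ s ∈ Set.Ioo 0 t, 0 < t - s ∧ t - s ≤ (N : ℝ) ^ 2 * T := fun s hs =>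
    ⟨sub_pos.2 hs.2, (sub_le_self _ hs.1.le).trans htT⟩
  have hkey := convolution_moment_le_of_const hN ha haA hK hΦ (Pi.single x 1 - Pi.single x' 1) 0
    ht0 hb (fun s hs y => by
      rw [zero_add]
      exact hmom N hN a ha haA α w v hG s₀ hs₀ hK₀ s hs.1.le (hs.2.le.trans htT) y)
    (M := 2 * Λ) (c₂ := 1 / N * (2 * Λ ^ 2 * d ^ u)) (p := p) (C := C') (D := D) hp (by positivity)
    (fun s hs y => by
      obtain ⟨hr, hrT⟩ := htT' s hs
      rw [kernelComb_single_sub]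
      refine (abs_sub _ _).trans ?_
      have h1 := hG.abs_kernelQ_le ha hT hr.le hrT x y
      have h2 := hG.abs_kernelQ_le ha hT hr.le hrT x' y
      linarith)
    (fun s hs => by
      obtain ⟨hr, hrT⟩ := htT' s hs
      simp only [kernelComb_single_sub]
      rw [mul_assoc]
      exact mul_le_mul_of_nonneg_left (hsq _ hr hrT) (by positivity))
    hC' (by
      -- The horizon `N² T` supplies `N^{1-u}`; together with the prefactor `1/N` it turns `d^u`
      -- into `(d/N)^u`.
      have h1 : t ^ p ≤ (N : ℝ) ^ (1 - u) * |T| ^ p := by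
        calc t ^ p ≤ ((N : ℝ) ^ 2 * T) ^ p := Real.rpow_le_rpow ht htT hp.le
          _ = _ := by
            rw [Real.mul_rpow (by positivity) hT, ← Real.rpow_natCast, ← Real.rpow_mul hN0.le,
              abs_of_nonneg hT]
            congr 2
            simp only [p]; push_cast; ring
      have h2 : D ^ 2 = d ^ u / (N : ℝ) ^ u := by
        rw [← Real.rpow_natCast, ← Real.rpow_mul hq0.le, ← Real.div_rpow (by positivity) hN0.le]
        congr 1
        push_cast; ring
      have h3 : (N : ℝ) ^ (1 - u) = N / (N : ℝ) ^ u := by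
        rw [Real.rpow_sub hN0, Real.rpow_one]
      calc 1 / N * (2 * Λ ^ 2 * d ^ u) * (t ^ p / p)
          ≤ 1 / N * (2 * Λ ^ 2 * d ^ u) * ((N : ℝ) ^ (1 - u) * |T| ^ p / p) := by gcongr
        _ = C' * D ^ 2 := by
            rw [h2, h3]
            simp only [C']
            field_simp)
    (by
      calc (N : ℝ) ^ (-(1 / 2) : ℝ) ≤ (N : ℝ) ^ (-(u / 2)) :=
            Real.rpow_le_rpow_of_exponent_le (by linarith) (by linarith)
        _ = (1 / N : ℝ) ^ (u / 2) := by
            rw [one_div, Real.inv_rpow hN0.le, Real.rpow_neg hN0.le]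
        _ ≤ D := by
            refine Real.rpow_le_rpow (by positivity) ?_ (by positivity)
            gcongr)
  have e1 : ∀ z : State N, ∑ y, (Pi.single x 1 - Pi.single x' 1 : ZMod N → ℝ) y
      * gaertnerAt (0 + t) y z = gaertnerAt t x z - gaertnerAt t x' z := fun z => by
    simp [Pi.single_apply, sub_mul, Finset.sum_sub_distrib]
  simp only [e1, kernelComb_single_sub] at hkey
  refine ((jumpBounds hN ha haA).evol_pow_le hKe hΦ
    ((dom_gaertnerAt hN t x).sub (dom_gaertnerAt hN t x'))
    (dom_sum_gaertnerAt hN 0 fun y => kernelQ a t x y - kernelQ a t x' y) ht).trans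
    (mul_le_mul_of_nonneg_left (add_le_add hkey ?_) (by positivity))
  exact (hKe.pow_abs _).ge.trans (pow_le_pow_left₀ (abs_nonneg _) hdet _)


/-! ### Increments in time. -/

theorem rpow_le_rpow_mul_of_le {H T a b : ℝ} (hH : 0 < H) (hHT : H ≤ T) (hT : 1 ≤ T)
    (hb : 0 ≤ b) (hba : b ≤ a) : H ^ a ≤ T ^ a * H ^ b := by
  calc H ^ a = H ^ (a - b) * H ^ b := by rw [← Real.rpow_add hH, sub_add_cancel]
    _ ≤ T ^ (a - b) * H ^ b := by gcongr
    _ ≤ T ^ a * H ^ b := by gcongr; linarith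

/-- With `z = q² / H` this is `z^{γ/2} ≤ 1 + z`. It converts a Hölder modulus into a second moment,
the only moment of the heat kernel available. -/
theorem rpow_le_rpow_half_mul {q H γ : ℝ} (hq : 0 ≤ q) (hH : 0 < H) (hγ : 0 ≤ γ) (hγ2 : γ ≤ 2) :
    q ^ γ ≤ H ^ (γ / 2) * (1 + q ^ 2 / H) := by
  have h1 : q ^ γ = H ^ (γ / 2) * (q ^ 2 / H) ^ (γ / 2) := by
    rw [← Real.mul_rpow hH.le (by positivity), mul_div_cancel₀ _ hH.ne', ← Real.rpow_natCast,
      ← Real.rpow_mul hq]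
    congr 1; push_cast; ring
  rw [h1]
  have h2 : (q ^ 2 / H) ^ (γ / 2) ≤ 1 + q ^ 2 / H := by
    have h0 : 0 ≤ q ^ 2 / H := by positivity
    rcases le_total (q ^ 2 / H) 1 with h | h
    · linarith [Real.rpow_le_one h0 h (by linarith : 0 ≤ γ / 2)]
    · have := Real.rpow_le_rpow_of_exponent_le h (by linarith : γ / 2 ≤ 1)
      rw [Real.rpow_one] at this
      linarith
  gcongr

/-- The moment bound for the increment, without the noise, of the solution over a time step. -/
theorem GoodEnv.kernelQ_step_moment_le {N : ℕ} [NeZero N] {α w v Λ T : ℝ} {a : ZMod N → ℝ}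
    (hG : GoodEnv α w v Λ T a) (hN : 2 ≤ N) (hv : 0 < v) {k : ℕ} (hk : Even k) (hk0 : k ≠ 0)
    {Φ : (State N → ℝ) → ℝ}
    (hΦ : PosFun (validStates N) (fun s => heightWeight s ^ k) Φ) {t τ b c₂ γ H : ℝ}
    (hb : 0 < b) (hc₂ : 0 < c₂) (hγ : 0 ≤ γ) (hγ2 : γ ≤ 2) (hτ : 0 ≤ τ)
    (hτT : τ ≤ (N : ℝ) ^ 2 * T) (hH : 0 < H) (hτH : τ / (N : ℝ) ^ 2 ≤ H) (hΛ : 0 ≤ Λ) (x : ZMod N)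
    (h1 : ∀ y, Φ (fun s => gaertnerAt t y s ^ k) ≤ b ^ k)
    (h2 : ∀ y, Φ (fun s => (gaertnerAt t y s - gaertnerAt t x s) ^ k)
      ≤ (c₂ * ((torusDist y x : ℝ) / N) ^ γ) ^ k) :
    Φ (fun s => (∑ y, kernelQ a τ x y * gaertnerAt t y s - gaertnerAt t x s) ^ k)
      ≤ (2 * c₂ * H ^ (γ / 2) + Λ * b * H ^ (v / 2)) ^ k := by
  have hN0 : (0 : ℝ) < N := by positivity
  have hR : 0 < H ^ (γ / 2) := Real.rpow_pos_of_pos hH _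
  -- As `Q = p + D` and `p` has mass one, the step is a combination of two families: increments of
  -- the transform weighted by the heat kernel, and its values weighted by the difference kernel.
  set W : ZMod N ⊕ ZMod N → ℝ := Sum.elim (heatKernel N τ x) (kernelDiff a τ x)
  set Y : ZMod N ⊕ ZMod N → State N → ℝ :=
    Sum.elim (fun y s => gaertnerAt t y s - gaertnerAt t x s) (gaertnerAt t)
  set B : ZMod N ⊕ ZMod N → ℝ :=
    Sum.elim (fun y => c₂ * (H ^ (γ / 2) * (1 + ((torusDist x y : ℝ) / N) ^ 2 / H))) fun _ => b
  have hY : ∀ i, Dom heightWeight (Y i) := by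
    rintro (y | y)
    · exact (dom_gaertnerAt hN t y).sub (dom_gaertnerAt hN t x)
    · exact dom_gaertnerAt hN t y
  have hB : ∀ i, 0 < B i := by
    rintro (y | y)
    · simp only [B, Sum.elim_inl]; positivity
    · exact hb
  have hYB : ∀ i, Φ (fun s => Y i s ^ k) ≤ B i ^ k := by
    rintro (y | y)
    · refine (h2 y).trans ?_
      have h3 := rpow_le_rpow_half_mul (q := (torusDist x y : ℝ) / N) (by positivity) hH hγ hγ2
      have h4 : torusDist y x = torusDist x y := min_comm _ _
      rw [h4]
      simp only [B, Sum.elim_inl]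
      gcongr
    · exact h1 y
  have e : ∀ s, ∑ i, W i * Y i s = ∑ y, kernelQ a τ x y * gaertnerAt t y s - gaertnerAt t x s := by
    intro s
    simp only [W, Y, Fintype.sum_sum_type, Sum.elim_inl, Sum.elim_inr, mul_sub,
      Finset.sum_sub_distrib, ← Finset.sum_mul, sum_heatKernel, one_mul]
    rw [sub_add_eq_add_sub, ← Finset.sum_add_distrib]
    congr 1
    refine Finset.sum_congr rfl fun y _ => ?_
    simp only [kernelDiff]; ring
  have h := hΦ.sum_pow_le hk hk0 hY W hB hYB
  simp only [e] at h
  refine h.trans (pow_le_pow_left₀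
    (Finset.sum_nonneg fun i _ => mul_nonneg (abs_nonneg _) (hB i).le) ?_ k)
  rw [Fintype.sum_sum_type]
  simp only [W, B, Sum.elim_inl, Sum.elim_inr, abs_of_nonneg (heatKernel_nonneg hτ x _)]
  refine add_le_add ?_ ?_
  · have h3 := sum_heatKernel_mul_torusDist_sq_le hτ x
    have e2 : ∑ y, heatKernel N τ x y
          * (c₂ * (H ^ (γ / 2) * (1 + ((torusDist x y : ℝ) / N) ^ 2 / H)))
        = c₂ * H ^ (γ / 2) * (∑ y, heatKernel N τ x y
          + (∑ y, heatKernel N τ x y * (torusDist x y : ℝ) ^ 2) / (N ^ 2 * H)) := by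
      rw [Finset.sum_div, ← Finset.sum_add_distrib, Finset.mul_sum]
      refine Finset.sum_congr rfl fun y _ => ?_
      field_simp
    rw [e2, sum_heatKernel]
    have h4 : (∑ y, heatKernel N τ x y * (torusDist x y : ℝ) ^ 2) / (N ^ 2 * H) ≤ 1 := by
      rw [div_le_one (by positivity)]
      refine h3.trans ?_
      rwa [div_le_iff₀ (by positivity), mul_comm] at hτH
    calc _ ≤ c₂ * H ^ (γ / 2) * (1 + 1) := by gcongr
      _ = _ := by ring
  · rw [← Finset.sum_mul]
    have h3 := hG.diff_sum_le τ hτ hτT x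
    have h4 : (τ / (N : ℝ) ^ 2) ^ (v / 2) ≤ H ^ (v / 2) :=
      Real.rpow_le_rpow (by positivity) hτH (by positivity)
    calc _ ≤ (τ / (N : ℝ) ^ 2) ^ (v / 2) * Λ * b := by gcongr
      _ ≤ H ^ (v / 2) * Λ * b := by gcongr
      _ = _ := by ring

/-- The moment bound for the time increments of the Gärtner transform in a good environment. -/
theorem exists_time_bound {A : ℝ} (hA : 0 ≤ A) (K₀ Λ T : ℝ) {K : ℕ} (hK : Even K) {u β v : ℝ}
    (hu : 0 < u) (hu1 : u < 1) (hβ : 0 < β) (hv : 0 < v) :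
    ∃ c : ℝ, 0 < c ∧ ∀ (N : ℕ) [NeZero N], 2 ≤ N → ∀ a : ZMod N → ℝ, (∀ x, 0 ≤ a x) →
      (∀ x, a x ≤ A) → ∀ α w : ℝ, (w = u ∨ w = 1) → GoodEnv α w v Λ T a → ∀ s₀ ∈ validStates N,
      (∀ y, gaertnerAt 0 y s₀ ≤ K₀) →
      (∀ y y', |gaertnerAt 0 y s₀ - gaertnerAt 0 y' s₀|
        ≤ K₀ * ((torusDist y y' : ℝ) / N) ^ β) →
      ∀ t τ, 0 ≤ t → 0 ≤ τ → t + τ ≤ (N : ℝ) ^ 2 * T → ∀ x,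
        evol (jumpGen (pairRate (rate a)) (pairJump jump))
            (diagFun (evol (jumpGen (rate a) jump) (fun f => f s₀) t)) τ
            (fun p => (gaertnerAt (t + τ) x p.2 - gaertnerAt t x p.1) ^ (K + 2))
          ≤ (c * (max τ 1 / (N : ℝ) ^ 2) ^ min (u / 4) (min (β / 2) (v / 2))) ^ (K + 2) := by
  obtain ⟨b, hb, hmom⟩ := exists_moment_bound hA K₀ Λ T hK
  obtain ⟨c₂, hc₂, hspace⟩ := exists_space_bound hA K₀ Λ T hK hu hu1 (β := β) hv
  set C := convolutionConst A K
  have hC : 1 ≤ C := convolutionConst_ge hA K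
  set T₁ : ℝ := max T 1
  have hT₁ : 1 ≤ T₁ := le_max_right _ _
  refine ⟨2 * (C * (1 + |Λ| * b + 2 * Λ ^ 2 * b ^ 2) * T₁ ^ (1 / 4 : ℝ)
    + (2 * c₂ + |Λ| * b * T₁ ^ (v / 2))), by positivity, ?_⟩
  intro N _ hN a ha haA α w hw hG s₀ hs₀ hK₀ hNS t τ ht hτ htτT x
  have hN0 : (0 : ℝ) < N := by positivity
  have htT : t ≤ (N : ℝ) ^ 2 * T := by linarith
  have hτT : τ ≤ (N : ℝ) ^ 2 * T := by linarith
  have hT : 0 ≤ T := by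
    by_contra hT
    have : (N : ℝ) ^ 2 * T < 0 := mul_neg_of_pos_of_neg (by positivity) (not_le.1 hT)
    linarith
  have hΛ := hG.one_le hT
  have hΛ0 : 0 ≤ Λ := by linarith
  rw [abs_of_nonneg hΛ0]
  have hKe : Even (K + 2) := hK.add even_two
  have hΦ₀ : PosFun (validStates N) (fun s => heightWeight s ^ (K + 2)) fun f => f s₀ :=
    posFun_eval hs₀
  have hJ := jumpBounds hN ha haA
  have hΦ := (hJ.pow (K + 2)).posFun_evol hΦ₀ ht
  set Φ := evol (jumpGen (rate a) jump) (fun f => f s₀) t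
  have hΦb : ∀ y, Φ (fun s => gaertnerAt t y s ^ (K + 2)) ≤ b ^ (K + 2) :=
    hmom N hN a ha haA α w v hG s₀ hs₀ hK₀ t ht htT
  have hγ : min (u / 4) (min (β / 2) (v / 2)) = min (u / 2) (min β v) / 2 := by
    rw [← min_div_div_right (by norm_num), ← min_div_div_right (by norm_num)]
    congr 1; ring
  rw [hγ]
  set γ := min (u / 2) (min β v)
  have hγu : γ ≤ u / 2 := min_le_left _ _
  have hγv : γ ≤ v := (min_le_right _ _).trans (min_le_right _ _)
  have hγ0 : 0 < γ := lt_min (by linarith) (lt_min hβ hv)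
  -- The cut-off at `1` is what makes `N^{-1/2} ≤ H^{1/4}`: over shorter time steps individual jumps
  -- dominate.
  set H : ℝ := max τ 1 / (N : ℝ) ^ 2
  have hH : 0 < H := by positivity
  have hτH : τ / (N : ℝ) ^ 2 ≤ H := by
    simp only [H]; gcongr; exact le_max_left _ _
  have hNH : 1 / (N : ℝ) ^ 2 ≤ H := by
    simp only [H]; gcongr; exact le_max_right _ _
  have hHT : H ≤ T₁ := by
    rw [div_le_iff₀ (by positivity)]
    refine max_le ?_ ?_
    · rw [mul_comm] at hτT
      exact hτT.trans (by gcongr; exact le_max_left _ _)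
    · have : (1 : ℝ) ≤ (N : ℝ) ^ 2 := one_le_pow₀ (by exact_mod_cast (by omega : 1 ≤ N))
      nlinarith
  have h1 := hG.kernelQ_step_moment_le hN hv hKe (by omega) hΦ hb hc₂ hγ0.le (by linarith) hτ hτT
    hH hτH hΛ0 x hΦb
    fun y => hspace N hN a ha haA α w hw hG s₀ hs₀ hK₀ hNS t ht htT y x
  have hP := (hJ.pair.pow (K + 2)).posFun_evol hΦ.diag hτ
  rcases eq_or_lt_of_le hτ with rfl | hτ0
  · rw [evol_zero]
    have : diagFun Φ (fun p => (gaertnerAt (t + 0) x p.2 - gaertnerAt t x p.1) ^ (K + 2)) = 0 := by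
      unfold diagFun
      simp only [add_zero, sub_self, zero_pow (by omega : K + 2 ≠ 0)]
      exact hΦ.zero
    rw [this]
    exact hKe.pow_nonneg _
  set G : ℝ := 1 + Λ * b + 2 * Λ ^ 2 * b ^ 2
  have hG0 : 0 ≤ G := by positivity
  set D : ℝ := H ^ (1 / 4 : ℝ)
  have hD0 : 0 < D := Real.rpow_pos_of_pos hH _
  have hD2 : D ^ 2 = H ^ (1 / 2 : ℝ) := by
    rw [← Real.rpow_natCast, ← Real.rpow_mul hH.le]
    congr 1; norm_num
  -- The rescaled step is bounded by `T₁`, so larger exponents may be lowered to `γ / 2` at the cost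
  -- of a constant.
  have hDγ : D ≤ T₁ ^ (1 / 4 : ℝ) * H ^ (γ / 2) :=
    rpow_le_rpow_mul_of_le hH hHT hT₁ (by linarith) (by linarith)
  have hvγ : H ^ (v / 2) ≤ T₁ ^ (v / 2) * H ^ (γ / 2) :=
    rpow_le_rpow_mul_of_le hH hHT hT₁ (by linarith) (by linarith)
  have hτT' : ∀ s ∈ Set.Ioo 0 τ, 0 < τ - s ∧ τ - s ≤ (N : ℝ) ^ 2 * T := fun s hs =>
    ⟨sub_pos.2 hs.2, (sub_le_self _ hs.1.le).trans hτT⟩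
  -- The process restarts from its law at time `t`; the semigroup property turns moments after the
  -- restart into moments at time `t + s`, where the uniform bound applies.
  have hkey := convolution_moment_le_of_const hN ha haA hK hΦ (Pi.single x 1) t hτ0 hb
    (fun s hs y => by
      rw [(hJ.pow (K + 2)).evol_evol hΦ₀ ((dom_gaertnerAt hN (t + s) y).pow (K + 2))]
      exact hmom N hN a ha haA α w v hG s₀ hs₀ hK₀ (t + s) (by linarith [hs.1])
        (by linarith [hs.2]) y)
    (M := Λ) (c₂ := 1 / N * Λ ^ 2) (p := 1 / 2) (C := 2 * Λ ^ 2) (D := D) (by norm_num) hΛ0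
    (fun s hs y => by
      obtain ⟨hr, hrT⟩ := hτT' s hs
      rw [kernelComb_single]
      exact hG.abs_kernelQ_le ha hT hr.le hrT x y)
    (fun s hs => by
      obtain ⟨hr, hrT⟩ := hτT' s hs
      simp only [kernelComb_single]
      rw [mul_assoc]
      refine mul_le_mul_of_nonneg_left ?_ (by positivity)
      refine (hG.sum_kernelQ_sq_le ha hT hr.le hrT x).trans ?_
      rw [← mul_one_div, show (1 / 2 : ℝ) - 1 = -(1 / 2) by norm_num]
      exact mul_le_mul_of_nonneg_left (inv_sqrt_add_one_le hr) (by positivity))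
    (by positivity) (by
      have h2 : τ ^ (1 / 2 : ℝ) / N ≤ D ^ 2 := by
        rw [hD2]
        calc τ ^ (1 / 2 : ℝ) / N = (τ / (N : ℝ) ^ 2) ^ (1 / 2 : ℝ) := by
              rw [Real.div_rpow hτ (by positivity), ← Real.rpow_natCast, ← Real.rpow_mul hN0.le]
              norm_num
          _ ≤ _ := Real.rpow_le_rpow (by positivity) hτH (by norm_num)
      calc 1 / N * Λ ^ 2 * (τ ^ (1 / 2 : ℝ) / (1 / 2)) = 2 * Λ ^ 2 * (τ ^ (1 / 2 : ℝ) / N) := by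
            ring
        _ ≤ _ := by gcongr)
    (by
      calc (N : ℝ) ^ (-(1 / 2) : ℝ) = (1 / (N : ℝ) ^ 2) ^ (1 / 4 : ℝ) := by
            rw [Real.div_rpow zero_le_one (by positivity), ← Real.rpow_natCast,
              ← Real.rpow_mul hN0.le, Real.one_rpow, Real.rpow_neg hN0.le, one_div]
            norm_num
        _ ≤ D := Real.rpow_le_rpow (by positivity) hNH (by norm_num))
  have e1 : ∀ z : State N, ∑ y, (Pi.single x 1 : ZMod N → ℝ) y * gaertnerAt (t + τ) y z
      = gaertnerAt (t + τ) x z := fun z => by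
    simp [Pi.single_apply]
  simp only [e1, kernelComb_single] at hkey
  calc _ ≤ 2 ^ (K + 2) * ((C * (G * D)) ^ (K + 2)
        + (2 * c₂ * H ^ (γ / 2) + Λ * b * H ^ (v / 2)) ^ (K + 2)) :=
        (hJ.evol_pair_pow_le hKe hΦ (dom_gaertnerAt hN (t + τ) x)
          (dom_sum_gaertnerAt hN t fun y => kernelQ a τ x y) (dom_gaertnerAt hN t x) hτ).trans
        (mul_le_mul_of_nonneg_left (add_le_add hkey h1) (by positivity))
    _ ≤ 2 ^ (K + 2) * (C * (G * D)
        + (2 * c₂ * H ^ (γ / 2) + Λ * b * H ^ (v / 2))) ^ (K + 2) :=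
        mul_le_mul_of_nonneg_left (pow_add_pow_le (by positivity) (by positivity) (by omega))
          (by positivity)
    _ ≤ 2 ^ (K + 2) * (C * (G * (T₁ ^ (1 / 4 : ℝ) * H ^ (γ / 2)))
        + (2 * c₂ * H ^ (γ / 2) + Λ * b * (T₁ ^ (v / 2) * H ^ (γ / 2)))) ^ (K + 2) := by
        gcongr
    _ = _ := by rw [← mul_pow]; congr 1; ring


/-! ### The martingale problem determines the transition probabilities -/

section MartingaleProblem

variable {Ω S J : Type*}

theorem measurable_eval_of_countable [Countable S] [MeasurableSpace S] [MeasurableSingletonClass S]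
    {m : MeasurableSpace Ω} {g : Ω → S → ℝ} (hg : ∀ s, Measurable fun ω => g ω s) {Y : Ω → S}
    (hY : Measurable Y) : Measurable fun ω => g ω (Y ω) := by
  have h : Measurable fun p : Ω × S => g p.1 p.2 := measurable_from_prod_countable_left hg
  exact h.comp (measurable_id.prodMk hY)

/-- A right-continuous process with values in a countable discrete space is jointly measurable. -/
theorem measurable_uncurry_of_right_cont [TopologicalSpace S] [DiscreteTopology S] [Countable S]
    [MeasurableSpace S] [MeasurableSingletonClass S] [MeasurableSpace Ω] {X : ℝ≥0 → Ω → S}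
    (hX : ∀ t, Measurable (X t))
    (hc : ∀ ω t, ContinuousWithinAt (fun s => X s ω) (Set.Ici t) t) (f : S → ℝ) :
    Measurable fun p : ℝ≥0 × Ω => f (X p.1 p.2) := by
  have hf : Measurable f := measurable_of_countable f
  -- Grid points to the right of `s` that decrease to it within `1 / (n + 1)`: the discretised
  -- process depends on time through an integer only, and right continuity gives the limit.
  set q : ℕ → ℝ≥0 → ℝ≥0 := fun n s => ((⌊s * (n + 1)⌋₊ : ℝ≥0) + 1) / (n + 1)
  have hq1 : ∀ n s, s ≤ q n s := fun n s => by
    rw [le_div_iff₀ (by positivity)]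
    exact (Nat.lt_floor_add_one _).le
  have hq2 : ∀ n s, q n s ≤ s + 1 / (n + 1) := fun n s => by
    rw [div_le_iff₀ (by positivity), add_mul, div_mul_cancel₀ _ (by positivity)]
    gcongr
    exact Nat.floor_le zero_le
  have hq : ∀ s, Tendsto (fun n => q n s) atTop (𝓝[Set.Ici s] s) := fun s => by
    refine tendsto_nhdsWithin_iff.2 ⟨?_, Eventually.of_forall fun n => hq1 n s⟩
    refine tendsto_of_tendsto_of_tendsto_of_le_of_le tendsto_const_nhds ?_ (fun n => hq1 n s)
      fun n => hq2 n s
    have : Tendsto (fun n : ℕ => s + 1 / ((n : ℝ≥0) + 1)) atTop (𝓝 (s + 0)) :=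
      tendsto_const_nhds.add tendsto_one_div_add_atTop_nhds_zero_nat
    rwa [add_zero] at this
  refine measurable_of_tendsto_metrizable (f := fun n p => f (X (q n p.1) p.2)) (fun n => ?_)
    (tendsto_pi_nhds.2 fun p => ?_)
  · have h1 : ∀ g : ℕ → ℝ≥0, Measurable fun p : ℕ × Ω => f (X (g p.1) p.2) := fun g =>
      measurable_from_prod_countable_right fun k => hf.comp (hX (g k))
    have h2 : Measurable fun s : ℝ≥0 => ⌊s * (n + 1)⌋₊ :=
      Nat.measurable_floor.comp (measurable_id.mul_const _)
    have h3 : Measurable fun p : ℝ≥0 × Ω => (⌊p.1 * ((n : ℝ≥0) + 1)⌋₊, p.2) :=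
      (h2.comp measurable_fst).prodMk measurable_snd
    have h4 := (h1 fun k => ((k : ℝ≥0) + 1) / (n + 1)).comp h3
    simp only [Function.comp_def] at h4
    exact h4
  · have hfc : Continuous f := continuous_of_discreteTopology
    exact (hfc.tendsto _).comp ((hc p.2 p.1).tendsto.comp (hq p.1))

theorem abs_integral_mul_comp_process_le [MeasurableSpace Ω] {P : Measure Ω}
    [IsProbabilityMeasure P] {X : ℝ≥0 → Ω → S} {w : Ω → ℝ} {W : ℝ}
    (hwW : ∀ ω, |w ω| ≤ W) {g : S → ℝ} {C : ℝ} (hg : ∀ s, |g s| ≤ C) (t : ℝ≥0) :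
    |∫ ω, w ω * g (X t ω) ∂P| ≤ W * C := by
  have := norm_integral_le_of_norm_le_const (μ := P) (f := fun ω => w ω * g (X t ω)) (C := W * C)
    (Eventually.of_forall fun ω => by
      rw [Real.norm_eq_abs, abs_mul]
      exact mul_le_mul (hwW ω) (hg _) (abs_nonneg _) ((abs_nonneg _).trans (hwW ω)))
  simpa using this

variable [Fintype J] [mΩ : MeasurableSpace Ω]

/-- The process `X` solves the martingale problem for jumps whose rates are the products of the
random coefficients `b`, known at time zero, and of the functions `r` of the state. -/
structure SolvesMartingaleProblem [TopologicalSpace S] [MeasurableSpace S] (P : Measure Ω)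
    (F : Filtration ℝ≥0 mΩ) (X : ℝ≥0 → Ω → S) (b : J → Ω → ℝ) (r : J → S → ℝ) (τ : J → S → S)
    (A : ℝ) : Prop where
  measurable_coeff : ∀ j, Measurable[F 0] (b j)
  coeff_nonneg : ∀ j ω, 0 ≤ b j ω
  coeff_le : ∀ j ω, b j ω ≤ A
  rate_nonneg : ∀ j s, 0 ≤ r j s
  rate_le : ∀ j s, r j s ≤ 1
  bound_nonneg : 0 ≤ A
  adapted : ∀ t, Measurable[F t] (X t)
  right_cont : ∀ ω t, ContinuousWithinAt (fun s => X s ω) (Set.Ici t) t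
  martingale : ∀ f : S → ℝ, (∃ C, ∀ s, |f s| ≤ C) →
    Martingale (fun (t : ℝ≥0) ω => f (X t ω)
      - ∫ s in (0 : ℝ)..t, jumpGen (fun j s => b j ω * r j s) τ f (X s.toNNReal ω)) F P

/-- The action of a single jump. -/
def jumpTerm (r : J → S → ℝ) (τ : J → S → S) (j : J) (f : S → ℝ) (s : S) : ℝ :=
  r j s * (f (τ j s) - f s)

/-- Separates the random environment from the dependence on the state, so that the coefficients,
known at time zero, can be moved into the weight against which the martingale is tested. -/
theorem jumpGen_mul_eq (b : J → ℝ) (r : J → S → ℝ) (τ : J → S → S) (f : S → ℝ) :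
    jumpGen (fun j s => b j * r j s) τ f = ∑ j, b j • jumpTerm r τ j f := by
  funext s
  simp only [jumpGen_apply, jumpTerm, Finset.sum_apply, Pi.smul_apply, smul_eq_mul, mul_assoc]

omit mΩ in
theorem measurable_gen_pow {b : J → Ω → ℝ} {r : J → S → ℝ} {τ : J → S → S}
    {m : MeasurableSpace Ω} (hb : ∀ j, Measurable[m] (b j)) (f : S → ℝ) (n : ℕ) (s : S) :
    Measurable[m] fun ω => (jumpGen (fun j s => b j ω * r j s) τ ^ n) f s := by
  induction n generalizing s with
  | zero => exact measurable_const
  | succ n ih =>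
    simp only [pow_succ', Module.End.mul_apply, jumpGen_apply]
    exact Finset.measurable_fun_sum _ fun j _ => ((hb j).mul_const _).mul ((ih _).sub (ih s))

namespace SolvesMartingaleProblem

variable [TopologicalSpace S] [MeasurableSpace S] {P : Measure Ω}
  {F : Filtration ℝ≥0 mΩ} {X : ℝ≥0 → Ω → S} {b : J → Ω → ℝ} {r : J → S → ℝ} {τ : J → S → S}
  {A : ℝ}

theorem jumpBounds (h : SolvesMartingaleProblem P F X b r τ A) (ω : Ω) :
    JumpBounds (fun j s => b j ω * r j s) τ Set.univ (fun _ => 1) A 1 where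
  rate_nonneg j s := mul_nonneg (h.coeff_nonneg j ω) (h.rate_nonneg j s)
  rate_le j s := (mul_le_of_le_one_right (h.coeff_nonneg j ω) (h.rate_le j s)).trans
    (h.coeff_le j ω)
  weight_nonneg _ := zero_le_one
  weight_le _ _ := by simp
  inv _ _ _ _ := Set.mem_univ _
  kappa_nonneg := h.bound_nonneg
  ratio_nonneg := zero_le_one

theorem abs_jumpTerm_le (h : SolvesMartingaleProblem P F X b r τ A) {f : S → ℝ} {C : ℝ}
    (hf : ∀ s, |f s| ≤ C) (j : J) (s : S) : |jumpTerm r τ j f s| ≤ 2 * C := by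
  rw [jumpTerm, abs_mul, abs_of_nonneg (h.rate_nonneg j s)]
  calc r j s * |f (τ j s) - f s| ≤ 1 * (|f (τ j s)| + |f s|) :=
        mul_le_mul (h.rate_le j s) (abs_sub _ _) (abs_nonneg _) zero_le_one
    _ ≤ 2 * C := by linarith [hf s, hf (τ j s)]

theorem abs_gen_pow_le (h : SolvesMartingaleProblem P F X b r τ A) {f : S → ℝ} {C : ℝ}
    (hf : ∀ s, |f s| ≤ C) (n : ℕ) (ω : Ω) (s : S) :
    |(jumpGen (fun j s => b j ω * r j s) τ ^ n) f s| ≤ C * (Fintype.card J * A * 2) ^ n := by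
  have := (h.jumpBounds ω).abs_gen_pow_le (f := f) (C := C) (by simpa using hf) n s
  norm_num at this
  exact this

theorem measurable_process (h : SolvesMartingaleProblem P F X b r τ A) (t : ℝ≥0) :
    Measurable (X t) :=
  (h.adapted t).mono (F.le t) le_rfl

variable [Countable S] [MeasurableSingletonClass S]

theorem measurable_gen_pow_process (h : SolvesMartingaleProblem P F X b r τ A) (f : S → ℝ) (n : ℕ)
    (t : ℝ≥0) :
    Measurable[F t] fun ω => (jumpGen (fun j s => b j ω * r j s) τ ^ n) f (X t ω) :=
  @measurable_eval_of_countable Ω S _ _ _ (F t) _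
    (fun s => (measurable_gen_pow h.measurable_coeff f n s).mono (F.mono zero_le) le_rfl) _
    (h.adapted t)

theorem measurable_comp_process (h : SolvesMartingaleProblem P F X b r τ A) (g : S → ℝ) (t : ℝ≥0) :
    Measurable fun ω => g (X t ω) := (measurable_of_countable g).comp (h.measurable_process t)

theorem measurable_uncurry_process [DiscreteTopology S]
    (h : SolvesMartingaleProblem P F X b r τ A) (g : S → ℝ) (t₀ : ℝ≥0) :
    Measurable fun p : ℝ × Ω => g (X (t₀ + p.1.toNNReal) p.2) :=
  (measurable_uncurry_of_right_cont h.measurable_process h.right_cont g).comp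
    ((measurable_const.add (measurable_real_toNNReal.comp measurable_fst)).prodMk measurable_snd)

variable [IsProbabilityMeasure P]

theorem integrable_mul_comp_process (h : SolvesMartingaleProblem P F X b r τ A) {w : Ω → ℝ} {W : ℝ}
    (hw : Measurable w) (hwW : ∀ ω, |w ω| ≤ W) {g : S → ℝ} {C : ℝ} (hg : ∀ s, |g s| ≤ C)
    (t : ℝ≥0) : Integrable (fun ω => w ω * g (X t ω)) P := by
  refine Integrable.of_bound (hw.mul (h.measurable_comp_process g t)).aestronglyMeasurable (W * C)
    (Eventually.of_forall fun ω => ?_)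
  rw [Real.norm_eq_abs, abs_mul]
  exact mul_le_mul (hwW ω) (hg _) (abs_nonneg _) ((abs_nonneg _).trans (hwW ω))

variable [DiscreteTopology S]

theorem intervalIntegrable_integral_mul (h : SolvesMartingaleProblem P F X b r τ A)
    {w : Ω → ℝ} {W : ℝ} (hw : Measurable w) (hwW : ∀ ω, |w ω| ≤ W) {g : S → ℝ} {C : ℝ}
    (hg : ∀ s, |g s| ≤ C) (t₀ : ℝ≥0) (x y : ℝ) :
    IntervalIntegrable (fun u : ℝ => ∫ ω, w ω * g (X (t₀ + u.toNNReal) ω) ∂P) volume x y := by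
  have hm : Measurable fun p : ℝ × Ω => w p.2 * g (X (t₀ + p.1.toNNReal) p.2) :=
    (hw.comp measurable_snd).mul (h.measurable_uncurry_process g t₀)
  rw [intervalIntegrable_iff]
  refine Measure.integrableOn_of_bounded (M := W * C) (by simp [Set.uIoc])
    (hm.stronglyMeasurable.integral_prod_right').aestronglyMeasurable
    (Eventually.of_forall fun u => ?_)
  exact abs_integral_mul_comp_process_le hwW hg _

/-- The martingale problem, in integrated form. -/
theorem integral_mul_process_add (h : SolvesMartingaleProblem P F X b r τ A) {t₀ : ℝ≥0}
    {w : Ω → ℝ} {W : ℝ}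
    (hw : Measurable[F t₀] w) (hwW : ∀ ω, |w ω| ≤ W) {f : S → ℝ} {C : ℝ} (hf : ∀ s, |f s| ≤ C)
    (s : ℝ≥0) :
    ∫ ω, w ω * f (X (t₀ + s) ω) ∂P = ∫ ω, w ω * f (X t₀ ω) ∂P
      + ∫ u in (0 : ℝ)..s, ∑ j, ∫ ω, w ω * b j ω
          * jumpTerm r τ j f (X (t₀ + u.toNNReal) ω) ∂P := by
  have hw' : Measurable w := hw.mono (F.le t₀) le_rfl
  have hb : ∀ j, Measurable (b j) := fun j => (h.measurable_coeff j).mono (F.le 0) le_rfl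
  set L : Ω → S → ℝ := fun ω => jumpGen (fun j s => b j ω * r j s) τ f
  have hL : ∀ ω s, L ω s = ∑ j, b j ω * jumpTerm r τ j f s := fun ω s => by
    simp only [L, jumpGen_mul_eq, Finset.sum_apply, Pi.smul_apply, smul_eq_mul]
  set Bd : ℝ := C * (Fintype.card J * A * 2) ^ 1
  have hLb : ∀ ω s, |L ω s| ≤ Bd := fun ω s => by
    simpa [L, Bd] using h.abs_gen_pow_le hf 1 ω s
  have hLm : ∀ t₀ : ℝ≥0, Measurable fun p : ℝ × Ω => L p.2 (X (t₀ + p.1.toNNReal) p.2) := by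
    intro t₀
    simp only [hL]
    exact Finset.measurable_fun_sum _ fun j _ =>
      ((hb j).comp measurable_snd).mul (h.measurable_uncurry_process _ t₀)
  have hLi : ∀ ω (x y : ℝ), IntervalIntegrable (fun u : ℝ => L ω (X u.toNNReal ω)) volume x y := by
    intro ω x y
    rw [intervalIntegrable_iff]
    refine Measure.integrableOn_of_bounded (M := Bd) (by simp [Set.uIoc]) ?_
      (Eventually.of_forall fun u => hLb ω _)
    have h1 : Measurable fun u : ℝ => L ω (X (0 + u.toNNReal) ω) :=
      (hLm 0).comp (measurable_id.prodMk measurable_const)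
    simp only [zero_add] at h1
    exact h1.aestronglyMeasurable
  set I : ℝ≥0 → Ω → ℝ := fun t ω => ∫ u in (0 : ℝ)..t, L ω (X u.toNNReal ω)
  have hM : Martingale (fun t ω => f (X t ω) - I t ω) F P := h.martingale f ⟨C, hf⟩
  have hwM : ∀ t, Integrable (fun ω => w ω * (f (X t ω) - I t ω)) P := fun t =>
    (hM.integrable t).bdd_mul hw'.aestronglyMeasurable (Eventually.of_forall hwW)
  -- The martingale property tested against a weight known at time `t₀`.
  have h1 : ∫ ω, w ω * (f (X (t₀ + s) ω) - I (t₀ + s) ω) ∂P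
      = ∫ ω, w ω * (f (X t₀ ω) - I t₀ ω) ∂P := by
    have e1 := condExp_stronglyMeasurable_mul_of_bound (F.le t₀) hw.stronglyMeasurable
      (hM.integrable (t₀ + s)) W (Eventually.of_forall hwW)
    have e2 := hM.condExp_ae_eq (le_self_add : t₀ ≤ t₀ + s)
    calc _ = ∫ ω, (P[w * fun ω => f (X (t₀ + s) ω) - I (t₀ + s) ω | F t₀]) ω ∂P :=
          (integral_condExp (F.le t₀)).symm
      _ = _ := by
          refine integral_congr_ae ?_
          filter_upwards [e1, e2] with ω h1 h2
          rw [h1, Pi.mul_apply, h2]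
  have hwf : ∀ t, Integrable (fun ω => w ω * f (X t ω)) P := fun t =>
    h.integrable_mul_comp_process hw' hwW hf t
  have hwI : ∀ t, Integrable (fun ω => w ω * I t ω) P := fun t => by
    have := (hwf t).sub (hwM t)
    refine this.congr (Eventually.of_forall fun ω => ?_)
    simp only [Pi.sub_apply]
    ring
  simp only [mul_sub] at h1
  rw [integral_sub (hwf _) (hwI _), integral_sub (hwf _) (hwI _)] at h1
  have h2 : ∫ ω, w ω * I (t₀ + s) ω ∂P - ∫ ω, w ω * I t₀ ω ∂P
      = ∫ ω, (∫ u in (0 : ℝ)..s, w ω * L ω (X (t₀ + u.toNNReal) ω)) ∂P := by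
    rw [← integral_sub (hwI _) (hwI _)]
    refine integral_congr_ae (Eventually.of_forall fun ω => ?_)
    simp only
    rw [← mul_sub, intervalIntegral.integral_const_mul]
    congr 1
    simp only [I]
    rw [intervalIntegral.integral_interval_sub_left (hLi ω _ _) (hLi ω _ _)]
    have := intervalIntegral.integral_comp_add_left (a := 0) (b := s)
      (fun u => L ω (X u.toNNReal ω)) (t₀ : ℝ)
    rw [add_zero] at this
    rw [NNReal.coe_add, ← this]
    refine intervalIntegral.integral_congr fun u hu => ?_
    rw [Set.uIcc_of_le (NNReal.coe_nonneg s)] at hu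
    rw [Real.toNNReal_add t₀.coe_nonneg hu.1, Real.toNNReal_coe]
  have hint : Integrable (Function.uncurry fun (u : ℝ) ω => w ω * L ω (X (t₀ + u.toNNReal) ω))
      ((volume.restrict (Set.uIoc (0 : ℝ) s)).prod P) := by
    have : IsFiniteMeasure (volume.restrict (Set.uIoc (0 : ℝ) s)) :=
      ⟨by simp [Set.uIoc]⟩
    refine Integrable.of_bound
      ((hw'.comp measurable_snd).mul (hLm t₀)).aestronglyMeasurable (W * Bd)
      (Eventually.of_forall fun p => ?_)
    rw [Function.uncurry, Real.norm_eq_abs, abs_mul]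
    exact mul_le_mul (hwW _) (hLb _ _) (abs_nonneg _) ((abs_nonneg _).trans (hwW p.2))
  rw [← intervalIntegral_integral_swap hint] at h2
  have h3 : ∀ u : ℝ, ∫ ω, w ω * L ω (X (t₀ + u.toNNReal) ω) ∂P
      = ∑ j, ∫ ω, w ω * b j ω * jumpTerm r τ j f (X (t₀ + u.toNNReal) ω) ∂P := by
    intro u
    rw [← integral_finsetSum]
    · refine integral_congr_ae (Eventually.of_forall fun ω => ?_)
      simp only [hL, Finset.mul_sum, mul_assoc]
    · intro j _
      refine h.integrable_mul_comp_process (hw'.mul (hb j)) (W := W * A) (fun ω => ?_)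
        (h.abs_jumpTerm_le hf j) _
      rw [Pi.mul_apply, abs_mul, abs_of_nonneg (h.coeff_nonneg j ω)]
      exact mul_le_mul (hwW ω) (h.coeff_le j ω) (h.coeff_nonneg j ω)
        ((abs_nonneg _).trans (hwW ω))
  simp only [h3] at h2
  linarith

end SolvesMartingaleProblem

end MartingaleProblem


/-! ### Taylor expansion of expectations. -/

namespace SolvesMartingaleProblem

variable {Ω S J : Type*} [Fintype J] [mΩ : MeasurableSpace Ω] [TopologicalSpace S]
  [Countable S] [MeasurableSpace S]
  [MeasurableSingletonClass S] {P : Measure Ω} [IsProbabilityMeasure P]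
  {F : Filtration ℝ≥0 mΩ} {X : ℝ≥0 → Ω → S} {b : J → Ω → ℝ} {r : J → S → ℝ} {τ : J → S → S}
  {A : ℝ}

theorem integrable_mul_gen_pow (h : SolvesMartingaleProblem P F X b r τ A) {t : ℝ≥0} {w : Ω → ℝ}
    {W : ℝ} (hw : Measurable w) (hwW : ∀ ω, |w ω| ≤ W) {f : S → ℝ} {C : ℝ}
    (hf : ∀ s, |f s| ≤ C) (n : ℕ) :
    Integrable (fun ω => w ω * (jumpGen (fun j s => b j ω * r j s) τ ^ n) f (X t ω)) P := by
  refine Integrable.of_bound (hw.mul ((h.measurable_gen_pow_process f n t).mono (F.le t)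
    le_rfl)).aestronglyMeasurable (W * (C * (Fintype.card J * A * 2) ^ n))
    (Eventually.of_forall fun ω => ?_)
  rw [Real.norm_eq_abs, abs_mul]
  exact mul_le_mul (hwW ω) (h.abs_gen_pow_le hf n ω _) (abs_nonneg _)
    ((abs_nonneg _).trans (hwW ω))

variable [DiscreteTopology S]

/-- Iterates the integrated martingale problem. The induction runs over all weights and test
functions at once: jump `j` passes to the weight `w * b j` and the test function `jumpTerm r τ j f`.
Each round costs the factor `card J * A * 2`, and time integration yields the factorial. -/
theorem abs_integral_sub_taylor_le (h : SolvesMartingaleProblem P F X b r τ A) {t₀ : ℝ≥0} (m : ℕ)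
    {w : Ω → ℝ} {W : ℝ} (hw : Measurable[F t₀] w) (hwW : ∀ ω, |w ω| ≤ W) {f : S → ℝ} {C : ℝ}
    (hf : ∀ s, |f s| ≤ C) (s : ℝ≥0) :
    |∫ ω, w ω * f (X (t₀ + s) ω) ∂P - ∑ n ∈ Finset.range m, (s : ℝ) ^ n / n.factorial
        * ∫ ω, w ω * (jumpGen (fun j s => b j ω * r j s) τ ^ n) f (X t₀ ω) ∂P|
      ≤ W * C * ((Fintype.card J * A * 2) * s) ^ m / m.factorial := by
  induction m generalizing w W f C s with
  | zero => simpa using abs_integral_mul_comp_process_le hwW hf (t₀ + s)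
  | succ m ih =>
    set ρ : ℝ := Fintype.card J * A * 2
    have hb : ∀ j, Measurable[F t₀] (b j) := fun j =>
      (h.measurable_coeff j).mono (F.mono zero_le) le_rfl
    have hw' : Measurable w := hw.mono (F.le t₀) le_rfl
    have hb' : ∀ j, Measurable (b j) := fun j => (hb j).mono (F.le t₀) le_rfl
    have hwb : ∀ j ω, |w ω * b j ω| ≤ W * A := fun j ω => by
      rw [abs_mul, abs_of_nonneg (h.coeff_nonneg j ω)]
      exact mul_le_mul (hwW ω) (h.coeff_le j ω) (h.coeff_nonneg j ω)
        ((abs_nonneg _).trans (hwW ω))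
    set a : ℕ → ℝ := fun n =>
      ∫ ω, w ω * (jumpGen (fun j s => b j ω * r j s) τ ^ n) f (X t₀ ω) ∂P
    have ha : ∀ n, a (n + 1) = ∑ j, ∫ ω, w ω * b j ω
        * (jumpGen (fun j s => b j ω * r j s) τ ^ n) (jumpTerm r τ j f) (X t₀ ω) ∂P := by
      intro n
      rw [← integral_finsetSum]
      · refine integral_congr_ae (Eventually.of_forall fun ω => ?_)
        simp only [pow_succ, Module.End.mul_apply]
        rw [jumpGen_mul_eq (fun j => b j ω), map_sum, Finset.sum_apply, Finset.mul_sum]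
        refine Finset.sum_congr rfl fun j _ => ?_
        rw [map_smul, Pi.smul_apply, smul_eq_mul, mul_assoc]
      · intro j _
        exact h.integrable_mul_gen_pow (hw'.mul (hb' j)) (hwb j) (h.abs_jumpTerm_le hf j) n
    set φ : ℝ → ℝ := fun u =>
      ∑ j, ∫ ω, w ω * b j ω * jumpTerm r τ j f (X (t₀ + u.toNNReal) ω) ∂P
    set ψ : ℝ → ℝ := fun u => ∑ n ∈ Finset.range m, u ^ n / n.factorial * a (n + 1)
    have hφψ : ∀ u, 0 ≤ u → |φ u - ψ u| ≤ W * C * ρ ^ (m + 1) / m.factorial * u ^ m := by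
      intro u hu
      have e : ψ u = ∑ j, ∑ n ∈ Finset.range m, u ^ n / n.factorial * ∫ ω, w ω * b j ω
          * (jumpGen (fun j s => b j ω * r j s) τ ^ n) (jumpTerm r τ j f) (X t₀ ω) ∂P := by
        simp only [ψ, ha, Finset.mul_sum]
        exact Finset.sum_comm
      rw [e]
      simp only [φ]
      rw [← Finset.sum_sub_distrib]
      calc _ ≤ ∑ _j : J, W * A * (2 * C) * (ρ * u) ^ m / m.factorial := by
            refine (Finset.abs_sum_le_sum_abs _ _).trans (Finset.sum_le_sum fun j _ => ?_)
            have := ih (hw.mul (hb j)) (hwb j) (h.abs_jumpTerm_le hf j) u.toNNReal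
            rwa [Real.coe_toNNReal u hu] at this
        _ = _ := by
            rw [Finset.sum_const, Finset.card_univ, nsmul_eq_mul, mul_pow, pow_succ]
            simp only [ρ]
            ring
    have hφi : IntervalIntegrable φ volume 0 s := by
      have e : φ = ∑ j, fun u : ℝ =>
          ∫ ω, w ω * b j ω * jumpTerm r τ j f (X (t₀ + u.toNNReal) ω) ∂P := by
        funext u
        simp [φ]
      rw [e]
      exact IntervalIntegrable.sum Finset.univ fun j _ =>
        h.intervalIntegrable_integral_mul (hw'.mul (hb' j)) (hwb j) (h.abs_jumpTerm_le hf j) t₀ 0 s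
    have hψi : IntervalIntegrable ψ volume 0 s := by
      refine Continuous.intervalIntegrable ?_ _ _
      simp only [ψ]
      fun_prop
    have hψ : ∫ u in (0 : ℝ)..s, ψ u
        = ∑ n ∈ Finset.range m, (s : ℝ) ^ (n + 1) / (n + 1).factorial * a (n + 1) := by
      simp only [ψ]
      rw [intervalIntegral.integral_finsetSum
        fun n _ => Continuous.intervalIntegrable (by fun_prop) _ _]
      refine Finset.sum_congr rfl fun n _ => ?_
      rw [intervalIntegral.integral_mul_const, intervalIntegral.integral_div, integral_pow,
        Nat.factorial_succ]
      push_cast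
      rw [zero_pow (by omega), sub_zero]
      field_simp
    have hstep : ∫ ω, w ω * f (X (t₀ + s) ω) ∂P
          - ∑ n ∈ Finset.range (m + 1), (s : ℝ) ^ n / n.factorial * a n
        = ∫ u in (0 : ℝ)..s, (φ u - ψ u) := by
      rw [intervalIntegral.integral_sub hφi hψi, hψ, Finset.sum_range_succ',
        h.integral_mul_process_add hw hwW hf s]
      simp only [a, pow_zero, Nat.factorial_zero, Nat.cast_one, div_one, one_mul,
        Module.End.one_apply]
      simp only [φ]
      ring
    change |_ - ∑ n ∈ Finset.range (m + 1), (s : ℝ) ^ n / n.factorial * a n| ≤ _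
    rw [hstep]
    calc |∫ u in (0 : ℝ)..s, (φ u - ψ u)|
        ≤ ∫ u in (0 : ℝ)..s, W * C * ρ ^ (m + 1) / m.factorial * u ^ m := by
          refine intervalIntegral.norm_integral_le_of_norm_le (f := fun u => φ u - ψ u)
            (g := fun u => W * C * ρ ^ (m + 1) / m.factorial * u ^ m) s.coe_nonneg
            (Eventually.of_forall fun u hu => hφψ u hu.1.le) ?_
          exact Continuous.intervalIntegrable (by fun_prop) _ _
      _ = _ := by
          rw [intervalIntegral.integral_const_mul, integral_pow, Nat.factorial_succ]
          push_cast
          rw [zero_pow (by omega), sub_zero]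
          field_simp
          ring

/-- The solution of the martingale problem has the transition probabilities of the jump process. -/
theorem integral_mul_process_eq (h : SolvesMartingaleProblem P F X b r τ A) {t₀ : ℝ≥0}
    {w : Ω → ℝ} {W : ℝ} (hw : Measurable[F t₀] w) (hwW : ∀ ω, |w ω| ≤ W) {f : S → ℝ} {C : ℝ}
    (hf : ∀ s, |f s| ≤ C) (s : ℝ≥0) :
    ∫ ω, w ω * f (X (t₀ + s) ω) ∂P = ∫ ω, w ω
      * evol (jumpGen (fun j s => b j ω * r j s) τ) (fun g => g (X t₀ ω)) s f ∂P := by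
  have hw' : Measurable w := hw.mono (F.le t₀) le_rfl
  set ρ : ℝ := Fintype.card J * A * 2
  have hρ : 0 ≤ ρ := mul_nonneg (mul_nonneg (Nat.cast_nonneg _) h.bound_nonneg) zero_le_two
  set G : ℕ → Ω → ℝ := fun n ω => (s : ℝ) ^ n / n.factorial
    * (w ω * (jumpGen (fun j s => b j ω * r j s) τ ^ n) f (X t₀ ω))
  have hGi : ∀ n, Integrable (G n) P := fun n =>
    (h.integrable_mul_gen_pow hw' hwW hf n).const_mul _
  have hsum : Summable fun n : ℕ => W * C * ((ρ * s) ^ n / n.factorial) :=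
    (Real.summable_pow_div_factorial (ρ * s)).mul_left _
  have hGs : Summable fun n => ∫ ω, ‖G n ω‖ ∂P := by
    refine Summable.of_nonneg_of_le (fun n => integral_nonneg fun ω => norm_nonneg _)
      (fun n => ?_) hsum
    have := integral_mono (hGi n).norm (integrable_const (W * C * ((ρ * s) ^ n / n.factorial)))
      fun ω => by
        simp only [G, Real.norm_eq_abs, abs_mul, abs_div, abs_pow, Nat.abs_cast,
          NNReal.abs_eq]
        calc _ ≤ (s : ℝ) ^ n / n.factorial * (W * (C * ρ ^ n)) := by
              refine mul_le_mul_of_nonneg_left ?_ (by positivity)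
              exact mul_le_mul (hwW ω) (h.abs_gen_pow_le hf n ω _) (abs_nonneg _)
                ((abs_nonneg _).trans (hwW ω))
          _ = _ := by rw [mul_pow]; ring
    simpa using this
  -- The partial sums converge to the integrated exponential series, and by the Taylor estimate also
  -- to the expectation of the process; limits are unique.
  have h1 := (hasSum_integral_of_summable_integral_norm hGi hGs).tendsto_sum_nat
  have h2 : Tendsto (fun m => ∑ n ∈ Finset.range m, ∫ ω, G n ω ∂P) atTop
      (𝓝 (∫ ω, w ω * f (X (t₀ + s) ω) ∂P)) := by
    have h3 : Tendsto (fun m : ℕ => W * C * ((ρ * s) ^ m / m.factorial)) atTop (𝓝 0) :=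
      hsum.tendsto_atTop_zero
    rw [tendsto_iff_norm_sub_tendsto_zero]
    refine squeeze_zero (fun _ => norm_nonneg _) (fun m => ?_) h3
    rw [norm_sub_rev, Real.norm_eq_abs]
    have := h.abs_integral_sub_taylor_le m hw hwW hf s
    simp only [G, integral_const_mul]
    rwa [mul_div_assoc] at this
  rw [tendsto_nhds_unique h2 h1]
  refine integral_congr_ae (Eventually.of_forall fun ω => ?_)
  simp only [G, evol]
  rw [← tsum_mul_left]
  exact tsum_congr fun n => by ring

end SolvesMartingaleProblem


/-! ### Point masses of the pair functional. -/

section PairFunctional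

variable {S J : Type*} [Fintype J] {c : J → S → ℝ} {τ : J → S → S} {V : Set S} {v : S → ℝ}
  {κ R : ℝ} {Φ : (S → ℝ) → ℝ}

/-- The indicator function of a state. -/
noncomputable def stateIndicator (s : S) : S → ℝ := Set.indicator {s} fun _ => 1

theorem stateIndicator_self (s : S) : stateIndicator s s = 1 := by simp [stateIndicator]

theorem stateIndicator_of_ne {s y : S} (h : y ≠ s) : stateIndicator s y = 0 := by
  simp [stateIndicator, h]

theorem stateIndicator_nonneg (s y : S) : 0 ≤ stateIndicator s y :=
  Set.indicator_nonneg (fun _ _ => zero_le_one) y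

theorem abs_stateIndicator_le (s y : S) : |stateIndicator s y| ≤ 1 := by
  rw [abs_of_nonneg (stateIndicator_nonneg s y)]
  exact Set.indicator_le_self' (fun _ _ => zero_le_one) y

theorem stateIndicator_mul (s y : S) (g : S → ℝ) :
    stateIndicator s y * g y = g s * stateIndicator s y := by
  rcases eq_or_ne y s with rfl | h
  · exact mul_comm _ _
  · rw [stateIndicator_of_ne h, zero_mul, mul_zero]

theorem dom_stateIndicator {W : S → ℝ} (hW : ∀ s, 0 < W s) (s : S) :
    Dom W (stateIndicator s) := by
  refine ⟨(W s)⁻¹, fun y => ?_⟩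
  rcases eq_or_ne y s with rfl | h
  · rw [inv_mul_cancel₀ (hW y).ne']
    exact abs_stateIndicator_le _ _
  · rw [stateIndicator_of_ne h, abs_zero]
    exact mul_nonneg (inv_nonneg.2 (hW s).le) (hW y).le

/-- The algebraic Markov property: fixing the first coordinate by a point mass restarts the second
one from that state, so the joint weight factorises. -/
theorem evol_pair_stateIndicator (t : ℝ) (s s' : S)
    (hΦ : ∀ x : ℝ, Φ (x • stateIndicator s) = x * Φ (stateIndicator s)) :
    evol (jumpGen (pairRate c) (pairJump τ)) (diagFun Φ) t
        (fun p => stateIndicator s p.1 * stateIndicator s' p.2)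
      = Φ (stateIndicator s) * evol (jumpGen c τ) (fun g => g s) t (stateIndicator s') := by
  simp only [evol, diagFun, jumpGen_pair_pow]
  rw [← tsum_mul_left]
  refine tsum_congr fun n => ?_
  have h1 : (fun y => (jumpGen c τ ^ n) (fun x => stateIndicator s y * stateIndicator s' x) y)
      = ((jumpGen c τ ^ n) (stateIndicator s') s) • stateIndicator s := by
    funext y
    have : (fun x => stateIndicator s y * stateIndicator s' x)
        = stateIndicator s y • stateIndicator s' := rfl
    rw [this, map_smul, Pi.smul_apply, smul_eq_mul, stateIndicator_mul, Pi.smul_apply,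
      smul_eq_mul]
  rw [h1, hΦ]
  ring

end PairFunctional

/-! ### Two-time laws given the environment. -/

namespace SolvesMartingaleProblem

variable {Ω S J : Type*} [Fintype J] [mΩ : MeasurableSpace Ω] [TopologicalSpace S]
  [MeasurableSpace S] {P : Measure Ω}
  {F : Filtration ℝ≥0 mΩ} {X : ℝ≥0 → Ω → S} {b : J → Ω → ℝ} {r : J → S → ℝ} {τ : J → S → S}
  {A : ℝ}

theorem abs_evol_le (h : SolvesMartingaleProblem P F X b r τ A) {f : S → ℝ} {C : ℝ}
    (hf : ∀ s, |f s| ≤ C) {t : ℝ} (ht : 0 ≤ t) (ω : Ω) (σ : S) :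
    |evol (jumpGen (fun j s => b j ω * r j s) τ) (fun g => g σ) t f|
      ≤ C * Real.exp (Fintype.card J * A * 2 * t) :=
  abs_exp_series_le (fun n => h.abs_gen_pow_le hf n ω σ) ht

theorem measurable_evol (h : SolvesMartingaleProblem P F X b r τ A) {f : S → ℝ} {C : ℝ}
    (hf : ∀ s, |f s| ≤ C) (t : ℝ) (σ : S) :
    Measurable[F 0] fun ω =>
      evol (jumpGen (fun j s => b j ω * r j s) τ) (fun g => g σ) t f := by
  refine @measurable_of_tendsto_metrizable Ω ℝ (F 0) _ _ _ _
    (fun m ω => ∑ n ∈ Finset.range m,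
      t ^ n / n.factorial * (jumpGen (fun j s => b j ω * r j s) τ ^ n) f σ) _ (fun m => ?_)
    (tendsto_pi_nhds.2 fun ω => ?_)
  · exact Finset.measurable_fun_sum _ fun n _ =>
      (measurable_gen_pow h.measurable_coeff f n σ).const_mul _
  · exact (summable_exp_series (fun n => h.abs_gen_pow_le hf n ω σ) t).hasSum.tendsto_sum_nat

variable [DiscreteTopology S] [Countable S] [MeasurableSingletonClass S] [IsProbabilityMeasure P]

/-- The two-time marginals of the process, jointly with the environment. -/
theorem integral_pair_eq (h : SolvesMartingaleProblem P F X b r τ A) {σ₀ : S}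
    (h0 : ∀ᵐ ω ∂P, X 0 ω = σ₀)
    {w : Ω → ℝ} {W : ℝ} (hw : Measurable[F 0] w) (hwW : ∀ ω, |w ω| ≤ W) (t s : ℝ≥0) (σ σ' : S) :
    ∫ ω, w ω * (stateIndicator σ (X t ω) * stateIndicator σ' (X (t + s) ω)) ∂P
      = ∫ ω, w ω * (evol (jumpGen (fun j s => b j ω * r j s) τ) (fun g => g σ₀) t
            (stateIndicator σ)
          * evol (jumpGen (fun j s => b j ω * r j s) τ) (fun g => g σ) s
            (stateIndicator σ')) ∂P := by
  set p : S → ℝ≥0 → S → Ω → ℝ := fun σ s σ' ω =>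
    evol (jumpGen (fun j s => b j ω * r j s) τ) (fun g => g σ) s (stateIndicator σ')
  have hσ : Measurable (stateIndicator σ) := measurable_of_countable _
  -- First the later time: the event `X t = σ` is part of the weight. In the next application, at
  -- time zero, the transition probability just obtained depends on the environment only and joins
  -- the weight.
  have h1 := h.integral_mul_process_eq (t₀ := t) (w := fun ω => w ω * stateIndicator σ (X t ω))
    (W := W) ((hw.mono (F.mono zero_le) le_rfl).mul (hσ.comp (h.adapted t)))
    (fun ω => by
      rw [abs_mul]
      exact mul_le_of_le_one_right (abs_nonneg _) (abs_stateIndicator_le _ _) |>.trans (hwW ω))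
    (abs_stateIndicator_le σ') s
  have h2 := h.integral_mul_process_eq (t₀ := 0) (w := fun ω => w ω * p σ s σ' ω)
    (hw.mul (h.measurable_evol (abs_stateIndicator_le σ') s σ))
    (fun ω => by
      rw [abs_mul]
      exact mul_le_mul (hwW ω) (h.abs_evol_le (abs_stateIndicator_le σ') s.coe_nonneg ω σ)
        (abs_nonneg _) ((abs_nonneg _).trans (hwW ω)))
    (abs_stateIndicator_le σ) t
  rw [zero_add] at h2
  calc _ = ∫ ω, w ω * stateIndicator σ (X t ω) * stateIndicator σ' (X (t + s) ω) ∂P := by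
        simp only [mul_assoc]
    _ = _ := h1
    _ = ∫ ω, w ω * p σ s σ' ω * stateIndicator σ (X t ω) ∂P := by
        refine integral_congr_ae (Eventually.of_forall fun ω => ?_)
        have := stateIndicator_mul σ (X t ω) fun x => p x s σ' ω
        simp only [p] at this ⊢
        rw [mul_assoc, this, mul_assoc]
    _ = _ := h2
    _ = _ := by
        refine integral_congr_ae ?_
        filter_upwards [h0] with ω hω
        simp only [p, hω]
        ring

/-- A bound for the evolved pair functional gives a bound for the expectations, given the
environment, of the functions of the process at two times. -/
theorem lintegral_pair_le (h : SolvesMartingaleProblem P F X b r τ A) {σ₀ : S}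
    (h0 : ∀ᵐ ω ∂P, X 0 ω = σ₀)
    {B : Set Ω} (hB : MeasurableSet[F 0] B) {V : Set S} {v : S → ℝ} {κ R : ℝ} (hσ₀ : σ₀ ∈ V)
    (hv : ∀ s, 0 < v s)
    (hJ : ∀ ω, JumpBounds (fun j s => b j ω * r j s) τ V v κ R) (k : ℕ) {f : S × S → ℝ}
    (hf0 : ∀ p, 0 ≤ f p) (hf : Dom (fun p : S × S => (v p.1 + v p.2) ^ k) f) (t s : ℝ≥0) {M : ℝ}
    (hM0 : 0 ≤ M)
    (hM : ∀ ω ∈ B, evol (jumpGen (pairRate fun j s => b j ω * r j s) (pairJump τ))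
      (diagFun (evol (jumpGen (fun j s => b j ω * r j s) τ) (fun g => g σ₀) t)) s f ≤ M) :
    ∫⁻ ω in B, ENNReal.ofReal (f (X t ω, X (t + s) ω)) ∂P ≤ ENNReal.ofReal M * P B := by
  have hB' : MeasurableSet B := F.le 0 B hB
  set Y : Ω → S × S := fun ω => (X t ω, X (t + s) ω)
  have hY : Measurable Y := (h.measurable_process t).prodMk (h.measurable_process (t + s))
  set e : S × S → S × S → ℝ := fun q p => stateIndicator q.1 p.1 * stateIndicator q.2 p.2
  have he : ∀ q ω, (Y ⁻¹' {q}).indicator (fun _ => (1 : ℝ)) ω = e q (Y ω) := by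
    intro q ω
    simp only [e]
    by_cases hq : Y ω = q
    · rw [Set.indicator_of_mem (by exact hq), hq, stateIndicator_self, stateIndicator_self, mul_one]
    · rw [Set.indicator_of_notMem (by exact hq)]
      by_cases h1 : (Y ω).1 = q.1
      · rw [stateIndicator_of_ne fun h2 => hq (Prod.ext h1 h2), mul_zero]
      · rw [stateIndicator_of_ne h1, zero_mul]
  have hed : ∀ q, Dom (fun p : S × S => (v p.1 + v p.2) ^ k) (e q) := by
    intro q
    have : e q = stateIndicator q := by
      funext p
      simp only [e]
      rcases eq_or_ne p q with rfl | hpq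
      · rw [stateIndicator_self, stateIndicator_self, stateIndicator_self, mul_one]
      · rw [stateIndicator_of_ne hpq]
        by_cases h1 : p.1 = q.1
        · rw [stateIndicator_of_ne fun h2 => hpq (Prod.ext h1 h2), mul_zero]
        · rw [stateIndicator_of_ne h1, zero_mul]
    rw [this]
    exact dom_stateIndicator (fun p => pow_pos (add_pos (hv _) (hv _)) k) q
  rw [← lintegral_map (f := fun p => ENNReal.ofReal (f p)) (μ := P.restrict B)
    (measurable_of_countable _) hY, lintegral_countable']
  -- As `f` may be unbounded, it is approximated from below by its restrictions to finite sets of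
  -- pairs of states, where the law of the process is already identified.
  rw [ENNReal.tsum_eq_iSup_sum]
  refine iSup_le fun T => ?_
  have hprob : ∀ q, ((P.restrict B).map Y) {q}
      = ENNReal.ofReal (∫ ω, B.indicator (fun _ => (1 : ℝ)) ω * e q (Y ω) ∂P) := by
    intro q
    have hm : MeasurableSet (Y ⁻¹' {q}) := hY (measurableSet_singleton q)
    rw [Measure.map_apply hY (measurableSet_singleton q), Measure.restrict_apply hm]
    have : (fun ω => B.indicator (fun _ => (1 : ℝ)) ω * e q (Y ω))
        = (Y ⁻¹' {q} ∩ B).indicator fun _ => 1 := by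
      funext ω
      rw [← he, mul_comm, ← Set.inter_indicator_mul]
      simp
    rw [this, integral_indicator_const _ (hm.inter hB'), smul_eq_mul, mul_one, Measure.real,
      ENNReal.ofReal_toReal (measure_ne_top _ _)]
  have hw : ∀ ω, |B.indicator (fun _ => (1 : ℝ)) ω| ≤ 1 := fun ω => by
    by_cases hω : ω ∈ B <;> simp [hω]
  have hei : ∀ q, Integrable (fun ω => B.indicator (fun _ => (1 : ℝ)) ω * e q (Y ω)) P := by
    intro q
    refine Integrable.of_bound ((measurable_const.indicator hB').mul
      ((measurable_of_countable (e q)).comp hY)).aestronglyMeasurable 1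
      (Eventually.of_forall fun ω => ?_)
    rw [Real.norm_eq_abs, abs_mul]
    refine mul_le_one₀ (hw ω) (abs_nonneg _) ?_
    simp only [e, abs_mul]
    exact mul_le_one₀ (abs_stateIndicator_le _ _) (abs_nonneg _) (abs_stateIndicator_le _ _)
  have hen : ∀ q ω, 0 ≤ B.indicator (fun _ => (1 : ℝ)) ω * e q (Y ω) := fun q ω =>
    mul_nonneg (Set.indicator_nonneg (fun _ _ => zero_le_one) _)
      (mul_nonneg (stateIndicator_nonneg _ _) (stateIndicator_nonneg _ _))
  set p : S → ℝ≥0 → S → Ω → ℝ := fun σ s σ' ω =>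
    evol (jumpGen (fun j s => b j ω * r j s) τ) (fun g => g σ) s (stateIndicator σ')
  have hlaw : ∀ q, ∫ ω, B.indicator (fun _ => (1 : ℝ)) ω * e q (Y ω) ∂P
      = ∫ ω, B.indicator (fun _ => (1 : ℝ)) ω * (p σ₀ t q.1 ω * p q.1 s q.2 ω) ∂P := fun q =>
    h.integral_pair_eq h0 (measurable_const.indicator hB) hw t s q.1 q.2
  have hpi : ∀ q : S × S, Integrable (fun ω => B.indicator (fun _ => (1 : ℝ)) ω
      * (p σ₀ t q.1 ω * p q.1 s q.2 ω)) P := by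
    intro q
    have hb := fun (σ : S) (s : ℝ≥0) σ' ω =>
      h.abs_evol_le (abs_stateIndicator_le σ') s.coe_nonneg ω σ
    have hm := fun (σ : S) (s : ℝ≥0) σ' =>
      (h.measurable_evol (abs_stateIndicator_le σ') s σ).mono (F.le 0) le_rfl
    refine Integrable.of_bound ((measurable_const.indicator hB').mul
      ((hm _ _ _).mul (hm _ _ _))).aestronglyMeasurable
      (1 * (1 * Real.exp (Fintype.card J * A * 2 * t)
        * (1 * Real.exp (Fintype.card J * A * 2 * s))))
      (Eventually.of_forall fun ω => ?_)
    rw [Real.norm_eq_abs, abs_mul]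
    refine mul_le_mul (hw ω) ?_ (abs_nonneg _) zero_le_one
    rw [abs_mul]
    exact mul_le_mul (hb _ _ _ _) (hb _ _ _ _) (abs_nonneg _) (by positivity)
  calc _ = ENNReal.ofReal (∑ q ∈ T, f q
        * ∫ ω, B.indicator (fun _ => (1 : ℝ)) ω * (p σ₀ t q.1 ω * p q.1 s q.2 ω) ∂P) := by
        rw [ENNReal.ofReal_sum_of_nonneg]
        · refine Finset.sum_congr rfl fun q _ => ?_
          rw [hprob, ← hlaw, ENNReal.ofReal_mul (hf0 q)]
        · intro q _
          rw [← hlaw]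
          exact mul_nonneg (hf0 q) (integral_nonneg (hen q))
    _ ≤ ENNReal.ofReal (∫ ω, B.indicator (fun _ => M) ω ∂P) := by
        refine ENNReal.ofReal_le_ofReal ?_
        simp only [← integral_const_mul]
        rw [← integral_finsetSum _ fun q _ => (hpi q).const_mul _]
        refine integral_mono (integrable_finsetSum _ fun q _ => (hpi q).const_mul _)
          ((integrable_const M).indicator hB') fun ω => ?_
        by_cases hω : ω ∈ B
        · simp only [Set.indicator_of_mem hω, one_mul]
          refine le_trans ?_ (hM ω hω)
          have hΦ : PosFun V (fun s => v s ^ k)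
              (evol (jumpGen (fun j s => b j ω * r j s) τ) (fun g => g σ₀) t) :=
            ((hJ ω).pow k).posFun_evol (posFun_eval hσ₀) t.coe_nonneg
          have hP := ((hJ ω).pair.pow k).posFun_evol hΦ.diag s.coe_nonneg
          have hpq : ∀ q : S × S, p σ₀ t q.1 ω * p q.1 s q.2 ω
              = evol (jumpGen (pairRate fun j s => b j ω * r j s) (pairJump τ))
                (diagFun (evol (jumpGen (fun j s => b j ω * r j s) τ) (fun g => g σ₀) t)) s
                (e q) := fun q =>
            (evol_pair_stateIndicator _ _ _ fun x => hΦ.smul x _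
              (dom_stateIndicator (fun s => pow_pos (hv s) k) q.1)).symm
          simp only [hpq, ← hP.smul _ _ (hed _)]
          rw [← hP.sum _ fun q _ => (hed q).smul _]
          -- The finite combination of point masses is `f` cut off to `T`, hence at most `f`;
          -- positivity of the evolved functional finishes.
          refine hP.mono (Dom.sum _ fun q _ => (hed q).smul _) hf fun y _ => ?_
          rw [Finset.sum_apply]
          simp only [Pi.smul_apply, smul_eq_mul]
          have hz : ∀ q, q ≠ y → e q y = 0 := by
            intro q hq
            simp only [e]
            by_cases h1 : y.1 = q.1
            · rw [stateIndicator_of_ne fun h2 => hq (Prod.ext h1 h2).symm, mul_zero]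
            · rw [stateIndicator_of_ne h1, zero_mul]
          by_cases hy : y ∈ T
          · rw [Finset.sum_eq_single_of_mem y hy fun q _ hq => by rw [hz q hq, mul_zero]]
            simp [e, stateIndicator_self]
          · rw [Finset.sum_eq_zero fun q hq => by
              rw [hz q fun hqy => hy (hqy ▸ hq), mul_zero]]
            exact hf0 y
        · simp [Set.indicator_of_notMem hω]
    _ = _ := by
        rw [integral_indicator_const _ hB', smul_eq_mul, mul_comm, ENNReal.ofReal_mul hM0,
          Measure.real, ENNReal.ofReal_toReal (measure_ne_top _ _)]

end SolvesMartingaleProblem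


/-! ### The good environments form a closed set -/

section ClosedGoodEnvironments

variable {N : ℕ} [NeZero N]

theorem continuous_kernelQ (t : ℝ) (x y : ZMod N) :
    Continuous fun a : ZMod N → ℝ => kernelQ a t x y := by
  have h1 : Continuous fun a : ZMod N → ℝ => t • hill a := by
    refine continuous_matrix fun x y => ?_
    simp only [Matrix.smul_apply, hill, smul_eq_mul]
    fun_prop
  exact (continuous_matrix_exp.comp h1).matrix_elem x y

/-- Uncountably many times are involved, so measurability is obtained through closedness: at fixed
time and sites each condition is a non-strict inequality between continuous functions of the
environment. -/
theorem isClosed_goodEnv (α w v Λ T : ℝ) :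
    IsClosed {a : ZMod N → ℝ | GoodEnv α w v Λ T a} := by
  have hQ : ∀ t x y, Continuous fun a : ZMod N → ℝ => kernelQ a t x y := continuous_kernelQ
  have hD : ∀ t x y, Continuous fun a : ZMod N → ℝ => kernelDiff a t x y := fun t x y =>
    (hQ t x y).sub continuous_const
  have hh : ∀ a : ZMod N → ℝ, holderSeminorm α (partialSum a) ≤ Λ ↔ ∀ p : ZMod N × ZMod N,
      |partialSum a p.1 p.2| / (((arc p.1 p.2).card : ℝ) / N) ^ α ≤ Λ := fun a =>
    ciSup_le_iff (Set.finite_range _).bddAbove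
  have e : {a : ZMod N → ℝ | GoodEnv α w v Λ T a} = {a | holderSeminorm α (partialSum a) ≤ Λ}
      ∩ {a | ∀ t, 0 ≤ t → t ≤ (N : ℝ) ^ 2 * T →
        (∀ x, ∑ y, kernelQ a t x y ≤ Λ) ∧ (∀ x y, kernelQ a t x y ≤ Λ / √(t + 1)) ∧
        (∀ x x' y, |kernelQ a t x y - kernelQ a t x' y|
          ≤ (torusDist x x' : ℝ) ^ w / (t + 1) ^ ((w + 1) / 2) * Λ) ∧
        (∀ x x', ∑ y, |kernelQ a t x y - kernelQ a t x' y|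
          ≤ (torusDist x x' : ℝ) ^ w / (t + 1) ^ (w / 2) * Λ) ∧
        (∀ x, ∑ y, |kernelDiff a t x y| ≤ (t / (N : ℝ) ^ 2) ^ (v / 2) * Λ) ∧
        (∀ x x', ∑ y, |kernelDiff a t x y - kernelDiff a t x' y|
          ≤ ((torusDist x x' : ℝ) ^ w / (1 + t) ^ (w / 2) * (N : ℝ) ^ (-v)
            + ((torusDist x x' : ℝ) / N) ^ w) * Λ) ∧
        (∀ x x' y, |kernelDiff a t x y - kernelDiff a t x' y|
          ≤ ((torusDist x x' : ℝ) ^ w / (1 + t) ^ ((w + 1) / 2) * (N : ℝ) ^ (-v)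
            + ((torusDist x x' : ℝ) / N) ^ w / (1 + t) ^ (1 / 2 : ℝ)) * Λ) ∧
        (∀ x y, ∀ t' ∈ Set.Icc t (t + 1), kernelQ a t' x y ≤ Λ * kernelQ a (t + 1) x y)} := by
    ext a
    constructor
    · intro h
      exact ⟨h.holder, fun t h0 hT => ⟨h.sum_le t h0 hT, h.sup_le t h0 hT, h.grad_sup_le t h0 hT,
        h.grad_sum_le t h0 hT, h.diff_sum_le t h0 hT, h.diff_grad_sum_le t h0 hT,
        h.diff_grad_sup_le t h0 hT, h.local_le t h0 hT⟩⟩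
    · rintro ⟨h, h'⟩
      exact ⟨h, fun t h0 hT => (h' t h0 hT).1, fun t h0 hT => (h' t h0 hT).2.1,
        fun t h0 hT => (h' t h0 hT).2.2.1, fun t h0 hT => (h' t h0 hT).2.2.2.1,
        fun t h0 hT => (h' t h0 hT).2.2.2.2.1, fun t h0 hT => (h' t h0 hT).2.2.2.2.2.1,
        fun t h0 hT => (h' t h0 hT).2.2.2.2.2.2.1, fun t h0 hT => (h' t h0 hT).2.2.2.2.2.2.2⟩
  rw [e]
  refine IsClosed.inter ?_ ?_
  · simp only [hh, Set.ofPred_forall]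
    refine isClosed_iInter fun p => isClosed_le (Continuous.div_const ?_ _) continuous_const
    simp only [partialSum]
    fun_prop
  · simp only [Set.ofPred_forall, Set.ofPred_and]
    refine isClosed_iInter fun t => isClosed_iInter fun _ => isClosed_iInter fun _ => ?_
    refine .inter (isClosed_iInter fun x => ?_) (.inter
      (isClosed_iInter fun x => isClosed_iInter fun y => ?_) (.inter
      (isClosed_iInter fun x => isClosed_iInter fun x' => isClosed_iInter fun y => ?_) (.inter
      (isClosed_iInter fun x => isClosed_iInter fun x' => ?_) (.inter
      (isClosed_iInter fun x => ?_) (.inter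
      (isClosed_iInter fun x => isClosed_iInter fun x' => ?_) (.inter
      (isClosed_iInter fun x => isClosed_iInter fun x' => isClosed_iInter fun y => ?_)
      (isClosed_iInter fun x => isClosed_iInter fun y => isClosed_iInter fun t' =>
        isClosed_iInter fun _ => ?_))))))) <;>
    exact isClosed_le (by fun_prop) (by fun_prop)

end ClosedGoodEnvironments

/-! ### Conditional norms -/

section ConditionalNorm

/-- This is `z^k ≤ 1 + z^n` for `z = |y| / M`; it replaces a real exponent by an even one. When the
`n`-th moment is at most `M^n`, both terms contribute `M^k`. -/
theorem enorm_rpow_le_add (y : ℝ) {k M : ℝ} (hk : 1 < k) {n : ℕ} (hkn : k ≤ n) (hn : Even n)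
    (hM : 0 < M) :
    ‖y‖ₑ ^ k ≤ ENNReal.ofReal (M ^ k)
      + ENNReal.ofReal (M ^ k / M ^ n) * ENNReal.ofReal (y ^ n) := by
  rw [← ofReal_norm, ENNReal.ofReal_rpow_of_nonneg (norm_nonneg _) (by linarith),
    ← ENNReal.ofReal_mul (by positivity), ← ENNReal.ofReal_add (by positivity)
      (mul_nonneg (by positivity) (hn.pow_nonneg _)), Real.norm_eq_abs, ← hn.pow_abs y]
  refine ENNReal.ofReal_le_ofReal ?_
  have h1 : |y| ^ k = M ^ k * (|y| / M) ^ k := by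
    rw [← Real.mul_rpow hM.le (by positivity), mul_div_cancel₀ _ hM.ne']
  have h2 : M ^ k / M ^ n * |y| ^ n = M ^ k * (|y| / M) ^ n := by
    rw [div_pow]; ring
  rw [h1, h2, ← mul_one_add]
  refine mul_le_mul_of_nonneg_left ?_ (by positivity)
  have h0 : 0 ≤ |y| / M := by positivity
  rcases le_total (|y| / M) 1 with h | h
  · have := Real.rpow_le_one h0 h (by linarith : 0 ≤ k)
    have := pow_nonneg h0 n
    linarith
  · have := Real.rpow_le_rpow_of_exponent_le h hkn
    rw [Real.rpow_natCast] at this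
    linarith

/-- A conditional expectation is bounded by a constant as soon as its integrals over all events of
the conditioning `σ`-algebra are; the indicator restricts these to subevents of `G`. The final
constant uses `(2 M^k)^{1/k} ≤ 2 M`, as `k > 1`. -/
theorem condLExp_rpow_le {Ω : Type*} {m mΩ : MeasurableSpace Ω} (hm : m ≤ mΩ) {P : Measure Ω}
    [IsProbabilityMeasure P] {G : Set Ω} (hG : MeasurableSet[m] G) {Y : Ω → ℝ} {k M : ℝ}
    (hk : 1 < k) {n : ℕ} (hkn : k ≤ n) (hn : Even n) (hM : 0 < M)
    (h : ∀ B, MeasurableSet[m] B → B ⊆ G →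
      ∫⁻ ω in B, ENNReal.ofReal (Y ω ^ n) ∂P ≤ ENNReal.ofReal (M ^ n) * P B) :
    ∀ᵐ ω ∂P, condLExp m P (G.indicator fun ω => ‖Y ω‖ₑ ^ k) ω ^ (1 / k)
      ≤ ENNReal.ofReal (2 * M) := by
  have h1 : ∀ B, MeasurableSet[m] B → B ⊆ G →
      ∫⁻ ω in B, ‖Y ω‖ₑ ^ k ∂P ≤ ENNReal.ofReal (2 * M ^ k) * P B := by
    intro B hB hBG
    calc _ ≤ ∫⁻ ω in B, (ENNReal.ofReal (M ^ k)
          + ENNReal.ofReal (M ^ k / M ^ n) * ENNReal.ofReal (Y ω ^ n)) ∂P :=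
          lintegral_mono fun ω => enorm_rpow_le_add (Y ω) hk hkn hn hM
      _ ≤ ENNReal.ofReal (M ^ k) * P B
          + ENNReal.ofReal (M ^ k / M ^ n) * (ENNReal.ofReal (M ^ n) * P B) := by
          rw [lintegral_add_left measurable_const, lintegral_const, Measure.restrict_apply_univ,
            lintegral_const_mul' _ _ ENNReal.ofReal_ne_top]
          gcongr
          exact h B hB hBG
      _ = _ := by
          rw [← mul_assoc, ← add_mul, ← ENNReal.ofReal_mul (by positivity),
            div_mul_cancel₀ _ (by positivity), ← ENNReal.ofReal_add (by positivity)
            (by positivity), two_mul]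
  have h2 : condLExp m P (G.indicator fun ω => ‖Y ω‖ₑ ^ k)
      ≤ᵐ[P.trim hm] fun _ => ENNReal.ofReal (2 * M ^ k) := by
    refine @ae_le_of_forall_setLIntegral_le_of_sigmaFinite Ω m (P.trim hm) _ _ _
      (measurable_condLExp m P _) fun B hB _ => ?_
    rw [setLIntegral_condLExp_trim hm P _ hB, setLIntegral_const, trim_measurableSet_eq hm hB,
      lintegral_indicator (hm _ hG), Measure.restrict_restrict (hm _ hG)]
    refine (h1 _ (hG.inter hB) Set.inter_subset_left).trans ?_
    gcongr
    exact Set.inter_subset_right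
  filter_upwards [ae_of_ae_trim hm h2] with ω hω
  calc _ ≤ ENNReal.ofReal (2 * M ^ k) ^ (1 / k) :=
        ENNReal.rpow_le_rpow hω (by positivity)
    _ ≤ ENNReal.ofReal ((2 * M) ^ k) ^ (1 / k) := by
        refine ENNReal.rpow_le_rpow (ENNReal.ofReal_le_ofReal ?_) (by positivity)
        rw [Real.mul_rpow zero_le_two hM.le]
        have : (2 : ℝ) ≤ 2 ^ k := by
          conv_lhs => rw [← Real.rpow_one 2]
          exact Real.rpow_le_rpow_of_exponent_le one_le_two hk.le
        gcongr
    _ = _ := by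
        rw [ENNReal.ofReal_rpow_of_nonneg (by positivity) (by positivity),
          ← Real.rpow_mul (by positivity), mul_one_div_cancel (by positivity), Real.rpow_one]

end ConditionalNorm


/-! ### Conditional norms of the exclusion process. -/

section Exclusion

variable {N : ℕ} [NeZero N] {Ω : Type*} [MeasurableSpace Ω] {P : Measure Ω}
  {a : Ω → ZMod N → ℝ} {η₀ : ZMod N → Bool} {X : ℝ≥0 → Ω → State N}

omit [NeZero N] in
theorem rate_eq_mul (a : ZMod N → ℝ) :
    rate a = fun j s => a j.1 * rate (fun _ => 1) j s := by
  funext j s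
  simp only [rate, one_mul]
  split_ifs <;> rfl

/-- The exclusion process solves the martingale problem for its jump rates. -/
theorem IsASEP.solvesMartingaleProblem (h : IsASEP P a η₀ X) (hN : 2 ≤ N) {A : ℝ} (hA : 0 ≤ A)
    (ha : ∀ ω x, 0 ≤ a ω x) (haA : ∀ ω x, a ω x ≤ A) :
    SolvesMartingaleProblem P (envFiltration a X h.measurable_env h.measurable_process) X
      (fun (j : ZMod N × Bool) ω => a ω j.1) (rate fun _ => 1) jump A where
  measurable_coeff j := by
    have h1 : Measurable[MeasurableSpace.comap a inferInstance] a := comap_measurable a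
    exact ((measurable_pi_apply j.1).comp h1).mono le_sup_left le_rfl
  coeff_nonneg j ω := ha ω j.1
  coeff_le j ω := haA ω j.1
  rate_nonneg := rate_nonneg hN fun _ => zero_le_one
  rate_le := rate_le hN (fun _ => zero_le_one) fun _ => le_rfl
  bound_nonneg := hA
  adapted t := by
    have h1 : Measurable[MeasurableSpace.comap (X t) inferInstance] (X t) := comap_measurable _
    exact h1.mono (le_sup_of_le_right (le_iSup₂_of_le t le_rfl le_rfl)) le_rfl
  right_cont := h.right_cont
  martingale f hf := by
    have := h.martingale f hf
    simp only [generator_eq, rate_eq_mul (a _)] at this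
    exact this

theorem heightWeight_pos (hN : 2 ≤ N) (s : State N) : 0 < heightWeight s :=
  add_pos_of_pos_of_nonneg one_pos (Finset.sum_nonneg fun y _ => (expHeight_pos hN y s).le)

variable [IsProbabilityMeasure P]

/-- A bound for the evolved pair functional in the environments of an event gives a bound for the
conditional norm on this event. -/
theorem IsASEP.condNorm_le (h : IsASEP P a η₀ X) (hN : 2 ≤ N) {A : ℝ} (hA : 0 ≤ A)
    (ha : ∀ ω x, 0 ≤ a ω x) (haA : ∀ ω x, a ω x ≤ A)
    (hη : 2 * (Finset.univ.filter fun x => η₀ x = true).card = N) {G : Set Ω}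
    (hG : MeasurableSet[MeasurableSpace.comap a inferInstance] G) {k M : ℝ} (hk : 1 < k) {n : ℕ}
    (hkn : k ≤ n) (hn : Even n) (hM : 0 < M) {y : State N × State N → ℝ}
    (hy : Dom (fun p : State N × State N => heightWeight p.1 + heightWeight p.2) y) (t s : ℝ≥0)
    (hyM : ∀ ω ∈ G, evol (jumpGen (pairRate (rate (a ω))) (pairJump jump))
      (diagFun (evol (jumpGen (rate (a ω)) jump) (fun g => g (η₀, initialHeight η₀)) t)) s
        (fun p => y p ^ n) ≤ M ^ n) :
    ∀ᵐ ω ∂P, condNorm P a G k (fun ω => y (X t ω, X (t + s) ω)) ω ≤ ENNReal.ofReal (2 * M) := by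
  refine condLExp_rpow_le h.measurable_env.comap_le hG hk hkn hn hM fun B hB hBG => ?_
  have hJ := h.solvesMartingaleProblem hN hA ha haA
  have hB0 : MeasurableSet[envFiltration a X h.measurable_env h.measurable_process 0] B :=
    le_sup_left (a := MeasurableSpace.comap a inferInstance) B hB
  refine hJ.lintegral_pair_le h.initial hB0 (initial_mem_validStates hN hη) (heightWeight_pos hN)
    (κ := A) (R := (tau N)⁻¹) (fun ω => ?_) n (f := fun p => y p ^ n) (fun p => hn.pow_nonneg _)
    (hy.pow n) t s (by positivity) fun ω hω => ?_
  · rw [← rate_eq_mul]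
    exact jumpBounds hN (ha ω) (haA ω)
  · have := hyM ω (hBG hω)
    rwa [rate_eq_mul] at this

omit [MeasurableSpace Ω] in
theorem measurableSet_goodEvent (α w v Λ T : ℝ) (a : Ω → ZMod N → ℝ) :
    MeasurableSet[MeasurableSpace.comap a inferInstance] (goodEvent α w v Λ T a) :=
  ⟨_, (isClosed_goodEnv α w v Λ T).measurableSet, rfl⟩

/-- One-time case: the first of the two times is zero, where the evolved functional is evaluation at
the initial state. -/
theorem IsASEP.condNorm_le_of_evol (h : IsASEP P a η₀ X) (hN : 2 ≤ N) {A : ℝ} (hA : 0 ≤ A)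
    (ha : ∀ ω x, 0 ≤ a ω x) (haA : ∀ ω x, a ω x ≤ A)
    (hη : 2 * (Finset.univ.filter fun x => η₀ x = true).card = N) {G : Set Ω}
    (hG : MeasurableSet[MeasurableSpace.comap a inferInstance] G) {k M : ℝ} (hk : 1 < k) {n : ℕ}
    (hkn : k ≤ n) (hn : Even n) (hM : 0 < M) {y : State N → ℝ} (hy : Dom heightWeight y) (t : ℝ≥0)
    (hyM : ∀ ω ∈ G, evol (jumpGen (rate (a ω)) jump) (fun g => g (η₀, initialHeight η₀)) t
        (fun z => y z ^ n) ≤ M ^ n) :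
    ∀ᵐ ω ∂P, condNorm P a G k (fun ω => y (X t ω)) ω ≤ ENNReal.ofReal (2 * M) := by
  have := h.condNorm_le hN hA ha haA hη hG hk hkn hn hM (y := fun p => y p.2)
    (hy.snd (heightWeight_nonneg hN)) 0 t fun ω hω => ?_
  · simpa only [zero_add] using this
  · rw [evol_pair_snd (g := fun z => y z ^ n)]
    have e : evol (jumpGen (rate (a ω)) jump) (fun g => g (η₀, initialHeight η₀)) ((0 : ℝ≥0) : ℝ)
        = fun g => g (η₀, initialHeight η₀) := funext fun g => evol_zero _ _ _
    rw [e]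
    exact hyM ω hω

-- Needed for coinciding sites, where the target bound may be zero while the general estimate asks
-- for a positive constant.
omit [NeZero N] [IsProbabilityMeasure P] in
theorem condNorm_zero (hm : Measurable a) [IsProbabilityMeasure P] (G : Set Ω) {k : ℝ} (hk : 0 < k)
    (ω : Ω) : condNorm P a G k (fun _ => 0) ω = 0 := by
  have h1 : (G.indicator fun _ : Ω => ‖(0 : ℝ)‖ₑ ^ k) = fun _ => 0 := by
    funext ω
    simp [ENNReal.zero_rpow_of_pos hk]
  rw [condNorm, h1, condLExp_eq_self hm.comap_le P (@measurable_const _ _ _ _ _)]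
  exact ENNReal.zero_rpow_of_pos (by positivity)

end Exclusion

end InhomASEP

/-! ### The moment and increment bounds for the process. -/

theorem mainTheorem8
    (α β A K : ℝ) (hα : 0 < α) (hβ : 0 < β) (hA : 0 < A)
    (u v k Λ T : ℝ) (hu : 0 < u) (hu1 : u < 1) (hv : 0 < v) (hvα : v < α) (hk : 1 < k) :
    ∃ c : ℝ, 0 < c ∧
      ∀ (N : ℕ) [NeZero N] (Ω : Type*) [MeasurableSpace Ω] (P : Measure Ω)
        [IsProbabilityMeasure P] (a : Ω → ZMod N → ℝ) (η₀ : ZMod N → Bool)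
        (X : ℝ≥0 → Ω → InhomASEP.State N),
        (∀ ω x, 1 / A ≤ a ω x ∧ a ω x ≤ A) →
        2 * (Finset.univ.filter fun x => η₀ x = true).card = N →
        InhomASEP.NearStationary β K η₀ →
        InhomASEP.IsASEP P a η₀ X →
        ∀ w : ℝ, (w = u ∨ w = 1) →
        ∀ (x x' : ZMod N) (t t' : ℝ≥0), (t : ℝ) ≤ (N : ℝ) ^ 2 * T → (t' : ℝ) ≤ (N : ℝ) ^ 2 * T →
          (∀ᵐ ω ∂P,
            InhomASEP.condNorm P a (InhomASEP.goodEvent α w v Λ T a) k (InhomASEP.Z X t x) ω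
              ≤ ENNReal.ofReal c) ∧
          (∀ᵐ ω ∂P,
            InhomASEP.condNorm P a (InhomASEP.goodEvent α w v Λ T a) k
                (fun ω => InhomASEP.Z X t x ω - InhomASEP.Z X t x' ω) ω
              ≤ ENNReal.ofReal
                (c * ((InhomASEP.torusDist x x' : ℝ) / N) ^ (min (u / 2) (min β v)))) ∧
          (∀ᵐ ω ∂P,
            InhomASEP.condNorm P a (InhomASEP.goodEvent α w v Λ T a) k
                (fun ω => InhomASEP.Z X t' x ω - InhomASEP.Z X t x ω) ω
              ≤ ENNReal.ofReal
                (c * (max |(t' : ℝ) - t| 1 / (N : ℝ) ^ 2)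
                  ^ (min (u / 4) (min (β / 2) (v / 2))))) := by
  open InhomASEP in
  -- The working exponent `n + 2` is even and at least `k`.
  set n : ℕ := 2 * ⌈k⌉₊
  have hn : Even n := even_two_mul _
  have hn2 : Even (n + 2) := hn.add even_two
  have hkn : k ≤ (n + 2 : ℕ) := by
    have := Nat.le_ceil k
    push_cast [n]
    have : (0 : ℝ) ≤ ⌈k⌉₊ := Nat.cast_nonneg _
    linarith
  obtain ⟨c₁, hc₁, h₁⟩ := exists_moment_bound hA.le K Λ T hn
  obtain ⟨c₂, hc₂, h₂⟩ := exists_space_bound hA.le K Λ T hn hu hu1 (β := β) hv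
  obtain ⟨c₃, hc₃, h₃⟩ := exists_time_bound hA.le K Λ T hn hu hu1 hβ hv
  -- The `2` is the loss in passing from even moments to conditional norms of order `k`.
  refine ⟨2 * (c₁ + c₂ + c₃), by positivity, ?_⟩
  intro N _ Ω _ P _ a η₀ X ha hη hNS hX w hw x x' t t' ht ht'
  have hN : 2 ≤ N := by
    have := NeZero.ne N
    omega
  have hN0 : (0 : ℝ) < N := by positivity
  have ha0 : ∀ ω x, 0 ≤ a ω x := fun ω x => (one_div_pos.2 hA).le.trans (ha ω x).1
  have haA : ∀ ω x, a ω x ≤ A := fun ω x => (ha ω x).2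
  have hs₀ := initial_mem_validStates hN hη
  have hG := measurableSet_goodEvent α w v Λ T a
  have htime : ∀ t t' : ℝ≥0, (t' : ℝ) ≤ (N : ℝ) ^ 2 * T → t ≤ t' → ∀ᵐ ω ∂P,
      condNorm P a (goodEvent α w v Λ T a) k (fun ω => Z X t' x ω - Z X t x ω) ω
        ≤ ENNReal.ofReal (2 * (c₁ + c₂ + c₃) * (max |(t' : ℝ) - t| 1 / (N : ℝ) ^ 2)
          ^ (min (u / 4) (min (β / 2) (v / 2)))) := by
    intro t t' ht' htt
    obtain ⟨s, rfl⟩ := exists_add_of_le htt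
    rw [NNReal.coe_add] at ht'
    have hs : |((t + s : ℝ≥0) : ℝ) - t| = s := by
      rw [NNReal.coe_add, add_sub_cancel_left, abs_of_nonneg s.coe_nonneg]
    rw [hs]
    have hq : 0 < (max (s : ℝ) 1 / (N : ℝ) ^ 2) ^ (min (u / 4) (min (β / 2) (v / 2))) :=
      Real.rpow_pos_of_pos (by positivity) _
    refine (hX.condNorm_le hN hA.le ha0 haA hη hG hk hkn hn2 (mul_pos hc₃ hq)
      (y := fun p => gaertnerAt (t + s) x p.2 - gaertnerAt t x p.1)
      (((dom_gaertnerAt hN _ x).snd (heightWeight_nonneg hN)).sub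
        ((dom_gaertnerAt hN _ x).fst (heightWeight_nonneg hN))) t s fun ω hω =>
      h₃ N hN (a ω) (ha0 ω) (haA ω) α w hw hω _ hs₀ hNS.1 hNS.2 t s t.coe_nonneg s.coe_nonneg
        ht' x).mono fun ω hω => hω.trans (ENNReal.ofReal_le_ofReal ?_)
    rw [mul_assoc]
    gcongr
    linarith
  refine ⟨?_, ?_, ?_⟩
  · refine (hX.condNorm_le_of_evol hN hA.le ha0 haA hη hG hk hkn hn2 hc₁ (dom_gaertnerAt hN t x) t
      fun ω hω => h₁ N hN (a ω) (ha0 ω) (haA ω) α w v hω _ hs₀ hNS.1 t t.coe_nonneg ht x).mono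
      fun ω hω => hω.trans (ENNReal.ofReal_le_ofReal ?_)
    linarith
  · rcases eq_or_ne x x' with rfl | hxx
    · simp only [sub_self]
      refine Eventually.of_forall fun ω => ?_
      rw [condNorm_zero hX.measurable_env _ (by linarith)]
      exact zero_le
    · have hd : (1 : ℝ) ≤ torusDist x x' := by exact_mod_cast torusDist_pos hxx
      have hq : 0 < ((torusDist x x' : ℝ) / N) ^ (min (u / 2) (min β v)) :=
        Real.rpow_pos_of_pos (by positivity) _
      refine (hX.condNorm_le_of_evol hN hA.le ha0 haA hη hG hk hkn hn2 (mul_pos hc₂ hq)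
        ((dom_gaertnerAt hN t x).sub (dom_gaertnerAt hN t x')) t
        fun ω hω => h₂ N hN (a ω) (ha0 ω) (haA ω) α w hw hω _ hs₀ hNS.1 hNS.2 t t.coe_nonneg ht
          x x').mono fun ω hω => hω.trans (ENNReal.ofReal_le_ofReal ?_)
      rw [mul_assoc]
      gcongr
      linarith
  · rcases le_total t t' with htt | htt
    · exact htime t t' ht' htt
    -- The increment and the time difference are symmetric up to sign, so the ordered case suffices.
    · filter_upwards [htime t' t ht htt] with ω hω
      rw [abs_sub_comm] at hω
      convert hω using 1
      simp only [condNorm]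
      congr 4
      funext ω
      rw [← enorm_neg, neg_sub]
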